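/- \textbf{Model.} Let $\lambda>0$, $\mu_o>0$, $\sigma^2>0$, and $\alpha_j,\beta_j>0$ for $j\in\{L,N\}$. Base stations (BSs) $X_0,X_1,\dots$ form a homogeneous Poisson point process of density $\lambda$ in $\mathbb R^2$; the typical user is at the origin. Given the BS locations, the link states $S_n\in\{L,N\}$ (LoS/NLoS) are independent, with $\Pr(S_n=j\mid X)=p_j(\|X_n\|)$, where $p_L(r)=e^{-0.0149r}$ and $p_N=1-p_L$. Put $\ell^j(r)=\beta_j r^{-\alpha_j}$. The user associates with the BS $o$ maximising $\ell^{S_n}(\|X_n\|)$ (minimum path loss). The aligned gain $G_o$ is exponential with rate $\mu_o$ and the misaligned gains $G_0,G_1,\dots$ are i.i.d. with a probability density $f_{G_x}$ on $(0,\infty)$ (log-logistic in the isotropic case); the pair (BS locations, link states), the aligned gain and the sequence of misaligned gains are independent. Let $I^j=\sum_{n\ne o,\,S_n=j}G_n\,\ell^j(\|X_n\|)\in[0,\infty]$, $$\mathsf{SINR}=\frac{G_o\,\ell^{S_o}(\|X_o\|)}{I^L+I^N+\sigma^2},\qquad C(T)=\Pr(\mathsf{SINR}\ge T),$$ where $\mathsf{SINR}=0$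 if the interference is infinite. For $r>0$, $i,j\in\{L,N\}$ put $\rho_{ij}(r)=(\beta_j r^{\alpha_i}/\beta_i)^{1/\alpha_j}$, let $i'$ be the state opposite to $i$, and set $$f_{r^i}(r)=2\pi\lambda p_i(r)\,r\exp\Big(-2\pi\lambda\Big[\int_0^r v\,p_i(v)\,dv+\int_0^{\rho_{ii'}(r)}v\,p_{i'}(v)\,dv\Big]\Big),$$ $$\mathcal L_{I_i^j}(s;r)=\exp\Big(-2\pi\lambda\int_0^\infty\Big(\int_{\rho_{ij}(r)}^\infty\big[1-e^{-s\,g\,\ell^j(v)}\big]\,v\,p_j(v)\,dv\Big)f_{G_x}(g)\,dg\Big),$$ where the integral may be infinite and $e^{-\infty}=0$. \textbf{Proposition (Coverage, ISO).} (a) For each $i$, $f_{r^i}$ is the density on $(0,\infty)$ of the association distance jointly with association in state $i$: $\Pr(S_o=i,\ \|X_o\|\in B)=\int_{B\cap(0,\infty)} f_{r^i}(r)\,dr$ for all Borel $B\subseteq\mathbb R$. (b) For each $j$ and $s\ge 0$, the conditional Laplace transform of the interference is $\mathbf E[e^{-sI^j}\mid S_o,\|X_o\|]=\mathcal L_{I_{S_o}^j}(s;\|X_o\|)$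 almost surely. (c) For every $T>0$ the following integrands are integrable on $(0,\infty)$, and $$C(T)=\sum_{i\in\{L,N\}}\int_0^\infty f_{r^i}(r)\,\exp\Big(-\frac{\mu_oTr^{\alpha_i}\sigma^2}{\beta_i}\Big)\,\mathcal L_{I_i^L}\Big(\frac{\mu_oT}{\ell^i(r)};r\Big)\,\mathcal L_{I_i^N}\Big(\frac{\mu_oT}{\ell^i(r)};r\Big)\,dr .$$ -/

import Mathlib

open MeasureTheory ProbabilityTheory
open scoped ENNReal NNReal

noncomputable section

namespace MmWave

/-- The plane in which the base stations live; the typical user sits at the origin. -/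
abbrev Plane : Type := EuclideanSpace ℝ (Fin 2)

/-- The state of a link: line of sight (`L`) or non line of sight (`N`). -/
inductive LinkState : Type
  | L
  | N
  deriving DecidableEq

instance : Fintype LinkState where
  elems := {.L, .N}
  complete := by intro j; cases j <;> simp

instance : MeasurableSpace LinkState := ⊤

/-- The opposite link state. -/
def LinkState.other : LinkState → LinkState
  | .L => .N
  | .N => .L

/-! ### Point processes, thinning -/

/-- The number (with multiplicity) of points of the sequence `X` that lie in `B`. -/
def pointCount {Ω E : Type*} (X : ℕ → Ω → E) (B : Set E) (ω : Ω) : ℕ∞ :=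
  {n : ℕ | X n ω ∈ B}.encard

/-- The random points `X 0, X 1, …` enumerate a Poisson point process of intensity measure `Λ`:
the number of points in a measurable set of finite intensity is Poisson distributed with mean the
intensity of the set, and the numbers of points in pairwise disjoint sets are independent. -/
structure IsPoissonPointProcess {Ω E : Type*} [MeasurableSpace Ω] [MeasurableSpace E]
    (P : Measure Ω) (Λ : Measure E) (X : ℕ → Ω → E) : Prop where
  measurable : ∀ n, Measurable (X n)
  count_law : ∀ B : Set E, MeasurableSet B → Λ B ≠ ∞ → ∀ k : ℕ,
    P {ω | pointCount X B ω = k} =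
      ENNReal.ofReal (Real.exp (-(Λ B).toReal) * (Λ B).toReal ^ k / (k.factorial : ℝ))
  count_indep : ∀ (m : ℕ) (B : Fin m → Set E), (∀ i, MeasurableSet (B i)) →
    (∀ i, Λ (B i) ≠ ∞) → Pairwise (fun i j => Disjoint (B i) (B j)) →
    iIndepFun (fun i ω => pointCount X (B i) ω) P

/-- The probability `p_j(r)` that a link of length `r` is in state `j`. -/
def linkProb : LinkState → ℝ → ℝ
  | .L, r => Real.exp (-0.0149 * r)
  | .N, r => 1 - Real.exp (-0.0149 * r)

/-- Given the locations `X` of all base stations, the link states `S n` are independent, and the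
link of length `‖X n‖` from base station `n` to the origin is in state `j` with probability
`p_j(‖X n‖)`. -/
structure IsStateThinning {Ω : Type*} [MeasurableSpace Ω] (P : Measure Ω)
    (X : ℕ → Ω → Plane) (S : ℕ → Ω → LinkState) : Prop where
  measurable : ∀ n, Measurable (S n)
  cond_law : ∀ A : Set (ℕ → Plane), MeasurableSet A →
    ∀ (J : Finset ℕ) (s : ℕ → LinkState),
      P {ω | (fun n => X n ω) ∈ A ∧ ∀ n ∈ J, S n ω = s n} =
        ∫⁻ ω in {ω | (fun n => X n ω) ∈ A},
          ∏ n ∈ J, ENNReal.ofReal (linkProb (s n) ‖X n ω‖) ∂P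

/-- The channel gains: the aligned gain `Go` is exponential with rate `μo`, the misaligned gains
`G n` are i.i.d. with density `fG` on `(0, ∞)`, and the base station locations together with the
link states, the aligned gain, and the misaligned gains are independent. -/
structure IsGainModel {Ω : Type*} [MeasurableSpace Ω] (P : Measure Ω)
    (X : ℕ → Ω → Plane) (S : ℕ → Ω → LinkState) (μo : ℝ) (fG : ℝ → ℝ)
    (Go : Ω → ℝ) (G : ℕ → Ω → ℝ) : Prop where
  measurable_aligned : Measurable Go
  measurable_misaligned : ∀ n, Measurable (G n)
  aligned_law : P.map Go = expMeasure μo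
  misaligned_law : ∀ n, P.map (G n) =
    (volume.restrict (Set.Ioi (0 : ℝ))).withDensity (fun g => ENNReal.ofReal (fG g))
  misaligned_iIndep : iIndepFun G P
  aligned_indep : IndepFun Go (fun ω n => G n ω) P
  gains_indep : IndepFun (fun ω => ((fun n => X n ω), (fun n => S n ω)))
    (fun ω => (Go ω, (fun n => G n ω))) P

/-! ### Path loss, association, SINR -/

/-- The path loss attenuation `ℓ^j(r) = β_j r^{-α_j}`. -/
def pathLoss (α β : LinkState → ℝ) (j : LinkState) (r : ℝ) : ℝ :=
  β j * r ^ (-α j)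

/-- The index of the serving base station: the one of largest attenuation factor
`ℓ^{S n}(‖X n‖)`, that is, of maximum average received power. (The least index is taken in case
of ties, and `0` if there is no maximum; both have probability zero in the model.) -/
def serving {Ω : Type*} (α β : LinkState → ℝ) (X : ℕ → Ω → Plane) (S : ℕ → Ω → LinkState)
    (ω : Ω) : ℕ :=
  sInf {n : ℕ | ∀ m, pathLoss α β (S m ω) ‖X m ω‖ ≤ pathLoss α β (S n ω) ‖X n ω‖}

/-- The link state of the serving base station. -/
def servingState {Ω : Type*} (α β : LinkState → ℝ) (X : ℕ → Ω → Plane)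
    (S : ℕ → Ω → LinkState) (ω : Ω) : LinkState :=
  S (serving α β X S ω) ω

/-- The association distance: the distance from the origin to the serving base station. -/
def servingDist {Ω : Type*} (α β : LinkState → ℝ) (X : ℕ → Ω → Plane)
    (S : ℕ → Ω → LinkState) (ω : Ω) : ℝ :=
  ‖X (serving α β X S ω) ω‖

/-- The interference from the non-serving base stations in state `j`, possibly infinite. -/
def interference {Ω : Type*} (α β : LinkState → ℝ) (X : ℕ → Ω → Plane)
    (S : ℕ → Ω → LinkState) (G : ℕ → Ω → ℝ) (j : LinkState) (ω : Ω) : ℝ≥0∞ :=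
  ∑' n : ℕ, if n ≠ serving α β X S ω ∧ S n ω = j then
    ENNReal.ofReal (G n ω * pathLoss α β j ‖X n ω‖) else 0

/-- The SINR of the typical user (`0` if the interference is infinite). -/
def sinr {Ω : Type*} (α β : LinkState → ℝ) (σ2 : ℝ) (X : ℕ → Ω → Plane)
    (S : ℕ → Ω → LinkState) (Go : Ω → ℝ) (G : ℕ → Ω → ℝ) (ω : Ω) : ℝ≥0∞ :=
  ENNReal.ofReal (Go ω * pathLoss α β (servingState α β X S ω) (servingDist α β X S ω)) /
    (interference α β X S G .L ω + interference α β X S G .N ω + ENNReal.ofReal σ2)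

/-- The coverage probability `C(T) = P(SINR ≥ T)`. -/
def coverage {Ω : Type*} [MeasurableSpace Ω] (P : Measure Ω) (α β : LinkState → ℝ) (σ2 : ℝ)
    (X : ℕ → Ω → Plane) (S : ℕ → Ω → LinkState) (Go : Ω → ℝ) (G : ℕ → Ω → ℝ) (T : ℝ) : ℝ :=
  P.real {ω | ENNReal.ofReal T ≤ sinr α β σ2 X S Go G ω}

/-! ### The closed-form expressions -/

/-- The distance `(β_j r^{α_i} / β_i)^{1/α_j}` at which a link in state `j` has the same path loss
as a link of length `r` in state `i`. -/
def exclusionRadius (α β : LinkState → ℝ) (i j : LinkState) (r : ℝ) : ℝ :=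
  (β j * r ^ α i / β i) ^ (1 / α j)

/-- The density `f_{r^i}(r)` of the association distance, jointly with association in state `i`:
`2π λ p_i(r) r exp(-2πλ [∫_0^r v p_i(v) dv + ∫_0^{(β_{i'} r^{α_i}/β_i)^{1/α_{i'}}} v p_{i'}(v) dv])`
with `i'` the state opposite to `i`. -/
def assocPDF (lam : ℝ) (α β : LinkState → ℝ) (i : LinkState) (r : ℝ) : ℝ :=
  2 * Real.pi * (lam * linkProb i r) * r *
    Real.exp (-2 * Real.pi * lam *
      ((∫ v in (0 : ℝ)..r, v * linkProb i v) +
        ∫ v in (0 : ℝ)..exclusionRadius α β i i.other r, v * linkProb i.other v))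

/-- `e^{-t}` for `t ∈ [0, ∞]`, with `e^{-∞} = 0`. -/
def expNeg (t : ℝ≥0∞) : ℝ :=
  if t = ∞ then 0 else Real.exp (-t.toReal)

/-- The formula for the Laplace transform at `s` of the interference from the base stations in
state `j`, when the serving base station is in state `i` at distance `r`:
`exp(-2πλ ∫_0^∞ (∫_{(β_j r^{α_i}/β_i)^{1/α_j}}^∞ [1 - exp(-s g ℓ^j(v))] v p_j(v) dv) f_G(g) dg)`.
The integrals of these nonnegative functions are taken in `[0, ∞]`. -/
def interferenceLaplace (lam : ℝ) (α β : LinkState → ℝ) (fG : ℝ → ℝ) (i j : LinkState)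
    (r s : ℝ) : ℝ :=
  expNeg (ENNReal.ofReal (2 * Real.pi * lam) *
    ∫⁻ g in Set.Ioi (0 : ℝ),
      (∫⁻ v in Set.Ioi (exclusionRadius α β i j r),
        ENNReal.ofReal ((1 - Real.exp (-(pathLoss α β j v * s * g))) * v * linkProb j v)) *
      ENNReal.ofReal (fG g))

/-- The integrand of the coverage formula for association in state `i`. -/
def coverageIntegrand (lam : ℝ) (α β : LinkState → ℝ) (σ2 μo : ℝ) (fG : ℝ → ℝ) (T : ℝ)
    (i : LinkState) (r : ℝ) : ℝ :=
  assocPDF lam α β i r * Real.exp (-μo * T * r ^ α i * σ2 / β i) *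
    interferenceLaplace lam α β fG i .L r (μo * T / pathLoss α β i r) *
    interferenceLaplace lam α β fG i .N r (μo * T / pathLoss α β i r)

end MmWave

end

namespace MmWave

open Filter Topology Set

/-! ### The exponential `e^{-t}` on `[0, ∞]` and infinite products of numbers in `[0, 1]` -/

/-! Attach to each base station its state and misaligned gain. Averaging these marks turns the
generating functional of the Poisson locations into that of a marked process: `E ∏ u(Z n) = exp(-∫
(1 - u) dM)`, where `M` has location intensity `λ dx`, state weights `p_j(‖x‖)` and gain law `f_G`
(`lintegral_infProd_marked`). This is the only fact about the marked process as a whole that yields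
the first-point formula below, and it holds in `[0, ∞]` with `e^{-∞} = 0`, so infinite interference
needs no special treatment.

The serving station minimises the key `W = ‖x‖^α_j / β_j`, the reciprocal path loss. The core
result, `lintegral_minProd`, is a Mecke-type formula for the first point: the expectation of `1_H`
at the minimiser times `∏ v` over the other points equals `∫_H exp(-M{W < W z} - ∫_{W > W z} (1 - v)
dM) M(dz)`. Its proof discretises the key. For an integer key, the expectation on the event that the
lowest occupied shell is `k` is a difference `e^{-a} - e^{-(a+h)}` of two generating functionals,
with `h` the mass of the part of the shell in `H`; the inequalities `h e^{-h} ≤ 1 - e^{-h} ≤ h`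
sandwich it. Along dyadic refinements both bounds converge to the formula, because the law of `W`
under `M` has no atoms.

With `v = e^{-(weighted power)}` and polar coordinates, `W < W z` becomes `v < ρ_ij(r)`, and the
exponent splits into the void probability inside `f_{r^i}` and the logarithms of the Laplace
transforms (`setLIntegral_negExp_interference`). Taking `s = 0` gives (a). Testing on events of the
serving state and distance gives (b). For (c), the exponential tail of the aligned gain turns
coverage into the expectation of `exp(-μo T (I + σ²) / ℓ)`; here the Laplace argument depends on the
serving distance, and the formula for constant arguments extends by approximation from below. -/

/-- `e^{-t}` as an extended nonnegative real, with `e^{-∞} = 0`. -/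
noncomputable def negExp (t : ℝ≥0∞) : ℝ≥0∞ := EReal.exp (-(t : EReal))

@[simp] lemma negExp_zero : negExp 0 = 1 := by simp [negExp]

@[simp] lemma negExp_top : negExp ∞ = 0 := by simp [negExp]

lemma negExp_ofReal {t : ℝ} (ht : 0 ≤ t) :
    negExp (ENNReal.ofReal t) = ENNReal.ofReal (Real.exp (-t)) := by
  rw [negExp, EReal.coe_ennreal_ofReal, max_eq_left ht, ← EReal.coe_neg, EReal.exp_coe]

lemma negExp_add (s t : ℝ≥0∞) : negExp (s + t) = negExp s * negExp t := by
  rw [negExp, EReal.coe_ennreal_add, EReal.neg_add (by simp) (by simp), sub_eq_add_neg,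
    EReal.exp_add]
  rfl

lemma negExp_antitone : Antitone negExp := fun _ _ h =>
  EReal.exp_monotone (EReal.neg_le_neg_iff.2 (EReal.coe_ennreal_le_coe_ennreal_iff.2 h))

lemma continuous_negExp : Continuous negExp :=
  ENNReal.continuous_exp.comp (continuous_neg.comp continuous_coe_ennreal_ereal)

lemma measurable_negExp : Measurable negExp := continuous_negExp.measurable

lemma negExp_le_one (t : ℝ≥0∞) : negExp t ≤ 1 := by
  simpa using negExp_antitone (zero_le (a := t))

lemma negExp_ne_top (t : ℝ≥0∞) : negExp t ≠ ∞ := ((negExp_le_one t).trans_lt (by simp)).ne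

lemma ofReal_expNeg (t : ℝ≥0∞) : ENNReal.ofReal (expNeg t) = negExp t := by
  rcases eq_or_ne t ∞ with rfl | ht
  · simp [expNeg]
  · rw [expNeg, if_neg ht, ← negExp_ofReal ENNReal.toReal_nonneg, ENNReal.ofReal_toReal ht]

lemma expNeg_nonneg (t : ℝ≥0∞) : 0 ≤ expNeg t := by
  unfold expNeg; split_ifs <;> positivity

lemma expNeg_eq_toReal (t : ℝ≥0∞) : expNeg t = (negExp t).toReal := by
  rw [← ofReal_expNeg, ENNReal.toReal_ofReal (expNeg_nonneg t)]

lemma expNeg_le_one (t : ℝ≥0∞) : expNeg t ≤ 1 := by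
  rw [expNeg_eq_toReal]
  exact ENNReal.toReal_le_of_le_ofReal zero_le_one (by simpa using negExp_le_one t)

lemma measurable_expNeg : Measurable expNeg := by
  have : expNeg = fun t => (negExp t).toReal := funext expNeg_eq_toReal
  rw [this]
  exact measurable_negExp.ennreal_toReal

lemma negExp_sum {ι : Type*} (s : Finset ι) (f : ι → ℝ≥0∞) :
    negExp (∑ i ∈ s, f i) = ∏ i ∈ s, negExp (f i) := by
  classical
  induction s using Finset.induction_on with
  | empty => simp
  | insert i s hi ih => rw [Finset.sum_insert hi, Finset.prod_insert hi, negExp_add, ih]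

lemma negExp_nsmul (k : ℕ) (t : ℝ≥0∞) : negExp (t * k) = negExp t ^ k := by
  have := negExp_sum (Finset.range k) (fun _ => t)
  simpa [mul_comm] using this

/-- With `mul_negExp_le`, this sandwiches the probability that a Poisson shell of mass `t` is
occupied. Both rest on `1 + x ≤ e^x`. -/
lemma one_sub_negExp_le (t : ℝ≥0∞) : 1 - negExp t ≤ t := by
  rcases eq_or_ne t ∞ with rfl | ht
  · simp
  · rw [← ENNReal.ofReal_toReal ht, negExp_ofReal ENNReal.toReal_nonneg, ← ENNReal.ofReal_one,
      ← ENNReal.ofReal_sub _ (Real.exp_pos _).le]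
    exact ENNReal.ofReal_le_ofReal (by linarith [Real.add_one_le_exp (-t.toReal)])

lemma mul_negExp_le (t : ℝ≥0∞) : t * negExp t ≤ 1 - negExp t := by
  rcases eq_or_ne t ∞ with rfl | ht
  · simp
  · rw [← ENNReal.ofReal_toReal ht, negExp_ofReal ENNReal.toReal_nonneg, ← ENNReal.ofReal_one,
      ← ENNReal.ofReal_sub _ (Real.exp_pos _).le, ← ENNReal.ofReal_mul ENNReal.toReal_nonneg]
    refine ENNReal.ofReal_le_ofReal ?_
    have h := Real.add_one_le_exp t.toReal
    have h2 : Real.exp t.toReal * Real.exp (-t.toReal) = 1 := by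
      rw [← Real.exp_add]; simp
    nlinarith [Real.exp_pos (-t.toReal)]

/-- The negative logarithm on `[0, 1]`. -/
noncomputable def negLog (u : ℝ≥0∞) : ℝ≥0∞ := (-ENNReal.log u).toENNReal

lemma measurable_negLog : Measurable negLog :=
  measurable_ereal_toENNReal.comp (continuous_neg.measurable.comp ENNReal.measurable_log)

/-- Every factor in `[0, 1]` is some `e^{-φ}`, with `φ = ∞` where the factor vanishes. Hence
generating functionals are Laplace functionals. -/
lemma negExp_negLog {u : ℝ≥0∞} (hu : u ≤ 1) : negExp (negLog u) = u := by
  rw [negExp, negLog, EReal.coe_toENNReal, neg_neg, ENNReal.exp_log]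
  exact EReal.le_neg_of_le_neg (by simpa using hu)

/-- The infinite product of a sequence of numbers in `[0, 1]`. -/
noncomputable def infProd (a : ℕ → ℝ≥0∞) : ℝ≥0∞ := ⨅ N, ∏ n ∈ Finset.range N, a n

lemma antitone_prod_range {a : ℕ → ℝ≥0∞} (ha : ∀ n, a n ≤ 1) :
    Antitone fun N => ∏ n ∈ Finset.range N, a n :=
  antitone_nat_of_succ_le fun N => by
    rw [Finset.prod_range_succ]
    exact mul_le_of_le_one_right' (ha N)

lemma tendsto_infProd {a : ℕ → ℝ≥0∞} (ha : ∀ n, a n ≤ 1) :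
    Tendsto (fun N => ∏ n ∈ Finset.range N, a n) atTop (𝓝 (infProd a)) :=
  tendsto_atTop_iInf (antitone_prod_range ha)

lemma infProd_le_one (a : ℕ → ℝ≥0∞) : infProd a ≤ 1 :=
  (iInf_le _ 0).trans (by simp)

lemma infProd_eq_zero {a : ℕ → ℝ≥0∞} {n : ℕ} (hn : a n = 0) : infProd a = 0 :=
  le_antisymm ((iInf_le _ (n + 1)).trans (by simp [Finset.prod_range_succ, hn])) zero_le

@[simp] lemma infProd_one : infProd (fun _ => 1) = 1 := by simp [infProd]

/-- `negExp` is continuous up to `∞`, so a divergent sum corresponds to a product equal to 0. -/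
lemma infProd_negExp (a : ℕ → ℝ≥0∞) : infProd (fun n => negExp (a n)) = negExp (∑' n, a n) := by
  refine tendsto_nhds_unique (tendsto_infProd fun n => negExp_le_one _) ?_
  simp_rw [← negExp_sum]
  exact (continuous_negExp.tendsto _).comp ENNReal.summable.hasSum.tendsto_sum_nat

lemma measurable_infProd {Ω : Type*} [MeasurableSpace Ω] {a : ℕ → Ω → ℝ≥0∞}
    (ha : ∀ n, Measurable (a n)) : Measurable fun ω => infProd fun n => a n ω :=
  Measurable.iInf fun _ => Finset.measurable_prod _ fun n _ => ha n

/-- Expectations of infinite products are limits of expectations of finite products. -/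
lemma tendsto_lintegral_prod {Ω : Type*} [MeasurableSpace Ω] {P : Measure Ω}
    [IsProbabilityMeasure P] {a : ℕ → Ω → ℝ≥0∞} (ha : ∀ n, Measurable (a n))
    (ha1 : ∀ n ω, a n ω ≤ 1) :
    Tendsto (fun N => ∫⁻ ω, ∏ n ∈ Finset.range N, a n ω ∂P) atTop
      (𝓝 (∫⁻ ω, infProd (fun n => a n ω) ∂P)) := by
  refine tendsto_lintegral_of_dominated_convergence (fun _ => 1)
    (fun N => Finset.measurable_prod _ fun n _ => ha n)
    (fun _ => Eventually.of_forall fun ω => Finset.prod_le_one' fun n _ => ha1 n ω) (by simp)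
    (Eventually.of_forall fun ω => tendsto_infProd fun n => ha1 n ω)

/-! ### The probability generating functional of a Poisson point process -/

lemma pointCount_eq_tsum {Ω E : Type*} (X : ℕ → Ω → E) (B : Set E) (ω : Ω) :
    ((pointCount X B ω : ℕ∞) : ℝ≥0∞) = ∑' n, B.indicator (fun _ => 1) (X n ω) := by
  rw [pointCount, ← ENNReal.tsum_set_one, tsum_subtype {n | X n ω ∈ B} (fun _ => (1 : ℝ≥0∞))]
  rfl

section Poisson

variable {Ω E : Type*} [MeasurableSpace Ω] [MeasurableSpace E] {P : Measure Ω} {Λ : Measure E}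
  {X : ℕ → Ω → E}

lemma measurable_pointCount (hX : ∀ n, Measurable (X n)) {B : Set E} (hB : MeasurableSet B) :
    Measurable (pointCount X B) := by
  have h : Measurable fun ω => ((pointCount X B ω : ℕ∞) : ℝ≥0∞) := by
    simp_rw [pointCount_eq_tsum]
    exact Measurable.tsum fun n => (measurable_const.indicator hB).comp (hX n)
  refine measurable_to_countable' fun k => ?_
  have : pointCount X B ⁻¹' {k} = (fun ω => ((pointCount X B ω : ℕ∞) : ℝ≥0∞)) ⁻¹' {(k : ℝ≥0∞)} := by
    ext ω; simp
  rw [this]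
  exact h (measurableSet_singleton _)

/-- `count_law` speaks of finite values only. The Poisson weights already sum to 1, so nothing is
left for the value `⊤`. -/
lemma IsPoissonPointProcess.ae_pointCount_ne_top [IsProbabilityMeasure P]
    (hX : IsPoissonPointProcess P Λ X) {B : Set E} (hB : MeasurableSet B) (hΛ : Λ B ≠ ∞) :
    ∀ᵐ ω ∂P, pointCount X B ω ≠ ⊤ := by
  have hm : ∀ k : ℕ, MeasurableSet {ω | pointCount X B ω = k} := fun k =>
    measurable_pointCount hX.measurable hB (measurableSet_singleton _)
  have hU : P (⋃ k : ℕ, {ω | pointCount X B ω = k}) = 1 := by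
    rw [measure_iUnion]
    · simp_rw [hX.count_law B hB hΛ]
      have := hasSum_one_poissonMeasure (Λ B).toNNReal
      have h2 := ENNReal.ofReal_tsum_of_nonneg (fun n => by positivity) this.summable
      rw [this.tsum_eq] at h2
      rw [← ENNReal.ofReal_one, h2]
      rfl
    · intro k l hkl
      refine Set.disjoint_left.2 fun ω hk hl => hkl ?_
      simp only [mem_ofPred_eq] at hk hl
      exact_mod_cast hk.symm.trans hl
    · exact hm
  have : ∀ᵐ ω ∂P, ω ∈ ⋃ k : ℕ, {ω | pointCount X B ω = k} := by
    exact (prob_compl_eq_zero_iff (MeasurableSet.iUnion hm)).2 hU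
  filter_upwards [this] with ω hω
  simp only [mem_iUnion, mem_ofPred_eq] at hω
  obtain ⟨k, hk⟩ := hω
  rw [hk]
  exact ENat.natCast_ne_top k

/-- The Laplace transform of a Poisson count. -/
lemma IsPoissonPointProcess.lintegral_negExp_count [IsProbabilityMeasure P]
    (hX : IsPoissonPointProcess P Λ X) {B : Set E} (hB : MeasurableSet B) (hΛ : Λ B ≠ ∞)
    (c : ℝ≥0∞) :
    ∫⁻ ω, negExp (c * ((pointCount X B ω : ℕ∞) : ℝ≥0∞)) ∂P = negExp ((1 - negExp c) * Λ B) := by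
  have hm : ∀ k : ℕ, MeasurableSet {ω | pointCount X B ω = k} := fun k =>
    measurable_pointCount hX.measurable hB (measurableSet_singleton _)
  set q : ℝ := (negExp c).toReal with hq
  have hq0 : 0 ≤ q := ENNReal.toReal_nonneg
  have hq1 : q ≤ 1 := by rw [hq, ← expNeg_eq_toReal]; exact expNeg_le_one c
  have hqc : negExp c = ENNReal.ofReal q := (ENNReal.ofReal_toReal (negExp_ne_top c)).symm
  set l : ℝ := (Λ B).toReal with hl
  have hl0 : 0 ≤ l := ENNReal.toReal_nonneg
  -- The events of a finite count exhaust almost all of the space, so the expectation becomes an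
  -- exponential series in `q * l`.
  have hU : P.restrict (⋃ k : ℕ, {ω | pointCount X B ω = k}) = P := by
    refine Measure.restrict_eq_self_of_ae_mem ?_
    filter_upwards [hX.ae_pointCount_ne_top hB hΛ] with ω hω
    obtain ⟨k, hk⟩ := ENat.ne_top_iff_exists.1 hω
    exact mem_iUnion.2 ⟨k, hk.symm⟩
  rw [← hU, lintegral_iUnion hm]
  · have hk : ∀ k : ℕ, ∫⁻ ω in {ω | pointCount X B ω = k},
        negExp (c * ((pointCount X B ω : ℕ∞) : ℝ≥0∞)) ∂P
        = ENNReal.ofReal (Real.exp (-l) * ((q * l) ^ k / (k.factorial : ℝ))) := by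
      intro k
      have : ∫⁻ ω in {ω | pointCount X B ω = k},
          negExp (c * ((pointCount X B ω : ℕ∞) : ℝ≥0∞)) ∂P
          = ∫⁻ ω in {ω | pointCount X B ω = k}, negExp c ^ k ∂P := by
        refine setLIntegral_congr_fun (hm k) fun ω hω => ?_
        have hω' : pointCount X B ω = k := hω
        simp only [hω', ← negExp_nsmul]
        simp
      rw [this, setLIntegral_const, hX.count_law B hB hΛ, hqc, ← ENNReal.ofReal_pow hq0,
        ← ENNReal.ofReal_mul (by positivity)]
      congr 1
      rw [mul_pow]; ring
    simp_rw [hk]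
    have hs : HasSum (fun k : ℕ => Real.exp (-l) * ((q * l) ^ k / (k.factorial : ℝ)))
        (Real.exp (-l) * Real.exp (q * l)) := by
      have := NormedSpace.expSeries_div_hasSum_exp (q * l)
      rw [← Real.exp_eq_exp_ℝ] at this
      exact this.mul_left _
    rw [← ENNReal.ofReal_tsum_of_nonneg (fun k => by positivity) hs.summable, hs.tsum_eq,
      ← Real.exp_add, hqc, ← ENNReal.ofReal_toReal hΛ, ← ENNReal.ofReal_one,
      ← ENNReal.ofReal_sub _ hq0, ← ENNReal.ofReal_mul (by linarith), negExp_ofReal]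
    · congr 2; rw [← hl]; ring
    · exact mul_nonneg (by linarith) hl0
  · intro k k' hkl
    refine Set.disjoint_left.2 fun ω hk hl => hkl ?_
    simp only [mem_ofPred_eq] at hk hl
    exact_mod_cast hk.symm.trans hl

/-- The value 0 is dropped because its fibre may have infinite intensity, where `count_law` and
`count_indep` say nothing. -/
lemma SimpleFunc_eq_sum_filter (φ : SimpleFunc E ℝ≥0∞) (g : ℝ≥0∞ → ℝ≥0∞) (hg : g 0 = 0) (x : E) :
    g (φ x) = ∑ c ∈ φ.range.filter (· ≠ 0), g c * (φ ⁻¹' {c}).indicator (fun _ => 1) x := by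
  classical
  rcases eq_or_ne (φ x) 0 with h | h
  · rw [h, hg, Finset.sum_eq_zero]
    intro c hc
    have : x ∉ φ ⁻¹' {c} := by
      intro hx
      exact (Finset.mem_filter.1 hc).2 (by rw [← h]; exact hx.symm)
    simp [this]
  · rw [Finset.sum_eq_single (φ x)]
    · simp
    · intro c _ hc
      have : x ∉ φ ⁻¹' {c} := fun hx => hc hx.symm
      simp [this]
    · intro hx
      simp [h] at hx

/-- The Laplace functional at a simple function whose support has finite intensity. -/
lemma IsPoissonPointProcess.lintegral_negExp_simpleFunc [IsProbabilityMeasure P]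
    (hX : IsPoissonPointProcess P Λ X) (φ : SimpleFunc E ℝ≥0∞)
    (hφ : ∀ c, c ≠ 0 → Λ (φ ⁻¹' {c}) ≠ ∞) :
    ∫⁻ ω, negExp (∑' n, φ (X n ω)) ∂P = negExp (∫⁻ x, (1 - negExp (φ x)) ∂Λ) := by
  classical
  set s := φ.range.filter (· ≠ 0) with hs
  have hmB : ∀ c, MeasurableSet (φ ⁻¹' {c}) := fun c => φ.measurableSet_fiber c
  -- Grouping the points by the value of `φ` expresses the sum through the counts of the fibres.
  have h1 : ∀ ω, negExp (∑' n, φ (X n ω)) =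
      ∏ c ∈ s, negExp (c * ((pointCount X (φ ⁻¹' {c}) ω : ℕ∞) : ℝ≥0∞)) := by
    intro ω
    rw [← negExp_sum]
    congr 1
    simp_rw [pointCount_eq_tsum, ← ENNReal.tsum_mul_left]
    rw [← Summable.tsum_finsetSum fun _ _ => ENNReal.summable]
    exact tsum_congr fun n => SimpleFunc_eq_sum_filter φ id rfl _
  have h2 : ∫⁻ x, (1 - negExp (φ x)) ∂Λ = ∑ c ∈ s, (1 - negExp c) * Λ (φ ⁻¹' {c}) := by
    simp_rw [SimpleFunc_eq_sum_filter φ (fun c => 1 - negExp c) (by simp)]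
    rw [lintegral_finsetSum _ fun c _ =>
      ((measurable_const.indicator (hmB c)).const_mul _)]
    refine Finset.sum_congr rfl fun c _ => ?_
    rw [lintegral_const_mul _ (measurable_const.indicator (hmB c)),
      lintegral_indicator_const (hmB c), one_mul]
  -- The fibres of distinct values are disjoint. `count_indep` is indexed by `Fin m`, hence the
  -- enumeration of `s`.
  have hind : iIndepFun (fun (c : s) ω => pointCount X (φ ⁻¹' {(c : ℝ≥0∞)}) ω) P := by
    have e := s.equivFin
    have := hX.count_indep s.card (fun i => φ ⁻¹' {((e.symm i : s) : ℝ≥0∞)})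
      (fun i => hmB _) (fun i => hφ _ (Finset.mem_filter.1 (e.symm i).2).2) (by
        intro i j hij
        refine Set.disjoint_left.2 fun x hi hj => hij ?_
        have : ((e.symm i : s) : ℝ≥0∞) = (e.symm j : s) := hi.symm.trans hj
        exact e.symm.injective (Subtype.ext this))
    have := this.precomp e.injective
    simpa using this
  simp_rw [h1]
  rw [h2, negExp_sum]
  have h3 := lintegral_prod_eq_prod_lintegral_of_indepFun (μ := P) Finset.univ
    (fun (c : s) ω => negExp (c * ((pointCount X (φ ⁻¹' {(c : ℝ≥0∞)}) ω : ℕ∞) : ℝ≥0∞)))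
    (hind.comp (fun (c : s) (k : ℕ∞) => negExp (c * (k : ℝ≥0∞))) fun _ => measurable_of_countable _)
    (fun c => (measurable_of_countable (fun k : ℕ∞ => negExp (c * (k : ℝ≥0∞)))).comp
      (measurable_pointCount hX.measurable (hmB c)))
  rw [Finset.univ_eq_attach] at h3
  rw [← Finset.prod_attach]
  simp_rw [← Finset.prod_attach s (fun c => negExp (c * ((pointCount X (φ ⁻¹' {c}) _ : ℕ∞) : ℝ≥0∞)))]
  rw [h3]
  exact Finset.prod_congr rfl fun c _ => hX.lintegral_negExp_count (hmB _)
    (hφ _ (Finset.mem_filter.1 c.2).2) _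

/-- Monotone convergence for the counting measure. -/
lemma tendsto_tsum_of_monotone {a : ℕ → ℕ → ℝ≥0∞} {b : ℕ → ℝ≥0∞} (ha : ∀ n, Monotone fun k => a k n)
    (hb : ∀ n, Tendsto (fun k => a k n) atTop (𝓝 (b n))) :
    Tendsto (fun k => ∑' n, a k n) atTop (𝓝 (∑' n, b n)) := by
  simp_rw [← lintegral_count]
  exact lintegral_tendsto_of_tendsto_of_monotone (fun k => (measurable_of_countable _).aemeasurable)
    (Eventually.of_forall ha) (Eventually.of_forall hb)

/-- The Laplace functional of a Poisson point process. -/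
theorem IsPoissonPointProcess.lintegral_negExp_tsum [IsProbabilityMeasure P] [SigmaFinite Λ]
    (hX : IsPoissonPointProcess P Λ X) {φ : E → ℝ≥0∞} (hφ : Measurable φ) :
    ∫⁻ ω, negExp (∑' n, φ (X n ω)) ∂P = negExp (∫⁻ x, (1 - negExp (φ x)) ∂Λ) := by
  -- Cutting to the spanning sets gives the nonzero fibres finite intensity; by σ-finiteness the
  -- approximations still increase to `φ`.
  set φ' : ℕ → SimpleFunc E ℝ≥0∞ := fun k =>
    (SimpleFunc.eapprox φ k).restrict (spanningSets Λ k) with hφ'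
  have happ : ∀ k x, φ' k x = (spanningSets Λ k).indicator (SimpleFunc.eapprox φ k) x :=
    fun k x => SimpleFunc.restrict_apply _ (measurableSet_spanningSets Λ k) x
  have hmono : ∀ x, Monotone fun k => φ' k x := by
    intro x k l hkl
    simp only [happ]
    by_cases hx : x ∈ spanningSets Λ k
    · rw [indicator_of_mem hx, indicator_of_mem (monotone_spanningSets Λ hkl hx)]
      exact SimpleFunc.monotone_eapprox φ hkl x
    · simp [hx]
  have hlim : ∀ x, Tendsto (fun k => φ' k x) atTop (𝓝 (φ x)) := by
    intro x
    have h1 : Tendsto (fun k => SimpleFunc.eapprox φ k x) atTop (𝓝 (φ x)) := by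
      rw [← SimpleFunc.iSup_eapprox_apply hφ x]
      exact tendsto_atTop_iSup fun k l hkl => SimpleFunc.monotone_eapprox φ hkl x
    refine h1.congr' ?_
    have hx : x ∈ ⋃ k, spanningSets Λ k := by rw [iUnion_spanningSets]; trivial
    obtain ⟨K, hK⟩ := mem_iUnion.1 hx
    filter_upwards [eventually_ge_atTop K] with k hk
    rw [happ, indicator_of_mem (monotone_spanningSets Λ hk hK)]
  have heq : ∀ k, ∫⁻ ω, negExp (∑' n, φ' k (X n ω)) ∂P
      = negExp (∫⁻ x, (1 - negExp (φ' k x)) ∂Λ) := by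
    intro k
    refine hX.lintegral_negExp_simpleFunc _ fun c hc => ?_
    refine ((measure_mono ?_).trans_lt (measure_spanningSets_lt_top Λ k)).ne
    intro x hx
    by_contra h
    have : φ' k x = c := hx
    rw [happ, indicator_of_notMem h] at this
    exact hc this.symm
  have hL : Tendsto (fun k => ∫⁻ ω, negExp (∑' n, φ' k (X n ω)) ∂P) atTop
      (𝓝 (∫⁻ ω, negExp (∑' n, φ (X n ω)) ∂P)) := by
    refine tendsto_lintegral_of_dominated_convergence (fun _ => 1) (fun k => ?_)
      (fun k => Eventually.of_forall fun ω => negExp_le_one _) (by simp)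
      (Eventually.of_forall fun ω => ?_)
    · exact measurable_negExp.comp (Measurable.tsum fun n =>
        (φ' k).measurable.comp (hX.measurable n))
    · exact (continuous_negExp.tendsto _).comp
        (tendsto_tsum_of_monotone (fun n => hmono _) fun n => hlim _)
  have hR : Tendsto (fun k => negExp (∫⁻ x, (1 - negExp (φ' k x)) ∂Λ)) atTop
      (𝓝 (negExp (∫⁻ x, (1 - negExp (φ x)) ∂Λ))) := by
    refine (continuous_negExp.tendsto _).comp (lintegral_tendsto_of_tendsto_of_monotone
      (fun k => ?_) (Eventually.of_forall fun x => ?_) (Eventually.of_forall fun x => ?_))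
    · exact (measurable_const.sub (measurable_negExp.comp (φ' k).measurable)).aemeasurable
    · exact fun k l hkl => tsub_le_tsub_left (negExp_antitone (hmono x hkl)) 1
    · exact ENNReal.Tendsto.sub tendsto_const_nhds ((continuous_negExp.tendsto _).comp (hlim x))
        (Or.inl (by simp))
  exact tendsto_nhds_unique hL (by simpa only [heq] using hR)

/-- The probability generating functional of a Poisson point process. -/
theorem IsPoissonPointProcess.lintegral_infProd [IsProbabilityMeasure P] [SigmaFinite Λ]
    (hX : IsPoissonPointProcess P Λ X) {u : E → ℝ≥0∞} (hu : Measurable u) (hu1 : ∀ x, u x ≤ 1) :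
    ∫⁻ ω, infProd (fun n => u (X n ω)) ∂P = negExp (∫⁻ x, (1 - u x) ∂Λ) := by
  -- Write `u = e^{-φ}` with `φ = negLog u`.
  have := hX.lintegral_negExp_tsum (measurable_negLog.comp hu)
  simpa only [← infProd_negExp, Function.comp_apply, negExp_negLog (hu1 _)] using this

end Poisson

/-! ### The marked process of locations, link states and gains -/

instance : MeasurableSingletonClass LinkState := ⟨fun _ => trivial⟩

/-- Independence as a Fubini formula: the second variable may be resampled with an independent `ω'`.
-/
lemma lintegral_comp_prodMk_of_indepFun {Ω A B : Type*} [MeasurableSpace Ω] [MeasurableSpace A]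
    [MeasurableSpace B] {P : Measure Ω} [IsProbabilityMeasure P] {U : Ω → A} {V : Ω → B}
    (hU : Measurable U) (hV : Measurable V) (h : IndepFun U V P) {Φ : A × B → ℝ≥0∞}
    (hΦ : Measurable Φ) :
    ∫⁻ ω, Φ (U ω, V ω) ∂P = ∫⁻ ω, ∫⁻ ω', Φ (U ω, V ω') ∂P ∂P := by
  have := Measure.isProbabilityMeasure_map (μ := P) hV.aemeasurable
  rw [← lintegral_map hΦ (hU.prodMk hV),
    (indepFun_iff_map_prod_eq_prod_map_map hU.aemeasurable hV.aemeasurable).1 h,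
    lintegral_prod _ hΦ.aemeasurable, lintegral_map hΦ.lintegral_prod_right' hU]
  refine lintegral_congr fun ω => ?_
  exact lintegral_map (f := fun y => Φ (U ω, y)) (hΦ.comp measurable_prodMk_left) hV

lemma linkProb_nonneg (j : LinkState) {r : ℝ} (hr : 0 ≤ r) : 0 ≤ linkProb j r := by
  cases j
  · exact (Real.exp_pos _).le
  · simp only [linkProb, sub_nonneg, Real.exp_le_one_iff]
    linarith

lemma continuous_linkProb (j : LinkState) : Continuous (linkProb j) := by
  cases j
  · change Continuous fun r => Real.exp (-0.0149 * r)
    fun_prop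
  · change Continuous fun r => 1 - Real.exp (-0.0149 * r)
    fun_prop

lemma sum_linkState {M : Type*} [AddCommMonoid M] (f : LinkState → M) : ∑ j, f j = f .L + f .N := by
  change ∑ j ∈ ({.L, .N} : Finset LinkState), f j = _
  simp

lemma sum_ofReal_linkProb {r : ℝ} (hr : 0 ≤ r) : ∑ j, ENNReal.ofReal (linkProb j r) = 1 := by
  rw [sum_linkState, ← ENNReal.ofReal_add (linkProb_nonneg _ hr) (linkProb_nonneg _ hr)]
  simp [linkProb]

lemma measurable_linkProb_norm (j : LinkState) :
    Measurable fun x : Plane => ENNReal.ofReal (linkProb j ‖x‖) :=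
  ((continuous_linkProb j).measurable.comp measurable_norm).ennreal_ofReal

section Thinning

variable {Ω : Type*} [MeasurableSpace Ω] {P : Measure Ω} {X : ℕ → Ω → Plane}
  {S : ℕ → Ω → LinkState}

/-- By `cond_law`, the law of the locations restricted to prescribed states and the law weighted by
the link probabilities agree on every measurable set, hence on every `F`. -/
lemma IsStateThinning.setLIntegral (hX : ∀ n, Measurable (X n)) (hS : IsStateThinning P X S)
    (J : Finset ℕ) (s : ℕ → LinkState) {F : (ℕ → Plane) → ℝ≥0∞} (hF : Measurable F) :
    ∫⁻ ω in {ω | ∀ n ∈ J, S n ω = s n}, F (fun n => X n ω) ∂P =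
      ∫⁻ ω, (∏ n ∈ J, ENNReal.ofReal (linkProb (s n) ‖X n ω‖)) * F (fun n => X n ω) ∂P := by
  have hXm : Measurable fun ω n => X n ω := measurable_pi_lambda _ hX
  have hd : Measurable fun ω => ∏ n ∈ J, ENNReal.ofReal (linkProb (s n) ‖X n ω‖) :=
    Finset.measurable_prod _ fun n _ => (measurable_linkProb_norm (s n)).comp (hX n)
  have hmap : (P.restrict {ω | ∀ n ∈ J, S n ω = s n}).map (fun ω n => X n ω) =
      (P.withDensity fun ω => ∏ n ∈ J, ENNReal.ofReal (linkProb (s n) ‖X n ω‖)).map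
        (fun ω n => X n ω) := by
    ext A hA
    rw [Measure.map_apply hXm hA, Measure.map_apply hXm hA,
      Measure.restrict_apply (hXm hA), withDensity_apply _ (hXm hA)]
    exact hS.cond_law A hA J s
  rw [← lintegral_map hF hXm, hmap, lintegral_map hF hXm,
    lintegral_withDensity_eq_lintegral_mul _ hd
      (show Measurable fun ω => F fun n => X n ω from hF.comp hXm)]
  rfl

/-- Given the locations, the link states are averaged independently. -/
lemma IsStateThinning.lintegral_prod (hX : ∀ n, Measurable (X n)) (hS : IsStateThinning P X S)
    {u : Plane → LinkState → ℝ≥0∞} (hu : ∀ j, Measurable fun x => u x j) (N : ℕ) :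
    ∫⁻ ω, ∏ n ∈ Finset.range N, u (X n ω) (S n ω) ∂P =
      ∫⁻ ω, ∏ n ∈ Finset.range N, ∑ j, ENNReal.ofReal (linkProb j ‖X n ω‖) * u (X n ω) j ∂P := by
  classical
  -- The value `.L` beyond `N` is a filler: only indices below `N` are read.
  set ext : (Fin N → LinkState) → ℕ → LinkState := fun p n => if h : n < N then p ⟨n, h⟩ else .L
    with hext
  have hext' : ∀ p (i : Fin N), ext p i = p i := fun p i => by simp [hext]
  have hmS : ∀ p, MeasurableSet {ω | ∀ n ∈ Finset.range N, S n ω = ext p n} := by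
    intro p
    have : {ω | ∀ n ∈ Finset.range N, S n ω = ext p n} =
        ⋂ n ∈ Finset.range N, S n ⁻¹' {ext p n} := by
      ext ω; simp
    rw [this]
    exact Finset.measurableSet_biInter _ fun n _ => hS.measurable n (measurableSet_singleton _)
  -- Partition according to the pattern of the first `N` states; only the pattern that occurs
  -- contributes.
  have h1 : ∀ ω, ∏ n ∈ Finset.range N, u (X n ω) (S n ω) =
      ∑ p : Fin N → LinkState, {ω | ∀ n ∈ Finset.range N, S n ω = ext p n}.indicator
        (fun ω => ∏ n ∈ Finset.range N, u (X n ω) (ext p n)) ω := by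
    intro ω
    rw [Finset.sum_eq_single fun i : Fin N => S i ω]
    · have hmem : ω ∈ {ω' | ∀ n ∈ Finset.range N, S n ω' = ext (fun i : Fin N => S i ω) n} := by
        intro n hn
        exact (hext' (fun i : Fin N => S i ω) ⟨n, Finset.mem_range.1 hn⟩).symm
      rw [indicator_of_mem hmem]
      exact Finset.prod_congr rfl fun n hn => by rw [← hmem n hn]
    · intro p _ hp
      refine indicator_of_notMem (fun hmem => hp ?_) _
      ext i
      have := hmem i (Finset.mem_range.2 i.2)
      rw [hext'] at this
      exact this.symm
    · simp
  have hF : ∀ p, Measurable fun x : ℕ → Plane => ∏ n ∈ Finset.range N, u (x n) (ext p n) :=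
    fun p => Finset.measurable_prod _ fun n _ => (hu _).comp (measurable_pi_apply n)
  have hXm : Measurable fun ω n => X n ω := measurable_pi_lambda _ hX
  simp_rw [h1]
  have hF' : ∀ p, Measurable fun ω => ∏ n ∈ Finset.range N, u (X n ω) (ext p n) :=
    fun p => (hF p).comp hXm
  rw [lintegral_finsetSum _ fun p _ => (hF' p).indicator (hmS p)]
  have h2 : ∀ p : Fin N → LinkState,
      ∫⁻ ω, {ω | ∀ n ∈ Finset.range N, S n ω = ext p n}.indicator
        (fun ω => ∏ n ∈ Finset.range N, u (X n ω) (ext p n)) ω ∂P =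
      ∫⁻ ω, ∏ i : Fin N, ENNReal.ofReal (linkProb (p i) ‖X i ω‖) * u (X i ω) (p i) ∂P := by
    intro p
    rw [lintegral_indicator (hmS p), hS.setLIntegral hX _ _ (hF p)]
    refine lintegral_congr fun ω => ?_
    rw [← Finset.prod_mul_distrib, Finset.prod_range]
    simp_rw [hext']
  simp_rw [h2]
  rw [← lintegral_finsetSum _ fun p _ => Finset.measurable_prod _ fun (i : Fin N) _ =>
    ((measurable_linkProb_norm (p i)).comp (hX i)).mul ((hu _).comp (hX i))]
  refine lintegral_congr fun ω => ?_
  -- Distributivity: the sum over patterns of products is the product of sums over states.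
  rw [Finset.prod_range, Finset.prod_univ_sum]
  simp

end Thinning

/-- The intensity measure of the marked process of locations, link states and gains. -/
noncomputable def markedIntensity (Λ : Measure Plane) (ν : Measure ℝ) :
    Measure (Plane × LinkState × ℝ) :=
  (Λ.prod ((Measure.count : Measure LinkState).prod ν)).withDensity
    fun z => ENNReal.ofReal (linkProb z.2.1 ‖z.1‖)

lemma measurable_linkProb_marked :
    Measurable fun z : Plane × LinkState × ℝ => ENNReal.ofReal (linkProb z.2.1 ‖z.1‖) := by
  have : Measurable fun q : LinkState × Plane => ENNReal.ofReal (linkProb q.1 ‖q.2‖) :=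
    measurable_from_prod_countable_right fun j => measurable_linkProb_norm j
  exact this.comp (measurable_snd.fst.prodMk measurable_fst)

lemma lintegral_markedIntensity (Λ : Measure Plane) (ν : Measure ℝ) [SFinite ν]
    {F : Plane × LinkState × ℝ → ℝ≥0∞} (hF : Measurable F) :
    ∫⁻ z, F z ∂markedIntensity Λ ν =
      ∫⁻ x, ∑ j, ENNReal.ofReal (linkProb j ‖x‖) * ∫⁻ g, F (x, j, g) ∂ν ∂Λ := by
  rw [markedIntensity, lintegral_withDensity_eq_lintegral_mul _ measurable_linkProb_marked hF,
    lintegral_prod _ (measurable_linkProb_marked.mul hF).aemeasurable]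
  refine lintegral_congr fun x => ?_
  have hm := (measurable_linkProb_marked.mul hF).comp (measurable_prodMk_left (x := x))
  have := lintegral_prod (μ := (Measure.count : Measure LinkState)) (ν := ν) _ hm.aemeasurable
  refine this.trans ?_
  rw [lintegral_count, tsum_fintype]
  refine Finset.sum_congr rfl fun j _ => ?_
  rw [← lintegral_const_mul]
  · rfl
  · exact hF.comp (measurable_const.prodMk (measurable_const.prodMk measurable_id))

section Marked

variable {Ω : Type*} [MeasurableSpace Ω] {P : Measure Ω} [IsProbabilityMeasure P]
  {X : ℕ → Ω → Plane} {S : ℕ → Ω → LinkState} {μo : ℝ} {fG : ℝ → ℝ} {Go : Ω → ℝ} {G : ℕ → Ω → ℝ}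

/-- Given locations and link states, the gains are averaged independently. -/
lemma IsGainModel.lintegral_prod (hX : ∀ n, Measurable (X n)) (hS : ∀ n, Measurable (S n))
    (hG : IsGainModel P X S μo fG Go G) {u : Plane × LinkState × ℝ → ℝ≥0∞} (hu : Measurable u)
    (N : ℕ) :
    ∫⁻ ω, ∏ n ∈ Finset.range N, u (X n ω, S n ω, G n ω) ∂P =
      ∫⁻ ω, ∏ n ∈ Finset.range N, ∫⁻ g, u (X n ω, S n ω, g) ∂P.map (G 0) ∂P := by
  have hind : IndepFun (fun ω => ((fun n => X n ω), (fun n => S n ω))) (fun ω n => G n ω) P :=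
    hG.gains_indep.comp measurable_id measurable_snd
  have hXS : Measurable fun ω => ((fun n => X n ω), (fun n => S n ω)) :=
    (measurable_pi_lambda _ hX).prodMk (measurable_pi_lambda _ hS)
  have hGm : Measurable fun ω n => G n ω := measurable_pi_lambda _ hG.measurable_misaligned
  have hΦ : Measurable fun q : ((ℕ → Plane) × (ℕ → LinkState)) × (ℕ → ℝ) =>
      ∏ n ∈ Finset.range N, u (q.1.1 n, q.1.2 n, q.2 n) := by
    refine Finset.measurable_prod _ fun n _ => hu.comp ?_
    fun_prop
  rw [lintegral_comp_prodMk_of_indepFun hXS hGm hind hΦ]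
  refine lintegral_congr fun ω => ?_
  have hun : ∀ n, Measurable fun g => u (X n ω, S n ω, g) := fun n =>
    hu.comp (measurable_const.prodMk (measurable_const.prodMk measurable_id))
  have := lintegral_prod_eq_prod_lintegral_of_indepFun (μ := P) (Finset.range N)
    (fun n ω' => u (X n ω, S n ω, G n ω')) (hG.misaligned_iIndep.comp _ hun)
    (fun n => (hun n).comp (hG.measurable_misaligned n))
  rw [this]
  refine Finset.prod_congr rfl fun n _ => ?_
  rw [← lintegral_map (hun n) (hG.measurable_misaligned n), hG.misaligned_law n,
    hG.misaligned_law 0]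

/-- The probability generating functional of the marked process. -/
theorem lintegral_infProd_marked {Λ : Measure Plane} [SigmaFinite Λ]
    (hX : IsPoissonPointProcess P Λ X) (hS : IsStateThinning P X S)
    (hG : IsGainModel P X S μo fG Go G) {u : Plane × LinkState × ℝ → ℝ≥0∞} (hu : Measurable u)
    (hu1 : ∀ z, u z ≤ 1) :
    ∫⁻ ω, infProd (fun n => u (X n ω, S n ω, G n ω)) ∂P =
      negExp (∫⁻ z, (1 - u z) ∂markedIntensity Λ (P.map (G 0))) := by
  have := Measure.isProbabilityMeasure_map (μ := P) (hG.measurable_misaligned 0).aemeasurable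
  set ν := P.map (G 0) with hν
  have hG' : ∀ j, Measurable fun x => ∫⁻ g, u (x, j, g) ∂ν := fun j => by
    refine Measurable.lintegral_prod_right' (f := fun q : Plane × ℝ => u (q.1, j, q.2))
      (hu.comp ?_)
    fun_prop
  set w : Plane → ℝ≥0∞ := fun x => ∑ j, ENNReal.ofReal (linkProb j ‖x‖) * ∫⁻ g, u (x, j, g) ∂ν
    with hw
  have hwm : Measurable w := Finset.measurable_sum _ fun j _ =>
    (measurable_linkProb_norm j).mul (hG' j)
  -- The marks at `x` have total mass 1, so `1 - w x` is the mark average of `1 - u`, the integrand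
  -- of the marked intensity.
  have hsum : ∀ x, w x + ∑ j, ENNReal.ofReal (linkProb j ‖x‖) * ∫⁻ g, (1 - u (x, j, g)) ∂ν = 1 := by
    intro x
    rw [hw, ← Finset.sum_add_distrib]
    refine Eq.trans ?_ (sum_ofReal_linkProb (norm_nonneg x))
    refine Finset.sum_congr rfl fun j _ => ?_
    have hm : Measurable fun g => u (x, j, g) :=
      hu.comp (measurable_const.prodMk (measurable_const.prodMk measurable_id))
    rw [← mul_add, ← lintegral_add_left hm]
    simp [add_tsub_cancel_of_le (hu1 _)]
  have hw1 : ∀ x, w x ≤ 1 := fun x => (le_self_add).trans (hsum x).le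
  -- Averaging gains, then states, leaves a product over the locations alone, to which the Poisson
  -- generating functional applies in the limit.
  have hfin : ∀ N, ∫⁻ ω, ∏ n ∈ Finset.range N, u (X n ω, S n ω, G n ω) ∂P =
      ∫⁻ ω, ∏ n ∈ Finset.range N, w (X n ω) ∂P := fun N => by
    rw [hG.lintegral_prod hX.measurable hS.measurable hu N]
    exact hS.lintegral_prod hX.measurable hG' N
  have h1 := tendsto_lintegral_prod (P := P) (a := fun n ω => u (X n ω, S n ω, G n ω))
    (fun n => hu.comp ((hX.measurable n).prodMk ((hS.measurable n).prodMk
      (hG.measurable_misaligned n)))) (fun n ω => hu1 _)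
  have h2 := tendsto_lintegral_prod (P := P) (a := fun n ω => w (X n ω))
    (fun n => hwm.comp (hX.measurable n)) (fun n ω => hw1 _)
  simp_rw [hfin] at h1
  rw [tendsto_nhds_unique h1 h2, hX.lintegral_infProd hwm hw1,
    lintegral_markedIntensity Λ ν (show Measurable fun z => 1 - u z from measurable_const.sub hu)]
  congr 1
  refine lintegral_congr fun x => ?_
  refine (congrArg (· - w x) (hsum x)).symm.trans ?_
  exact ENNReal.add_sub_cancel_left ((hw1 x).trans_lt (by simp)).ne

end Marked

/-! ### The first point of a Poisson point process -/

open Classical in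
/-- The product over the points `z m` of `𝟙_H (z m)` at those where `K` is minimal and of `v (z m)`
at the others. -/
noncomputable def minProd {E β : Type*} [LE β] (H : Set E) (v : E → ℝ≥0∞) (K : E → β)
    (z : ℕ → E) : ℝ≥0∞ :=
  infProd fun m => if ∀ l, K (z m) ≤ K (z l) then H.indicator (fun _ => 1) (z m) else v (z m)

lemma minProd_le_one {E β : Type*} [LE β] (H : Set E) (v : E → ℝ≥0∞) (K : E → β)
    (z : ℕ → E) : minProd H v K z ≤ 1 := infProd_le_one _

/-- Only the set of minimisers, and which of them lie in `H`, matter. This permits replacing the key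
by its dyadic index and `H` by a truncation. -/
lemma minProd_congr {E β γ : Type*} [LE β] [LE γ] {H H' : Set E} {v : E → ℝ≥0∞} {K : E → β}
    {K' : E → γ} {z : ℕ → E}
    (h : ∀ m, (∀ l, K (z m) ≤ K (z l)) ↔ (∀ l, K' (z m) ≤ K' (z l)))
    (hH : ∀ m, (∀ l, K (z m) ≤ K (z l)) → (z m ∈ H ↔ z m ∈ H')) :
    minProd H v K z = minProd H' v K' z := by
  classical
  unfold minProd
  congr 1
  ext m
  by_cases hm : ∀ l, K (z m) ≤ K (z l)
  · rw [if_pos hm, if_pos ((h m).1 hm)]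
    by_cases hz : z m ∈ H
    · rw [indicator_of_mem hz, indicator_of_mem ((hH m hm).1 hz)]
    · rw [indicator_of_notMem hz, indicator_of_notMem (fun hz' => hz ((hH m hm).2 hz'))]
  · rw [if_neg hm, if_neg (fun hm' => hm ((h m).2 hm'))]

lemma indicator_one_le_one {E : Type*} (H : Set E) (z : E) :
    H.indicator (fun _ => (1 : ℝ≥0∞)) z ≤ 1 := by
  by_cases h : z ∈ H <;> simp [h]

section FirstPoint

variable {Ω E : Type*} [MeasurableSpace Ω] [MeasurableSpace E] {P : Measure Ω}
  {Λ : Measure E} {Z : ℕ → Ω → E} {H : Set E} {v : E → ℝ≥0∞}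

lemma measurable_minProd {β : Type*} [LinearOrder β] [TopologicalSpace β] [OrderClosedTopology β]
    [SecondCountableTopology β] [MeasurableSpace β] [BorelSpace β] (hZ : ∀ n, Measurable (Z n))
    (hH : MeasurableSet H) (hv : Measurable v) {K : E → β} (hK : Measurable K) :
    Measurable fun ω => minProd H v K fun n => Z n ω := by
  classical
  refine measurable_infProd fun m => Measurable.ite ?_ ?_ (hv.comp (hZ m))
  · have : {ω | ∀ l, K (Z m ω) ≤ K (Z l ω)} = ⋂ l, {ω | K (Z m ω) ≤ K (Z l ω)} := by
      ext ω; simp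
    rw [this]
    exact MeasurableSet.iInter fun l => measurableSet_le (hK.comp (hZ m)) (hK.comp (hZ l))
  · exact (measurable_const.indicator hH).comp (hZ m)

/-- The intensity seen by the generating functional when the lowest occupied shell is `k`. -/
noncomputable def shellIntensity {β : Type*} [LT β] [DecidableLT β] (Λ : Measure E)
    (v : E → ℝ≥0∞) (K : E → β) (k : β) : ℝ≥0∞ :=
  ∫⁻ z, (if K z < k then 1 else if k < K z then 1 - v z else 0) ∂Λ

lemma setLIntegral_comp_nat {K : E → ℕ} (hK : Measurable K) (f : ℕ → ℝ≥0∞) :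
    ∫⁻ z in H, f (K z) ∂Λ = ∑' k, f k * Λ (H ∩ {z | K z = k}) := by
  rw [← lintegral_map (measurable_of_countable f) hK, lintegral_countable']
  refine tsum_congr fun k => ?_
  rw [Measure.map_apply hK (measurableSet_singleton k),
    Measure.restrict_apply (hK (measurableSet_singleton k)), inter_comm]
  rfl

/-- The expectation of `minProd` on the event that the lowest occupied shell is `k`. -/
lemma setLIntegral_minProd_shell [IsProbabilityMeasure P] (hZ : ∀ n, Measurable (Z n))
    (hPGF : ∀ u : E → ℝ≥0∞, Measurable u → (∀ z, u z ≤ 1) →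
      ∫⁻ ω, infProd (fun n => u (Z n ω)) ∂P = negExp (∫⁻ z, (1 - u z) ∂Λ))
    (hH : MeasurableSet H) (hv : Measurable v) (hv1 : ∀ z, v z ≤ 1)
    {K : E → ℕ} (hK : Measurable K) (k : ℕ) (hfin : Λ {z | K z = k} ≠ ∞) :
    ∫⁻ ω in {ω | (∃ m, K (Z m ω) = k) ∧ ∀ l, k ≤ K (Z l ω)}, minProd H v K (fun n => Z n ω) ∂P
        ≤ negExp (shellIntensity Λ v K k) * Λ (H ∩ {z | K z = k}) ∧
    negExp (shellIntensity Λ v K k + Λ {z | K z = k}) * Λ (H ∩ {z | K z = k}) ≤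
      ∫⁻ ω in {ω | (∃ m, K (Z m ω) = k) ∧ ∀ l, k ≤ K (Z l ω)},
        minProd H v K (fun n => Z n ω) ∂P := by
  classical
  set A : Set Ω := {ω | (∃ m, K (Z m ω) = k) ∧ ∀ l, k ≤ K (Z l ω)} with hA
  -- Both `u` and `u'` forbid points below shell `k` and weight those above by `v`. In the shell,
  -- `u` tests membership in `H`, while `u'` forbids points altogether.
  set u : E → ℝ≥0∞ := fun z =>
    if K z < k then 0 else if K z = k then H.indicator (fun _ => 1) z else v z with hu
  set u' : E → ℝ≥0∞ := fun z => if K z ≤ k then 0 else v z with hu'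
  set D : Set E := {z | K z = k} with hD
  have mlt : MeasurableSet {z | K z < k} := measurableSet_lt hK measurable_const
  have mgt : MeasurableSet {z | k < K z} := measurableSet_lt measurable_const hK
  have mle : MeasurableSet {z | K z ≤ k} := measurableSet_le hK measurable_const
  have meq : MeasurableSet D := hK (measurableSet_singleton k)
  have mI : Measurable fun z => H.indicator (fun _ => (1 : ℝ≥0∞)) z := measurable_const.indicator hH
  have hum : Measurable u := Measurable.ite mlt measurable_const (Measurable.ite meq mI hv)
  have hum' : Measurable u' := Measurable.ite mle measurable_const hv
  have hu1 : ∀ z, u z ≤ 1 := fun z => by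
    simp only [hu]; split_ifs
    exacts [zero_le_one, indicator_one_le_one _ _, hv1 z]
  have hu1' : ∀ z, u' z ≤ 1 := fun z => by
    simp only [hu']; split_ifs
    exacts [zero_le_one, hv1 z]
  have hAm : MeasurableSet A := by
    have : A = (⋃ m, {ω | K (Z m ω) = k}) ∩ ⋂ l, {ω | k ≤ K (Z l ω)} := by
      ext ω; simp [hA]
    rw [this]
    refine (MeasurableSet.iUnion fun m => ?_).inter (MeasurableSet.iInter fun l => ?_)
    · exact (hK.comp (hZ m)) (measurableSet_singleton k)
    · exact measurableSet_le measurable_const (hK.comp (hZ l))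
  -- On `A` the shell is occupied, which kills the `u'` product, and the minimisers are exactly its
  -- points. Off `A` either a point below `k` kills both products or the shell is empty and they
  -- coincide.
  have hpt : ∀ ω, A.indicator (fun ω => minProd H v K fun n => Z n ω) ω
      + infProd (fun n => u' (Z n ω)) = infProd (fun n => u (Z n ω)) := by
    intro ω
    by_cases hmem : ω ∈ A
    · obtain ⟨⟨m, hm⟩, hl⟩ := id hmem
      rw [indicator_of_mem hmem, infProd_eq_zero (n := m) (by simp [hu', hm]), add_zero]
      unfold minProd
      congr 1
      ext n
      have hn : ¬ K (Z n ω) < k := not_lt.2 (hl n)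
      have hiff : (∀ l, K (Z n ω) ≤ K (Z l ω)) ↔ K (Z n ω) = k :=
        ⟨fun h => le_antisymm (hm ▸ h m) (hl n), fun h l => h ▸ hl l⟩
      simp only [hu, hiff, if_neg hn]
    · rw [indicator_of_notMem hmem, zero_add]
      by_cases hlt : ∃ l, K (Z l ω) < k
      · obtain ⟨l, hl⟩ := hlt
        rw [infProd_eq_zero (n := l) (by simp [hu', hl.le]),
          infProd_eq_zero (n := l) (by simp [hu, hl])]
      · push Not at hlt
        have hne : ∀ m, K (Z m ω) ≠ k := fun m hm => hmem ⟨⟨m, hm⟩, hlt⟩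
        congr 1
        ext n
        simp only [hu, hu', if_neg (not_lt.2 (hlt n)), if_neg (hne n),
          if_neg (not_le.2 (lt_of_le_of_ne (hlt n) (hne n).symm))]
  have hmm : Measurable fun ω => minProd H v K fun n => Z n ω := measurable_minProd hZ hH hv hK
  set a := ∫⁻ z, (1 - u z) ∂Λ with ha
  set h := Λ (H ∩ D) with hh
  have hfin' : h ≠ ∞ := ((measure_mono inter_subset_right).trans_lt hfin.lt_top).ne
  -- `1 - u'` exceeds `1 - u` by exactly the indicator of `H ∩ D`.
  have ha' : ∫⁻ z, (1 - u' z) ∂Λ = a + h := by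
    rw [ha, hh, ← lintegral_indicator_one (hH.inter meq), ← lintegral_add_right]
    · refine lintegral_congr fun z => ?_
      rcases lt_trichotomy (K z) k with hz | hz | hz
      · simp [hu, hu', hz, hz.le, hz.ne, hD, indicator]
      · by_cases hzH : z ∈ H <;> simp [hu, hu', hz, hzH, hD, indicator]
      · simp [hu, hu', hz.not_gt, hz.ne', hz.not_ge, hD, indicator]
    · exact measurable_const.indicator (hH.inter meq)
  have hb' : shellIntensity Λ v K k + Λ D = a + h := by
    rw [← ha', shellIntensity, ← lintegral_indicator_one meq, ← lintegral_add_right]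
    · refine lintegral_congr fun z => ?_
      rcases lt_trichotomy (K z) k with hz | hz | hz
      · simp [hu', hz, hz.le, hz.ne, hD, indicator]
      · simp [hu', hz, hD, indicator]
      · simp [hu', hz.not_gt, hz.ne', hz.not_ge, hD, indicator, hz]
    · exact measurable_const.indicator meq
  have hb : shellIntensity Λ v K k ≤ a := by
    refine lintegral_mono fun z => ?_
    rcases lt_trichotomy (K z) k with hz | hz | hz
    · simp [hu, hz]
    · simp [hz]
    · simp [hu, hz.not_gt, hz.ne', hz]
  -- The difference `e^{-a} - e^{-(a+h)}` of the two generating functionals.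
  have hmain : ∫⁻ ω in A, minProd H v K (fun n => Z n ω) ∂P = negExp a * (1 - negExp h) := by
    have h1 := hPGF u hum hu1
    have h2 := hPGF u' hum' hu1'
    rw [ha'] at h2
    simp_rw [← hpt] at h1
    rw [lintegral_add_left (hmm.indicator hAm), lintegral_indicator hAm, h2, negExp_add] at h1
    rw [ENNReal.mul_sub (fun _ _ => negExp_ne_top a), mul_one]
    exact ENNReal.eq_sub_of_add_eq (ENNReal.mul_ne_top (negExp_ne_top _) (negExp_ne_top _)) h1
  rw [hmain]
  -- Replacing `a` by the shell intensity `b`, which ignores the shell, is controlled by `b ≤ a` and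
  -- `a + h = b + Λ D`.
  constructor
  · exact mul_le_mul' (negExp_antitone hb) (one_sub_negExp_le h)
  · rw [hb', negExp_add, mul_assoc]
    exact mul_le_mul_right (by rw [mul_comm]; exact mul_negExp_le h) _

/-- Bounds for the expectation of `minProd` with an integer valued key. -/
lemma lintegral_minProd_nat_bounds [IsProbabilityMeasure P] (hZ : ∀ n, Measurable (Z n))
    (hPGF : ∀ u : E → ℝ≥0∞, Measurable u → (∀ z, u z ≤ 1) →
      ∫⁻ ω, infProd (fun n => u (Z n ω)) ∂P = negExp (∫⁻ z, (1 - u z) ∂Λ))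
    (hH : MeasurableSet H) (hv : Measurable v) (hv1 : ∀ z, v z ≤ 1)
    {K : E → ℕ} (hK : Measurable K) (hfin : ∀ k, Λ {z | K z = k} ≠ ∞) :
    ∫⁻ ω, minProd H v K (fun n => Z n ω) ∂P
        ≤ ∫⁻ z in H, negExp (shellIntensity Λ v K (K z)) ∂Λ ∧
    ∫⁻ z in H, negExp (shellIntensity Λ v K (K z) + Λ {z' | K z' = K z}) ∂Λ ≤
      ∫⁻ ω, minProd H v K (fun n => Z n ω) ∂P := by
  set A : ℕ → Set Ω := fun k => {ω | (∃ m, K (Z m ω) = k) ∧ ∀ l, k ≤ K (Z l ω)} with hA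
  have hAm : ∀ k, MeasurableSet (A k) := by
    intro k
    have : A k = (⋃ m, {ω | K (Z m ω) = k}) ∩ ⋂ l, {ω | k ≤ K (Z l ω)} := by
      ext ω; simp [hA]
    rw [this]
    refine (MeasurableSet.iUnion fun m => ?_).inter (MeasurableSet.iInter fun l => ?_)
    · exact (hK.comp (hZ m)) (measurableSet_singleton k)
    · exact measurableSet_le measurable_const (hK.comp (hZ l))
  have hdisj : Pairwise (Function.onFun Disjoint A) := by
    intro k l hkl
    refine Set.disjoint_left.2 fun ω ⟨⟨m, hm⟩, hm'⟩ ⟨⟨n, hn⟩, hn'⟩ => hkl ?_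
    exact le_antisymm (hn ▸ hm' n) (hm ▸ hn' m)
  -- Natural numbers are well ordered, so a minimum is always attained; local finiteness is not yet
  -- needed.
  have hU : ⋃ k, A k = univ := by
    refine eq_univ_of_forall fun ω => mem_iUnion.2 ?_
    exact ⟨_, ⟨_, rfl⟩, fun l => Function.argmin_le (fun m => K (Z m ω)) l⟩
  have hsum : ∫⁻ ω, minProd H v K (fun n => Z n ω) ∂P =
      ∑' k, ∫⁻ ω in A k, minProd H v K (fun n => Z n ω) ∂P := by
    rw [← lintegral_iUnion hAm hdisj, hU, Measure.restrict_univ]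
  have hk := fun k => setLIntegral_minProd_shell hZ hPGF hH hv hv1 hK k (hfin k)
  rw [hsum, setLIntegral_comp_nat hK fun k => negExp (shellIntensity Λ v K k),
    setLIntegral_comp_nat hK fun k => negExp (shellIntensity Λ v K k + Λ {z' | K z' = k})]
  exact ⟨ENNReal.tsum_le_tsum fun k => (hk k).1, ENNReal.tsum_le_tsum fun k => (hk k).2⟩

/-! ### Dyadic refinement of a real key -/

/-- The index of the dyadic interval of length `2⁻ⁿ` that contains `x`. -/
noncomputable def dyadicIndex (n : ℕ) (x : ℝ) : ℕ := ⌊2 ^ n * x⌋₊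

lemma measurable_dyadicIndex (n : ℕ) : Measurable (dyadicIndex n) :=
  Nat.measurable_floor.comp (measurable_const.mul measurable_id)

lemma dyadicIndex_mono (n : ℕ) : Monotone (dyadicIndex n) := fun _ _ h =>
  Nat.floor_mono (mul_le_mul_of_nonneg_left h (by positivity))

/-- The dyadic partitions are nested. Hence a strict comparison of indices persists at all finer
levels, which makes the limits below monotone. -/
lemma dyadicIndex_succ (n : ℕ) (x : ℝ) : dyadicIndex n x = dyadicIndex (n + 1) x / 2 := by
  rw [dyadicIndex, dyadicIndex, ← Nat.floor_div_ofNat, pow_succ]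
  congr 1; ring

lemma dyadicIndex_lt_succ {n : ℕ} {x y : ℝ} (h : dyadicIndex n x < dyadicIndex n y) :
    dyadicIndex (n + 1) x < dyadicIndex (n + 1) y := by
  rw [dyadicIndex_succ n x, dyadicIndex_succ n y] at h
  omega

lemma dyadicIndex_lt_of_one_le {n : ℕ} {x y : ℝ} (hx : 0 ≤ x) (h : 1 ≤ 2 ^ n * (y - x)) :
    dyadicIndex n x < dyadicIndex n y := by
  have h1 : (⌊2 ^ n * x⌋₊ : ℝ) ≤ 2 ^ n * x := Nat.floor_le (by positivity)
  refine Nat.lt_of_succ_le (Nat.le_floor ?_)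
  rw [dyadicIndex]
  push_cast
  linarith

lemma eventually_dyadicIndex_lt {x y : ℝ} (hx : 0 ≤ x) (h : x < y) :
    ∀ᶠ n in atTop, dyadicIndex n x < dyadicIndex n y := by
  have := (tendsto_pow_atTop_atTop_of_one_lt (one_lt_two (α := ℝ))).eventually_ge_atTop (y - x)⁻¹
  filter_upwards [this] with n hn
  refine dyadicIndex_lt_of_one_le hx ?_
  have hpos : 0 < y - x := sub_pos.2 h
  calc (1 : ℝ) = (y - x)⁻¹ * (y - x) := (inv_mul_cancel₀ hpos.ne').symm
    _ ≤ _ := mul_le_mul_of_nonneg_right hn hpos.le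

/-- For a locally finite sequence, the points of minimal dyadic index are eventually the points of
minimal key. -/
lemma eventually_forall_dyadicIndex_le_iff {x : ℕ → ℝ} (hx : ∀ n, 0 ≤ x n)
    (hloc : ∀ t, {n | x n ≤ t}.Finite) :
    ∀ᶠ n in atTop, ∀ m, (∀ l, dyadicIndex n (x m) ≤ dyadicIndex n (x l)) ↔ ∀ l, x m ≤ x l := by
  obtain ⟨m₀, hm₀⟩ : ∃ m, ∀ l, x m ≤ x l := by
    obtain ⟨m, hm, hmin⟩ := (hloc (x 0)).exists_minimalFor x _ ⟨0, le_refl (x 0)⟩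
    refine ⟨m, fun l => ?_⟩
    rcases le_total (x l) (x 0) with h | h
    · by_contra hlt
      push Not at hlt
      exact hlt.not_ge (hmin h hlt.le)
    · exact le_trans hm h
  -- Only finitely many keys lie within 1 of the minimum, so a common level separates the
  -- non-minimal ones from it. A gap larger than 1 is seen at every level.
  have hev : ∀ᶠ n in atTop, ∀ m ∈ {m | x m ≤ x m₀ + 1}, x m₀ < x m →
      dyadicIndex n (x m₀) < dyadicIndex n (x m) := by
    rw [(hloc (x m₀ + 1)).eventually_all]
    intro m _
    by_cases h : x m₀ < x m
    · filter_upwards [eventually_dyadicIndex_lt (hx m₀) h] with n hn _ using hn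
    · exact Eventually.of_forall fun n h' => absurd h' h
  filter_upwards [hev] with n hn m
  refine ⟨fun h l => ?_, fun h l => dyadicIndex_mono n (h l)⟩
  suffices x m ≤ x m₀ from this.trans (hm₀ l)
  by_contra hlt
  push Not at hlt
  refine (h m₀).not_gt ?_
  by_cases hle : x m ≤ x m₀ + 1
  · exact hn m hle hlt
  · push Not at hle
    refine dyadicIndex_lt_of_one_le (hx m₀) ?_
    have : (1 : ℝ) ≤ 2 ^ n := one_le_pow₀ (by norm_num)
    nlinarith

/-- The integrand is 0 while the two keys share an interval and keeps its final value once they are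
separated. Monotone convergence thus needs no finite mass. -/
lemma tendsto_shellIntensity_dyadicIndex {W : E → ℝ} (hW : Measurable W) (hW0 : ∀ z, 0 ≤ W z)
    (hv : Measurable v) (z : E) :
    Tendsto (fun n => shellIntensity Λ v (fun z => dyadicIndex n (W z)) (dyadicIndex n (W z)))
      atTop (𝓝 (shellIntensity Λ v W (W z))) := by
  refine lintegral_tendsto_of_tendsto_of_monotone (fun n => ?_)
    (Eventually.of_forall fun z' => ?_) (Eventually.of_forall fun z' => ?_)
  · have hK : Measurable fun z => dyadicIndex n (W z) := (measurable_dyadicIndex n).comp hW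
    exact (Measurable.ite (measurableSet_lt hK measurable_const) measurable_const
      (Measurable.ite (measurableSet_lt measurable_const hK) (measurable_const.sub hv)
        measurable_const)).aemeasurable
  · refine monotone_nat_of_le_succ fun n => ?_
    by_cases h1 : dyadicIndex n (W z') < dyadicIndex n (W z)
    · simp [h1, dyadicIndex_lt_succ h1]
    · by_cases h2 : dyadicIndex n (W z) < dyadicIndex n (W z')
      · have h3 := dyadicIndex_lt_succ h2
        simp [h2, h3, h2.not_gt, h3.not_gt]
      · simp [h1, h2]
  · refine tendsto_const_nhds.congr' ?_
    rcases lt_trichotomy (W z') (W z) with h | h | h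
    · filter_upwards [eventually_dyadicIndex_lt (hW0 _) h] with n hn
      simp [h, hn]
    · simp [h]
    · filter_upwards [eventually_dyadicIndex_lt (hW0 _) h] with n hn
      simp [h, hn, h.not_gt, hn.not_gt]

/-- The intervals around `W z` shrink to a null level set; the one at level 0 has finite mass, so
continuity from above applies. This closes the gap between the two bounds. -/
lemma tendsto_measure_dyadicIndex_eq {W : E → ℝ} (hW : Measurable W) (hW0 : ∀ z, 0 ≤ W z)
    (hfin : ∀ t, Λ {z | W z ≤ t} ≠ ∞) (hatom : ∀ t, Λ {z | W z = t} = 0) (z : E) :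
    Tendsto (fun n => Λ {z' | dyadicIndex n (W z') = dyadicIndex n (W z)}) atTop (𝓝 0) := by
  have hK : ∀ n, Measurable fun z => dyadicIndex n (W z) :=
    fun n => (measurable_dyadicIndex n).comp hW
  have hI : ⋂ n, {z' | dyadicIndex n (W z') = dyadicIndex n (W z)} = {z' | W z' = W z} := by
    ext z'
    simp only [mem_iInter, mem_ofPred_eq]
    refine ⟨fun h => ?_, fun h n => by rw [h]⟩
    by_contra hne
    rcases lt_or_gt_of_ne hne with hlt | hlt <;>
    · obtain ⟨n, hn⟩ := (eventually_dyadicIndex_lt (hW0 _) hlt).exists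
      have := h n
      omega
  rw [← hatom (W z), ← hI]
  refine tendsto_measure_iInter_atTop
    (fun n => ((hK n) (measurableSet_singleton (dyadicIndex n (W z)))).nullMeasurableSet) ?_ ?_
  · refine antitone_nat_of_succ_le fun n z' hz' => ?_
    have : dyadicIndex (n + 1) (W z') = dyadicIndex (n + 1) (W z) := hz'
    change dyadicIndex n (W z') = dyadicIndex n (W z)
    rw [dyadicIndex_succ, this, ← dyadicIndex_succ]
  · refine ⟨0, ((measure_mono fun z' hz' => ?_).trans_lt (hfin (W z + 1)).lt_top).ne⟩
    have hz'' : dyadicIndex 0 (W z') = dyadicIndex 0 (W z) := hz'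
    change W z' ≤ W z + 1
    by_contra hlt
    push Not at hlt
    have := dyadicIndex_lt_of_one_le (n := 0) (hW0 z) (y := W z') (by linarith)
    omega

lemma measure_dyadicIndex_eq_ne_top {W : E → ℝ} (hfin : ∀ t, Λ {z | W z ≤ t} ≠ ∞) (n k : ℕ) :
    Λ {z | dyadicIndex n (W z) = k} ≠ ∞ := by
  refine ((measure_mono fun z hz => ?_).trans_lt (hfin ((k + 1) / 2 ^ n)).lt_top).ne
  have hz' : dyadicIndex n (W z) = k := hz
  have := Nat.lt_floor_add_one (2 ^ n * W z)
  change W z ≤ (k + 1) / 2 ^ n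
  rw [le_div_iff₀ (by positivity), ← hz', mul_comm]
  exact this.le

/-- The joint law of the first point and of the others, tested on products, for a region of finite
intensity. -/
lemma lintegral_minProd_of_ne_top [IsProbabilityMeasure P] (hZ : ∀ n, Measurable (Z n))
    (hPGF : ∀ u : E → ℝ≥0∞, Measurable u → (∀ z, u z ≤ 1) →
      ∫⁻ ω, infProd (fun n => u (Z n ω)) ∂P = negExp (∫⁻ z, (1 - u z) ∂Λ))
    {W : E → ℝ} (hW : Measurable W) (hW0 : ∀ z, 0 ≤ W z) (hfin : ∀ t, Λ {z | W z ≤ t} ≠ ∞)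
    (hatom : ∀ t, Λ {z | W z = t} = 0) (hloc : ∀ᵐ ω ∂P, ∀ t, {n | W (Z n ω) ≤ t}.Finite)
    (hH : MeasurableSet H) (hv : Measurable v) (hv1 : ∀ z, v z ≤ 1) (hHfin : Λ H ≠ ∞) :
    ∫⁻ ω, minProd H v W (fun n => Z n ω) ∂P =
      ∫⁻ z in H, negExp (shellIntensity Λ v W (W z)) ∂Λ := by
  set K : ℕ → E → ℕ := fun n z => dyadicIndex n (W z) with hKdef
  have hK : ∀ n, Measurable (K n) := fun n => (measurable_dyadicIndex n).comp hW
  have hb := fun n => lintegral_minProd_nat_bounds hZ hPGF hH hv hv1 (hK n)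
    (measure_dyadicIndex_eq_ne_top hfin n)
  have hL : Tendsto (fun n => ∫⁻ ω, minProd H v (K n) (fun m => Z m ω) ∂P) atTop
      (𝓝 (∫⁻ ω, minProd H v W (fun n => Z n ω) ∂P)) := by
    refine tendsto_lintegral_of_dominated_convergence (fun _ => 1)
      (fun n => measurable_minProd hZ hH hv (hK n))
      (fun n => Eventually.of_forall fun ω => minProd_le_one _ _ _ _) (by simp) ?_
    filter_upwards [hloc] with ω hω
    refine tendsto_const_nhds.congr' ?_
    filter_upwards [eventually_forall_dyadicIndex_le_iff (fun n => hW0 (Z n ω)) hω] with n hn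
    exact (minProd_congr hn fun _ _ => Iff.rfl).symm
  -- Finite intensity of `H` makes the constant 1 a dominating function for both bounds.
  have hconst : ∫⁻ _ in H, (1 : ℝ≥0∞) ∂Λ ≠ ∞ := by simpa using hHfin
  have hU : Tendsto (fun n => ∫⁻ z in H, negExp (shellIntensity Λ v (K n) (K n z)) ∂Λ) atTop
      (𝓝 (∫⁻ z in H, negExp (shellIntensity Λ v W (W z)) ∂Λ)) := by
    refine tendsto_lintegral_of_dominated_convergence (fun _ => 1)
      (fun n => (measurable_of_countable fun k => negExp (shellIntensity Λ v (K n) k)).comp (hK n))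
      (fun n => Eventually.of_forall fun ω => negExp_le_one _) hconst
      (Eventually.of_forall fun z => ?_)
    exact (continuous_negExp.tendsto _).comp (tendsto_shellIntensity_dyadicIndex hW hW0 hv z)
  have hD : Tendsto (fun n => ∫⁻ z in H, negExp (shellIntensity Λ v (K n) (K n z)
      + Λ {z' | K n z' = K n z}) ∂Λ) atTop
      (𝓝 (∫⁻ z in H, negExp (shellIntensity Λ v W (W z)) ∂Λ)) := by
    refine tendsto_lintegral_of_dominated_convergence (fun _ => 1)
      (fun n => (measurable_of_countable fun k => negExp (shellIntensity Λ v (K n) k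
        + Λ {z' | K n z' = k})).comp (hK n))
      (fun n => Eventually.of_forall fun ω => negExp_le_one _) hconst
      (Eventually.of_forall fun z => ?_)
    refine (continuous_negExp.tendsto _).comp ?_
    simpa using (tendsto_shellIntensity_dyadicIndex hW hW0 hv z).add
      (tendsto_measure_dyadicIndex_eq hW hW0 hfin hatom z)
  exact tendsto_nhds_unique hL
    (tendsto_of_tendsto_of_tendsto_of_le_of_le hD hU (fun n => (hb n).2) fun n => (hb n).1)

/-- The joint law of the first point of a Poisson point process and of the others, tested on
products. -/
theorem lintegral_minProd [IsProbabilityMeasure P] (hZ : ∀ n, Measurable (Z n))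
    (hPGF : ∀ u : E → ℝ≥0∞, Measurable u → (∀ z, u z ≤ 1) →
      ∫⁻ ω, infProd (fun n => u (Z n ω)) ∂P = negExp (∫⁻ z, (1 - u z) ∂Λ))
    {W : E → ℝ} (hW : Measurable W) (hW0 : ∀ z, 0 ≤ W z) (hfin : ∀ t, Λ {z | W z ≤ t} ≠ ∞)
    (hatom : ∀ t, Λ {z | W z = t} = 0) (hloc : ∀ᵐ ω ∂P, ∀ t, {n | W (Z n ω) ≤ t}.Finite)
    (hH : MeasurableSet H) (hv : Measurable v) (hv1 : ∀ z, v z ≤ 1) :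
    ∫⁻ ω, minProd H v W (fun n => Z n ω) ∂P =
      ∫⁻ z in H, negExp (shellIntensity Λ v W (W z)) ∂Λ := by
  -- Truncating the key makes the region finite, as the previous lemma requires.
  set B : ℕ → Set E := fun t => H ∩ {z | W z ≤ t} with hB
  have hBm : ∀ t, MeasurableSet (B t) := fun t => hH.inter (measurableSet_le hW measurable_const)
  have hBmono : Monotone B := fun s t hst z hz =>
    ⟨hz.1, (show W z ≤ s from hz.2).trans (Nat.cast_le.2 hst)⟩
  have hBU : ⋃ t, B t = H := by
    ext z
    simp only [hB, mem_iUnion, mem_inter_iff, mem_ofPred_eq]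
    exact ⟨fun ⟨_, h, _⟩ => h, fun h => ⟨⌈W z⌉₊, h, Nat.le_ceil _⟩⟩
  have heq := fun t => lintegral_minProd_of_ne_top hZ hPGF hW hW0 hfin hatom hloc (hBm t) hv hv1
    ((measure_mono inter_subset_right).trans_lt (hfin t).lt_top).ne
  have hL : Tendsto (fun t => ∫⁻ ω, minProd (B t) v W (fun m => Z m ω) ∂P) atTop
      (𝓝 (∫⁻ ω, minProd H v W (fun n => Z n ω) ∂P)) := by
    refine tendsto_lintegral_of_dominated_convergence (fun _ => 1)
      (fun t => measurable_minProd hZ (hBm t) hv hW)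
      (fun t => Eventually.of_forall fun ω => minProd_le_one _ _ _ _) (by simp)
      (Eventually.of_forall fun ω => ?_)
    refine tendsto_const_nhds.congr' ?_
    -- A minimiser has key at most that of point 0, so beyond this level the truncation is not felt.
    filter_upwards [eventually_ge_atTop ⌈W (Z 0 ω)⌉₊] with t ht
    refine (minProd_congr (fun _ => Iff.rfl) fun m hm => ?_).symm
    refine ⟨fun h => h.1, fun h => ⟨h, ?_⟩⟩
    exact (hm 0).trans ((Nat.le_ceil _).trans (Nat.cast_le.2 ht))
  have hR : Tendsto (fun t => ∫⁻ z in B t, negExp (shellIntensity Λ v W (W z)) ∂Λ) atTop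
      (𝓝 (∫⁻ z in H, negExp (shellIntensity Λ v W (W z)) ∂Λ)) := by
    rw [← hBU, setLIntegral_iUnion_of_directed _ hBmono.directed_le]
    exact tendsto_atTop_iSup fun s t hst => lintegral_mono_set (hBmono hst)
  exact tendsto_nhds_unique hL (by simpa only [heq] using hR)

end FirstPoint

/-! ### Polar coordinates -/

/-- Polar coordinates off the origin, a null set. The total mass of the sphere measure is the
dimension times the volume of the unit ball, here `2π`. -/
lemma lintegral_comp_norm (f : ℝ → ℝ≥0∞) (hf : Measurable f) :
    ∫⁻ x : Plane, f ‖x‖ = ENNReal.ofReal (2 * Real.pi) * ∫⁻ r in Ioi (0 : ℝ),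
      ENNReal.ofReal r * f r := by
  have hdim : Module.finrank ℝ Plane = 2 := by simp
  have h1 : ∫⁻ x : Plane, f ‖x‖ = ∫⁻ x : ({(0 : Plane)}ᶜ : Set Plane), f ‖x.1‖
      ∂((volume : Measure Plane).comap (↑)) := by
    rw [lintegral_subtype_comap (measurableSet_singleton _).compl fun x : Plane => f ‖x‖,
      MeasureTheory.restrict_compl_singleton]
  have h2 := (volume : Measure Plane).measurePreserving_homeomorphUnitSphereProd.lintegral_comp
    (f := fun x => f x.2) (by fun_prop)
  simp only [homeomorphUnitSphereProd_apply_snd_coe] at h2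
  rw [h1, h2, lintegral_prod _ (by fun_prop)]
  simp only
  rw [lintegral_const, Measure.toSphere_apply_univ, hdim,
    Measure.volumeIoiPow, lintegral_withDensity_eq_lintegral_mul _ (by fun_prop) (by fun_prop)]
  have h3 := lintegral_subtype_comap (μ := volume) (measurableSet_Ioi (a := (0 : ℝ)))
    fun r => ENNReal.ofReal r * f r
  simp only [Pi.mul_apply, Nat.add_one_sub_one, pow_one]
  rw [h3, mul_comm, EuclideanSpace.volume_ball_fin_two]
  congr 1
  rw [ENNReal.ofReal_mul zero_le_two]
  simp

lemma lintegral_markedIntensity_norm {lam : ℝ} (hlam : 0 < lam) (ν : Measure ℝ) [SFinite ν]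
    {F : ℝ × LinkState × ℝ → ℝ≥0∞} (hF : Measurable F) :
    ∫⁻ z, F (‖z.1‖, z.2) ∂markedIntensity (ENNReal.ofReal lam • volume) ν =
      ENNReal.ofReal (2 * Real.pi * lam) * ∑ j, ∫⁻ r in Ioi (0 : ℝ),
        ENNReal.ofReal (r * linkProb j r) * ∫⁻ g, F (r, j, g) ∂ν := by
  have hFj : ∀ j, Measurable fun r => ∫⁻ g, F (r, j, g) ∂ν := fun j =>
    Measurable.lintegral_prod_right' (f := fun q : ℝ × ℝ => F (q.1, j, q.2))
      (hF.comp (by fun_prop))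
  have hp : ∀ j, Measurable fun r => ENNReal.ofReal (linkProb j r) := fun j =>
    (continuous_linkProb j).measurable.ennreal_ofReal
  rw [lintegral_markedIntensity _ _
    (show Measurable fun z : Plane × LinkState × ℝ => F (‖z.1‖, z.2) by fun_prop),
    lintegral_smul_measure,
    lintegral_comp_norm (fun r => ∑ j, ENNReal.ofReal (linkProb j r) * ∫⁻ g, F (r, j, g) ∂ν)
      (Finset.measurable_sum _ fun j _ => (hp j).mul (hFj j)), smul_eq_mul, ← mul_assoc,
    ← ENNReal.ofReal_mul hlam.le, mul_comm lam]
  congr 1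
  have hm : ∀ j, Measurable fun r => ENNReal.ofReal (r * linkProb j r) * ∫⁻ g, F (r, j, g) ∂ν :=
    fun j => (measurable_id.mul (continuous_linkProb j).measurable).ennreal_ofReal.mul (hFj j)
  rw [← lintegral_finsetSum _ fun j _ => hm j]
  refine setLIntegral_congr_fun measurableSet_Ioi fun r hr => ?_
  simp only [Finset.mul_sum]
  refine Finset.sum_congr rfl fun j _ => ?_
  rw [ENNReal.ofReal_mul (le_of_lt hr), mul_assoc]

/-! ### The reciprocal path loss -/

/-- The reciprocal path loss `r^α_j / β_j` of a marked point. -/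
noncomputable def lossKey (α β : LinkState → ℝ) (z : Plane × LinkState × ℝ) : ℝ :=
  ‖z.1‖ ^ α z.2.1 / β z.2.1

section Key

variable {α β : LinkState → ℝ}

lemma lossKey_nonneg (hβ : ∀ j, 0 < β j) (z : Plane × LinkState × ℝ) : 0 ≤ lossKey α β z :=
  div_nonneg (Real.rpow_nonneg (norm_nonneg _) _) (hβ _).le

lemma measurable_linkState_fst {γ : Type*} [MeasurableSpace γ] {f : LinkState × ℝ → γ}
    (hf : ∀ j, Measurable fun r => f (j, r)) : Measurable f :=
  measurable_from_prod_countable_right hf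

lemma measurable_lossKey : Measurable (lossKey α β) := by
  have : Measurable fun q : LinkState × ℝ => q.2 ^ α q.1 / β q.1 :=
    measurable_linkState_fst fun j => by
      change Measurable fun r : ℝ => r ^ α j / β j
      fun_prop
  exact this.comp (measurable_snd.fst.prodMk measurable_fst.norm)

lemma exclusionRadius_nonneg (hβ : ∀ j, 0 < β j) (i j : LinkState) {r : ℝ} (hr : 0 ≤ r) :
    0 ≤ exclusionRadius α β i j r :=
  Real.rpow_nonneg (div_nonneg (mul_nonneg (hβ j).le (Real.rpow_nonneg hr _)) (hβ i).le) _

lemma exclusionRadius_self (hα : ∀ j, 0 < α j) (hβ : ∀ j, 0 < β j) (i : LinkState) {r : ℝ}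
    (hr : 0 ≤ r) : exclusionRadius α β i i r = r := by
  rw [exclusionRadius, mul_div_cancel_left₀ _ (hβ i).ne', one_div,
    Real.rpow_rpow_inv hr (hα i).ne']

/-- Keys increase with distance within each state, so comparing keys across states amounts to
comparing distances with the exclusion radius. -/
lemma rpow_div_lt_iff (hα : ∀ j, 0 < α j) (hβ : ∀ j, 0 < β j) (i j : LinkState) {r v : ℝ}
    (hr : 0 ≤ r) (hv : 0 ≤ v) :
    v ^ α j / β j < r ^ α i / β i ↔ v < exclusionRadius α β i j r := by
  rw [exclusionRadius, one_div, Real.lt_rpow_inv_iff_of_pos hv _ (hα j), div_lt_iff₀ (hβ j),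
    div_mul_eq_mul_div, mul_comm]
  exact div_nonneg (mul_nonneg (hβ j).le (Real.rpow_nonneg hr _)) (hβ i).le

lemma lt_rpow_div_iff (hα : ∀ j, 0 < α j) (hβ : ∀ j, 0 < β j) (i j : LinkState) {r v : ℝ}
    (hr : 0 ≤ r) (hv : 0 ≤ v) :
    r ^ α i / β i < v ^ α j / β j ↔ exclusionRadius α β i j r < v := by
  rw [exclusionRadius, one_div, Real.rpow_inv_lt_iff_of_pos _ hv (hα j), lt_div_iff₀ (hβ j),
    div_mul_eq_mul_div, mul_comm]
  exact div_nonneg (mul_nonneg (hβ j).le (Real.rpow_nonneg hr _)) (hβ i).le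

/-- A sublevel set of the key lies over a ball. Finite intensity below each level and local
finiteness of the keys both follow. -/
lemma exists_norm_le_of_lossKey_le (hα : ∀ j, 0 < α j) (hβ : ∀ j, 0 < β j) (t : ℝ) :
    ∃ R : ℝ, ∀ z : Plane × LinkState × ℝ, lossKey α β z ≤ t → ‖z.1‖ ≤ R := by
  have hj : ∀ (j : LinkState) (r : ℝ), 0 ≤ r → r ^ α j / β j ≤ t → r ≤ (t * β j) ^ (α j)⁻¹ := by
    intro j r hr h
    rw [div_le_iff₀ (hβ j)] at h
    exact (Real.le_rpow_inv_iff_of_pos hr ((Real.rpow_nonneg hr _).trans h) (hα j)).2 h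
  refine ⟨max ((t * β .L) ^ (α .L)⁻¹) ((t * β .N) ^ (α .N)⁻¹), fun ⟨x, j, g⟩ h => ?_⟩
  cases j
  · exact (hj .L _ (norm_nonneg _) h).trans (le_max_left _ _)
  · exact (hj .N _ (norm_nonneg _) h).trans (le_max_right _ _)

variable {lam : ℝ} {ν : Measure ℝ}

/-- The marks carry total mass 1 at each location, so projecting them away recovers `Λ`. -/
lemma markedIntensity_preimage_fst [IsProbabilityMeasure ν] (Λ : Measure Plane) {B : Set Plane}
    (hB : MeasurableSet B) : markedIntensity Λ ν (Prod.fst ⁻¹' B) = Λ B := by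
  rw [← lintegral_indicator_one (measurable_fst hB),
    lintegral_markedIntensity _ _ (measurable_one.indicator (measurable_fst hB)),
    ← lintegral_indicator_one hB]
  refine lintegral_congr fun x => ?_
  have h : ∀ j (g : ℝ), (Prod.fst ⁻¹' B : Set (Plane × LinkState × ℝ)).indicator
      (1 : Plane × LinkState × ℝ → ℝ≥0∞) (x, j, g) = B.indicator 1 x := by
    intro j g
    by_cases hx : x ∈ B <;> simp [hx, indicator]
  simp only [h, lintegral_const, measure_univ, mul_one]
  rw [← Finset.sum_mul, sum_ofReal_linkProb (norm_nonneg x), one_mul]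

lemma markedIntensity_lossKey_le_ne_top [IsProbabilityMeasure ν] (hα : ∀ j, 0 < α j)
    (hβ : ∀ j, 0 < β j) (t : ℝ) :
    markedIntensity (ENNReal.ofReal lam • volume) ν {z | lossKey α β z ≤ t} ≠ ∞ := by
  obtain ⟨R, hR⟩ := exists_norm_le_of_lossKey_le hα hβ t
  refine ((measure_mono (t := Prod.fst ⁻¹' Metric.closedBall (0 : Plane) R)
    fun z hz => ?_).trans_lt ?_).ne
  · simpa using hR z hz
  · rw [markedIntensity_preimage_fst _ Metric.isClosed_closedBall.measurableSet]
    exact ENNReal.mul_lt_top ENNReal.ofReal_lt_top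
      (isCompact_closedBall (0 : Plane) R).measure_lt_top

/-- A level set of the key lies over two circles, one per state, which are Lebesgue null. -/
lemma markedIntensity_lossKey_eq [IsProbabilityMeasure ν] (hα : ∀ j, 0 < α j)
    (hβ : ∀ j, 0 < β j) (t : ℝ) :
    markedIntensity (ENNReal.ofReal lam • volume) ν {z | lossKey α β z = t} = 0 := by
  refine measure_mono_null (t := Prod.fst ⁻¹' (⋃ j, Metric.sphere (0 : Plane)
    ((t * β j) ^ (α j)⁻¹))) (fun ⟨x, j, g⟩ hz => ?_) ?_
  · have h : ‖x‖ ^ α j / β j = t := hz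
    rw [div_eq_iff (hβ j).ne'] at h
    refine mem_iUnion.2 ⟨j, ?_⟩
    rw [mem_sphere_zero_iff_norm, ← h, Real.rpow_rpow_inv (norm_nonneg x) (hα j).ne']
  · rw [markedIntensity_preimage_fst _
      (MeasurableSet.iUnion fun j => Metric.isClosed_sphere.measurableSet)]
    rw [Measure.smul_apply, measure_iUnion_null fun j =>
      Measure.addHaar_sphere (volume : Measure Plane) 0 _, smul_zero]

end Key

/-! ### Existence and almost sure uniqueness of the strongest base station -/

section Model

variable {Ω : Type*} [MeasurableSpace Ω] {P : Measure Ω} [IsProbabilityMeasure P]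
  {lam μo : ℝ} {fG : ℝ → ℝ} {α β : LinkState → ℝ}
  {X : ℕ → Ω → Plane} {S : ℕ → Ω → LinkState} {Go : Ω → ℝ} {G : ℕ → Ω → ℝ}

lemma ae_finite_lossKey_le
    (hX : IsPoissonPointProcess P (ENNReal.ofReal lam • (volume : Measure Plane)) X)
    (hα : ∀ j, 0 < α j) (hβ : ∀ j, 0 < β j) :
    ∀ᵐ ω ∂P, ∀ t, {n | lossKey α β (X n ω, S n ω, G n ω) ≤ t}.Finite := by
  have : ∀ᵐ ω ∂P, ∀ k : ℕ, pointCount X (Metric.closedBall (0 : Plane) k) ω ≠ ⊤ :=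
    ae_all_iff.2 fun k => hX.ae_pointCount_ne_top Metric.isClosed_closedBall.measurableSet
      (ENNReal.mul_lt_top ENNReal.ofReal_lt_top
        (isCompact_closedBall (0 : Plane) k).measure_lt_top).ne
  filter_upwards [this] with ω hω t
  obtain ⟨R, hR⟩ := exists_norm_le_of_lossKey_le hα hβ t
  refine (Set.encard_ne_top_iff.1 (hω ⌈R⌉₊)).subset fun n hn => ?_
  have := (hR _ hn).trans (Nat.le_ceil R)
  simpa using this

/-- The number of points at the origin is Poisson of mean 0; the weight of `k = 0` is `e^0 * 0^0 /
0! = 1`. -/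
lemma ae_ne_zero
    (hX : IsPoissonPointProcess P (ENNReal.ofReal lam • (volume : Measure Plane)) X) :
    ∀ᵐ ω ∂P, ∀ n, X n ω ≠ 0 := by
  have h0 : (ENNReal.ofReal lam • (volume : Measure Plane)) {0} = 0 := by simp
  have h := hX.count_law {0} (measurableSet_singleton _) (by simp [h0]) 0
  rw [h0] at h
  have hm := measurable_pointCount hX.measurable (measurableSet_singleton (0 : Plane))
    (measurableSet_singleton (0 : ℕ∞))
  have h1 : P (pointCount X {0} ⁻¹' {0}) = 1 := by
    refine Eq.trans ?_ (h.trans (by simp))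
    congr 1
  have h2 : ∀ᵐ ω ∂P, ω ∈ pointCount X {0} ⁻¹' {0} := (prob_compl_eq_zero_iff hm).2 h1
  filter_upwards [h2] with ω hω n hn
  have : {n : ℕ | X n ω ∈ ({0} : Set Plane)}.encard = 0 := hω
  rw [Set.encard_eq_zero] at this
  exact (this.le (show n ∈ {n : ℕ | X n ω ∈ ({0} : Set Plane)} from hn)).elim

/-- The gains are independent and their law has a density, hence no atoms. Distinct gains will tell
the indices apart without knowing that the locations are distinct. -/
lemma IsGainModel.ae_injective (hG : IsGainModel P X S μo fG Go G) :
    ∀ᵐ ω ∂P, ∀ m n, m ≠ n → G m ω ≠ G n ω := by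
  refine ae_all_iff.2 fun m => ae_all_iff.2 fun n => ?_
  by_cases hmn : m = n
  · exact Eventually.of_forall fun ω h => absurd hmn h
  have hd : MeasurableSet {q : ℝ × ℝ | q.1 = q.2} :=
    measurableSet_eq_fun measurable_fst measurable_snd
  have h := lintegral_comp_prodMk_of_indepFun (hG.measurable_misaligned m)
    (hG.measurable_misaligned n) (hG.misaligned_iIndep.indepFun hmn)
    (Φ := {q : ℝ × ℝ | q.1 = q.2}.indicator 1) (measurable_one.indicator hd)
  have h0 : ∀ ω, ∫⁻ ω', {q : ℝ × ℝ | q.1 = q.2}.indicator (1 : ℝ × ℝ → ℝ≥0∞)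
      (G m ω, G n ω') ∂P = 0 := by
    intro ω
    have e : ∀ ω', {q : ℝ × ℝ | q.1 = q.2}.indicator (1 : ℝ × ℝ → ℝ≥0∞) (G m ω, G n ω') =
        (G n ⁻¹' {G m ω}).indicator 1 ω' := by
      intro ω'
      simp [indicator, eq_comm]
    simp_rw [e]
    have hs := hG.measurable_misaligned n (measurableSet_singleton (G m ω))
    rw [lintegral_indicator_one hs, ← Measure.map_apply (hG.measurable_misaligned n)
      (measurableSet_singleton _), hG.misaligned_law n]
    exact withDensity_absolutelyContinuous _ _ (by simp)
  simp_rw [h0] at h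
  rw [lintegral_zero] at h
  have hmeas : Measurable fun ω => {q : ℝ × ℝ | q.1 = q.2}.indicator (1 : ℝ × ℝ → ℝ≥0∞)
      (G m ω, G n ω) := (measurable_one.indicator hd).comp
    ((hG.measurable_misaligned m).prodMk (hG.measurable_misaligned n))
  filter_upwards [(lintegral_eq_zero_iff hmeas).1 h] with ω hω _ heq
  simp [heq] at hω

/-- The sequence of marked points. -/
def markedPoint (X : ℕ → Ω → Plane) (S : ℕ → Ω → LinkState) (G : ℕ → Ω → ℝ) (n : ℕ) (ω : Ω) :
    Plane × LinkState × ℝ :=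
  (X n ω, S n ω, G n ω)

lemma measurable_markedPoint (hX : ∀ n, Measurable (X n)) (hS : ∀ n, Measurable (S n))
    (hG : ∀ n, Measurable (G n)) (n : ℕ) : Measurable (markedPoint X S G n) :=
  (hX n).prodMk ((hS n).prodMk (hG n))

/-- The joint law of the first marked point and of the others. -/
lemma lintegral_minProd_marked
    (hX : IsPoissonPointProcess P (ENNReal.ofReal lam • (volume : Measure Plane)) X)
    (hS : IsStateThinning P X S) (hG : IsGainModel P X S μo fG Go G)
    (hα : ∀ j, 0 < α j) (hβ : ∀ j, 0 < β j)
    {H : Set (Plane × LinkState × ℝ)} (hH : MeasurableSet H)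
    {v : Plane × LinkState × ℝ → ℝ≥0∞} (hv : Measurable v) (hv1 : ∀ z, v z ≤ 1) :
    ∫⁻ ω, minProd H v (lossKey α β) (fun n => markedPoint X S G n ω) ∂P =
      ∫⁻ z in H, negExp (shellIntensity (markedIntensity (ENNReal.ofReal lam • volume)
        (P.map (G 0))) v (lossKey α β) (lossKey α β z))
        ∂markedIntensity (ENNReal.ofReal lam • volume) (P.map (G 0)) := by
  have := Measure.isProbabilityMeasure_map (μ := P) (hG.measurable_misaligned 0).aemeasurable
  have : SigmaFinite (ENNReal.ofReal lam • (volume : Measure Plane)) :=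
    inferInstanceAs (SigmaFinite (lam.toNNReal • (volume : Measure Plane)))
  refine lintegral_minProd
    (measurable_markedPoint hX.measurable hS.measurable hG.measurable_misaligned)
    (fun u hu hu1 => lintegral_infProd_marked hX hS hG hu hu1) measurable_lossKey
    (lossKey_nonneg hβ) (markedIntensity_lossKey_le_ne_top hα hβ)
    (markedIntensity_lossKey_eq hα hβ) (ae_finite_lossKey_le hX hα hβ) hH hv hv1

lemma ae_exists_min
    (hX : IsPoissonPointProcess P (ENNReal.ofReal lam • (volume : Measure Plane)) X)
    (hα : ∀ j, 0 < α j) (hβ : ∀ j, 0 < β j) :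
    ∀ᵐ ω ∂P, ∃ m, ∀ l,
      lossKey α β (markedPoint X S G m ω) ≤ lossKey α β (markedPoint X S G l ω) := by
  filter_upwards [ae_finite_lossKey_le (S := S) (G := G) hX hα hβ] with ω hloc
  set x : ℕ → ℝ := fun n => lossKey α β (markedPoint X S G n ω)
  obtain ⟨m, hm, hmin⟩ := (hloc (x 0)).exists_minimalFor x _ ⟨0, le_refl (x 0)⟩
  refine ⟨m, fun l => ?_⟩
  rcases le_total (x l) (x 0) with h | h
  · by_contra hlt
    push Not at hlt
    exact hlt.not_ge (hmin h hlt.le)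
  · exact le_trans hm h

/-- Any measurable set contains, almost surely, all or none of the points of minimal path loss. -/
lemma ae_forall_min_mem_or
    (hX : IsPoissonPointProcess P (ENNReal.ofReal lam • (volume : Measure Plane)) X)
    (hS : IsStateThinning P X S) (hG : IsGainModel P X S μo fG Go G)
    (hα : ∀ j, 0 < α j) (hβ : ∀ j, 0 < β j)
    {H : Set (Plane × LinkState × ℝ)} (hH : MeasurableSet H) :
    ∀ᵐ ω ∂P,
      (∀ m, (∀ l, lossKey α β (markedPoint X S G m ω) ≤ lossKey α β (markedPoint X S G l ω)) →
        markedPoint X S G m ω ∈ H) ∨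
      (∀ m, (∀ l, lossKey α β (markedPoint X S G m ω) ≤ lossKey α β (markedPoint X S G l ω)) →
        markedPoint X S G m ω ∉ H) := by
  set Y : Set (Plane × LinkState × ℝ) → Ω → ℝ≥0∞ := fun H ω =>
    minProd H 1 (lossKey α β) (fun n => markedPoint X S G n ω) with hY
  have hZ := measurable_markedPoint hX.measurable hS.measurable hG.measurable_misaligned
  have hYm : ∀ {H}, MeasurableSet H → Measurable (Y H) := fun hH =>
    measurable_minProd hZ hH measurable_one measurable_lossKey
  have hint : ∀ {H}, MeasurableSet H → ∫⁻ ω, Y H ω ∂P = _ := fun {H} hH =>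
    lintegral_minProd_marked (v := 1) hX hS hG hα hβ hH measurable_one fun _ => le_rfl
  have hzero : ∀ {H ω m}, (∀ l, lossKey α β (markedPoint X S G m ω) ≤
      lossKey α β (markedPoint X S G l ω)) → markedPoint X S G m ω ∉ H → Y H ω = 0 := by
    intro H ω m hm hmH
    refine infProd_eq_zero (n := m) ?_
    rw [if_pos hm, indicator_of_notMem hmH]
  have huniv : ∀ ω, Y univ ω = 1 := by
    intro ω
    simp [hY, minProd]
  -- For `v = 1` the first-point formula is additive in `H`, and for the whole space `Y` is
  -- constantly 1.
  have hsum : ∫⁻ ω, (Y H ω + Y Hᶜ ω) ∂P = ∫⁻ _, 1 ∂P := by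
    rw [lintegral_add_left (hYm hH), hint hH, hint hH.compl, lintegral_add_compl _ hH]
    have := hint MeasurableSet.univ
    simp_rw [huniv] at this
    rw [this, Measure.restrict_univ]
  -- A minimiser lies outside `H` or outside its complement, which kills one summand. Equal
  -- integrals then force the sum to be 1 almost surely, whereas minimisers on both sides would make
  -- it 0.
  have hle : (fun ω => Y H ω + Y Hᶜ ω) ≤ᵐ[P] fun _ => 1 := by
    filter_upwards [ae_exists_min (S := S) (G := G) hX hα hβ] with ω ⟨m, hm⟩
    by_cases h : markedPoint X S G m ω ∈ H
    · rw [hzero (H := Hᶜ) hm (by simpa using h), add_zero]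
      exact minProd_le_one _ _ _ _
    · rw [hzero hm h, zero_add]
      exact minProd_le_one _ _ _ _
  have hae := ae_eq_of_ae_le_of_lintegral_le hle (by rw [hsum]; simp) aemeasurable_const
    hsum.ge
  filter_upwards [hae] with ω hω
  by_contra hcon
  push Not at hcon
  obtain ⟨⟨m, hm, hmH⟩, ⟨n, hn, hnH⟩⟩ := hcon
  rw [hzero hm hmH, hzero (H := Hᶜ) hn (by simpa using hnH)] at hω
  simp at hω

/-- Almost surely there is exactly one point of minimal path loss. -/
lemma ae_existsUnique_min
    (hX : IsPoissonPointProcess P (ENNReal.ofReal lam • (volume : Measure Plane)) X)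
    (hS : IsStateThinning P X S) (hG : IsGainModel P X S μo fG Go G)
    (hα : ∀ j, 0 < α j) (hβ : ∀ j, 0 < β j) :
    ∀ᵐ ω ∂P, ∃! m, ∀ l,
      lossKey α β (markedPoint X S G m ω) ≤ lossKey α β (markedPoint X S G l ω) := by
  -- Two minimisers would have distinct gains, separated by some rational `q`; the set of marks with
  -- gain at most `q` would then contain only one of them.
  have hq : ∀ᵐ ω ∂P, ∀ q : ℚ, _ := ae_all_iff.2 fun q : ℚ =>
    ae_forall_min_mem_or (α := α) (β := β) hX hS hG hα hβ
      (H := {z | z.2.2 ≤ (q : ℝ)}) (measurableSet_le measurable_snd.snd measurable_const)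
  filter_upwards [hq, hG.ae_injective, ae_exists_min (S := S) (G := G) hX hα hβ]
    with ω hω hinj ⟨m, hm⟩
  refine ⟨m, hm, fun n hn => ?_⟩
  by_contra hne
  have hlt : ∀ a b, (∀ l, lossKey α β (markedPoint X S G a ω) ≤
      lossKey α β (markedPoint X S G l ω)) → (∀ l, lossKey α β (markedPoint X S G b ω) ≤
      lossKey α β (markedPoint X S G l ω)) → ¬ G a ω < G b ω := by
    intro a b ha hb hab
    obtain ⟨q, hq1, hq2⟩ := exists_rat_btwn hab
    rcases hω q with h | h
    · exact (h b hb).not_gt hq2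
    · exact h a ha hq1.le
  exact hinj n m hne (le_antisymm (not_lt.1 (hlt m n hm hn)) (not_lt.1 (hlt n m hn hm)))

end Model

/-! ### Measurability of the association -/

lemma measurable_sInf_nat {Ω : Type*} [MeasurableSpace Ω] {A : ℕ → Set Ω}
    (hA : ∀ n, MeasurableSet (A n)) : Measurable fun ω => sInf {n | ω ∈ A n} := by
  refine measurable_to_countable' fun k => ?_
  have h : (fun ω => sInf {n | ω ∈ A n}) ⁻¹' {k} =
      -- The extra set at `k = 0` accounts for `sInf ∅ = 0`.
      (A k ∩ ⋂ m ∈ Finset.range k, (A m)ᶜ) ∪ (if k = 0 then ⋂ m, (A m)ᶜ else ∅) := by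
    ext ω
    simp only [mem_preimage, mem_singleton_iff, mem_union, mem_inter_iff, mem_iInter,
      Finset.mem_range, mem_compl_iff]
    constructor
    · rintro rfl
      by_cases hne : {n | ω ∈ A n}.Nonempty
      · exact Or.inl ⟨Nat.sInf_mem hne, fun m hm => Nat.notMem_of_lt_sInf hm⟩
      · rw [not_nonempty_iff_eq_empty] at hne
        right
        rw [hne, Nat.sInf_empty, if_pos rfl]
        simp only [mem_iInter, mem_compl_iff]
        exact fun m hm => (hne.le hm : m ∈ (∅ : Set ℕ))
    · rintro (⟨h1, h2⟩ | h)
      · refine le_antisymm (Nat.sInf_le h1) (le_of_not_gt fun hlt => ?_)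
        exact h2 _ hlt (Nat.sInf_mem (s := {n | ω ∈ A n}) ⟨k, h1⟩)
      · by_cases hk : k = 0
        · subst hk
          rw [if_pos rfl] at h
          simp only [mem_iInter, mem_compl_iff] at h
          have : {n | ω ∈ A n} = ∅ := eq_empty_of_forall_notMem h
          rw [this, Nat.sInf_empty]
        · rw [if_neg hk] at h
          exact h.elim
  rw [h]
  refine ((hA k).inter (Finset.measurableSet_biInter _ fun m _ => (hA m).compl)).union ?_
  split_ifs
  · exact MeasurableSet.iInter fun m => (hA m).compl
  · exact MeasurableSet.empty

section Association

variable {Ω : Type*} [MeasurableSpace Ω] {α β : LinkState → ℝ}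
  {X : ℕ → Ω → Plane} {S : ℕ → Ω → LinkState} {G : ℕ → Ω → ℝ}

lemma measurable_pathLoss : Measurable fun q : LinkState × ℝ => pathLoss α β q.1 q.2 :=
  measurable_linkState_fst fun j => by
    change Measurable fun r : ℝ => β j * r ^ (-α j)
    fun_prop

lemma measurable_serving (hX : ∀ n, Measurable (X n)) (hS : ∀ n, Measurable (S n)) :
    Measurable (serving α β X S) := by
  refine measurable_sInf_nat (A := fun n => {ω | ∀ m, pathLoss α β (S m ω) ‖X m ω‖ ≤
    pathLoss α β (S n ω) ‖X n ω‖}) fun n => ?_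
  have h : ∀ n, Measurable fun ω => pathLoss α β (S n ω) ‖X n ω‖ := fun n =>
    measurable_pathLoss.comp ((hS n).prodMk (hX n).norm)
  simp only [Set.ofPred_forall]
  exact MeasurableSet.iInter fun m => measurableSet_le (h m) (h n)

lemma measurable_eval_nat {γ : Type*} [MeasurableSpace γ] {f : ℕ → Ω → γ}
    (hf : ∀ n, Measurable (f n)) {τ : Ω → ℕ} (hτ : Measurable τ) :
    Measurable fun ω => f (τ ω) ω :=
  (measurable_from_prod_countable_right (f := fun q : ℕ × Ω => f q.1 q.2) hf).comp
    (hτ.prodMk measurable_id)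

lemma measurable_servingState (hX : ∀ n, Measurable (X n)) (hS : ∀ n, Measurable (S n)) :
    Measurable (servingState α β X S) :=
  measurable_eval_nat hS (measurable_serving hX hS)

lemma measurable_servingDist (hX : ∀ n, Measurable (X n)) (hS : ∀ n, Measurable (S n)) :
    Measurable (servingDist α β X S) :=
  measurable_eval_nat (fun n => (hX n).norm) (measurable_serving hX hS)

lemma measurable_interference (hX : ∀ n, Measurable (X n)) (hS : ∀ n, Measurable (S n))
    (hG : ∀ n, Measurable (G n)) (j : LinkState) : Measurable (interference α β X S G j) := by
  refine Measurable.tsum fun n => Measurable.ite ?_ ?_ measurable_const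
  · exact (measurableSet_eq_fun measurable_const (measurable_serving hX hS)).compl.inter
      (hS n (measurableSet_singleton j))
  · exact ((hG n).mul (measurable_pathLoss.comp (measurable_const.prodMk (hX n).norm))).ennreal_ofReal

end Association

/-! ### The intensity seen from the serving base station -/

/-- The negative logarithm of `interferenceLaplace`. -/
noncomputable def laplaceExponent (lam : ℝ) (α β : LinkState → ℝ) (fG : ℝ → ℝ) (i j : LinkState)
    (r s : ℝ) : ℝ≥0∞ :=
  ENNReal.ofReal (2 * Real.pi * lam) *
    ∫⁻ g in Set.Ioi (0 : ℝ),
      (∫⁻ v in Set.Ioi (exclusionRadius α β i j r),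
        ENNReal.ofReal ((1 - Real.exp (-(pathLoss α β j v * s * g))) * v * linkProb j v)) *
      ENNReal.ofReal (fG g)

lemma interferenceLaplace_nonneg (lam : ℝ) (α β : LinkState → ℝ) (fG : ℝ → ℝ) (i j : LinkState)
    (r s : ℝ) : 0 ≤ interferenceLaplace lam α β fG i j r s := expNeg_nonneg _

lemma ofReal_interferenceLaplace (lam : ℝ) (α β : LinkState → ℝ) (fG : ℝ → ℝ) (i j : LinkState)
    (r s : ℝ) : ENNReal.ofReal (interferenceLaplace lam α β fG i j r s) =
      negExp (laplaceExponent lam α β fG i j r s) := ofReal_expNeg _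

/-- The contribution of a marked point to the exponent `∑ j, s j * I^j`. -/
noncomputable def weightedPower (α β : LinkState → ℝ) (s : LinkState → ℝ)
    (z : Plane × LinkState × ℝ) : ℝ≥0∞ :=
  ENNReal.ofReal (s z.2.1) * ENNReal.ofReal (z.2.2 * pathLoss α β z.2.1 ‖z.1‖)

section Intensity

variable {lam : ℝ} {α β : LinkState → ℝ} {fG : ℝ → ℝ} {s : LinkState → ℝ}

lemma pathLoss_nonneg (hβ : ∀ j, 0 < β j) (j : LinkState) {r : ℝ} (hr : 0 ≤ r) :
    0 ≤ pathLoss α β j r :=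
  mul_nonneg (hβ j).le (Real.rpow_nonneg hr _)

lemma measurable_weightedPower : Measurable (weightedPower α β s) := by
  have h : Measurable fun z : Plane × LinkState × ℝ => pathLoss α β z.2.1 ‖z.1‖ :=
    measurable_pathLoss.comp (measurable_snd.fst.prodMk measurable_fst.norm)
  have h' : Measurable fun z : Plane × LinkState × ℝ => ENNReal.ofReal (s z.2.1) :=
    (measurable_of_countable fun j => ENNReal.ofReal (s j)).comp measurable_snd.fst
  exact h'.mul ((measurable_snd.snd.mul h).ennreal_ofReal)

lemma lintegral_ofReal_mul_linkProb (j : LinkState) {ρ : ℝ} (hρ : 0 ≤ ρ) :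
    ∫⁻ v in Ioo 0 ρ, ENNReal.ofReal (v * linkProb j v) =
      ENNReal.ofReal (∫ v in (0 : ℝ)..ρ, v * linkProb j v) := by
  have hc : Continuous fun v : ℝ => v * linkProb j v := continuous_id.mul (continuous_linkProb j)
  rw [intervalIntegral.integral_of_le hρ, ofReal_integral_eq_lintegral_ofReal,
    Measure.restrict_congr_set Ioo_ae_eq_Ioc]
  · exact hc.integrableOn_Ioc
  · refine (ae_restrict_iff' measurableSet_Ioc).2 (Eventually.of_forall fun v hv => ?_)
    exact mul_nonneg hv.1.le (linkProb_nonneg j hv.1.le)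

/-- Tonelli: the closed form integrates distances inside gains, whereas the marked intensity in
polar coordinates produces the opposite order. -/
lemma laplaceExponent_eq (hfG : Measurable fG) (hβ : ∀ j, 0 < β j)
    (hs : ∀ j, 0 ≤ s j) (i j : LinkState) {r : ℝ} (hr : 0 ≤ r) :
    laplaceExponent lam α β fG i j r (s j) = ENNReal.ofReal (2 * Real.pi * lam) *
      ∫⁻ v in Ioi (exclusionRadius α β i j r), ENNReal.ofReal (v * linkProb j v) *
        ∫⁻ g, (1 - negExp (ENNReal.ofReal (s j) * ENNReal.ofReal (g * pathLoss α β j v)))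
          ∂(volume.restrict (Ioi (0 : ℝ))).withDensity fun g => ENNReal.ofReal (fG g) := by
  have hρ := exclusionRadius_nonneg (α := α) hβ i j hr
  have hpl : Measurable (pathLoss α β j) := measurable_pathLoss.comp measurable_prodMk_left
  have hpr : Measurable (linkProb j) := (continuous_linkProb j).measurable
  have hfG' : Measurable fun g => ENNReal.ofReal (fG g) := hfG.ennreal_ofReal
  have hkey : ∀ v ∈ Ioi (exclusionRadius α β i j r), ENNReal.ofReal (v * linkProb j v) *
        ∫⁻ g, (1 - negExp (ENNReal.ofReal (s j) * ENNReal.ofReal (g * pathLoss α β j v)))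
          ∂(volume.restrict (Ioi (0 : ℝ))).withDensity (fun g => ENNReal.ofReal (fG g)) =
      ∫⁻ g in Ioi (0 : ℝ), ENNReal.ofReal ((1 - Real.exp (-(pathLoss α β j v * s j * g))) * v *
        linkProb j v) * ENNReal.ofReal (fG g) := by
    intro v hv
    have hv0 : 0 ≤ v := hρ.trans (le_of_lt hv)
    have hm1 : Measurable fun g : ℝ =>
        1 - negExp (ENNReal.ofReal (s j) * ENNReal.ofReal (g * pathLoss α β j v)) :=
      measurable_const.sub (measurable_negExp.comp (by fun_prop))
    rw [lintegral_withDensity_eq_lintegral_mul _ hfG' hm1, ← lintegral_const_mul _ (hfG'.mul hm1)]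
    refine setLIntegral_congr_fun measurableSet_Ioi fun g hg => ?_
    have hg0 : (0 : ℝ) ≤ g := le_of_lt hg
    have hpl0 := pathLoss_nonneg (α := α) hβ j hv0
    simp only [Pi.mul_apply]
    rw [← ENNReal.ofReal_mul (hs j), negExp_ofReal (by have := hs j; positivity),
      ← ENNReal.ofReal_one, ← ENNReal.ofReal_sub _ (Real.exp_pos _).le, mul_comm (ENNReal.ofReal
      (fG g)), ← mul_assoc, ← ENNReal.ofReal_mul (mul_nonneg hv0 (linkProb_nonneg j hv0))]
    congr 2
    rw [show s j * (g * pathLoss α β j v) = pathLoss α β j v * s j * g by ring]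
    ring
  rw [setLIntegral_congr_fun measurableSet_Ioi hkey, lintegral_lintegral_swap, laplaceExponent]
  · congr 1
    refine lintegral_congr fun g => ?_
    rw [lintegral_mul_const]
    fun_prop
  · exact Measurable.aemeasurable (by fun_prop)

/-- The intensity of the points that are excluded or contribute to the interference, seen from a
serving base station in state `i` at distance `r`. -/
lemma shellIntensity_markedIntensity (hlam : 0 < lam) (hfG : Measurable fG)
    (hα : ∀ j, 0 < α j) (hβ : ∀ j, 0 < β j) (hs : ∀ j, 0 ≤ s j) {ν : Measure ℝ}
    [IsProbabilityMeasure ν]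
    (hν : ν = (volume.restrict (Ioi (0 : ℝ))).withDensity fun g => ENNReal.ofReal (fG g))
    (i : LinkState) {r : ℝ} (hr : 0 ≤ r) :
    shellIntensity (markedIntensity (ENNReal.ofReal lam • volume) ν)
        (fun z => negExp (weightedPower α β s z)) (lossKey α β) (r ^ α i / β i) =
      ENNReal.ofReal (2 * Real.pi * lam * ∑ j, ∫ v in (0 : ℝ)..exclusionRadius α β i j r,
        v * linkProb j v) + ∑ j, laplaceExponent lam α β fG i j r (s j) := by
  set w := r ^ α i / β i with hw
  set F : ℝ × LinkState × ℝ → ℝ≥0∞ := fun q =>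
    if q.1 ^ α q.2.1 / β q.2.1 < w then 1 else if w < q.1 ^ α q.2.1 / β q.2.1 then
      1 - negExp (ENNReal.ofReal (s q.2.1) * ENNReal.ofReal (q.2.2 * pathLoss α β q.2.1 q.1))
    else 0 with hF
  have hk : Measurable fun q : ℝ × LinkState × ℝ => q.1 ^ α q.2.1 / β q.2.1 := by
    have : Measurable fun q : LinkState × ℝ => q.2 ^ α q.1 / β q.1 :=
      measurable_linkState_fst fun j => by
        change Measurable fun r : ℝ => r ^ α j / β j
        fun_prop
    exact this.comp (measurable_snd.fst.prodMk measurable_fst)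
  have hFm : Measurable F := by
    refine Measurable.ite (measurableSet_lt hk measurable_const) measurable_const
      (Measurable.ite (measurableSet_lt measurable_const hk) (measurable_const.sub
        (measurable_negExp.comp ?_)) measurable_const)
    have h : Measurable fun z : ℝ × LinkState × ℝ => pathLoss α β z.2.1 z.1 :=
      measurable_pathLoss.comp (measurable_snd.fst.prodMk measurable_fst)
    have h' : Measurable fun z : ℝ × LinkState × ℝ => ENNReal.ofReal (s z.2.1) :=
      (measurable_of_countable fun j => ENNReal.ofReal (s j)).comp measurable_snd.fst
    exact h'.mul ((measurable_snd.snd.mul h).ennreal_ofReal)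
  have h1 : shellIntensity (markedIntensity (ENNReal.ofReal lam • volume) ν)
        (fun z => negExp (weightedPower α β s z)) (lossKey α β) w =
      ∫⁻ z, F (‖z.1‖, z.2) ∂markedIntensity (ENNReal.ofReal lam • volume) ν := rfl
  rw [h1, lintegral_markedIntensity_norm hlam ν hFm]
  have hpi : 0 ≤ 2 * Real.pi * lam := by positivity
  rw [ENNReal.ofReal_mul hpi, ENNReal.ofReal_sum_of_nonneg, Finset.mul_sum, Finset.mul_sum,
    ← Finset.sum_add_distrib]
  swap
  · intro j _
    have hρ := exclusionRadius_nonneg (α := α) hβ i j hr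
    exact intervalIntegral.integral_nonneg hρ fun v hv =>
      mul_nonneg hv.1 (linkProb_nonneg j hv.1)
  refine Finset.sum_congr rfl fun j _ => ?_
  have hρ := exclusionRadius_nonneg (α := α) hβ i j hr
  rw [laplaceExponent_eq hfG hβ hs i j hr, ← mul_add, ← hν, ← lintegral_ofReal_mul_linkProb j hρ]
  congr 1
  set ρ := exclusionRadius α β i j r with hρdef
  -- The null radius `ρ` is where the keys tie. Below it points are forbidden and the integrand is
  -- 1; above it they interfere.
  have hunion : ∫⁻ v in Ioi (0 : ℝ), ENNReal.ofReal (v * linkProb j v) * ∫⁻ g, F (v, j, g) ∂ν =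
      ∫⁻ v in Ioo 0 ρ ∪ Ioi ρ, ENNReal.ofReal (v * linkProb j v) * ∫⁻ g, F (v, j, g) ∂ν := by
    refine setLIntegral_congr ?_
    have hsub : Ioi (0 : ℝ) \ (Ioo 0 ρ ∪ Ioi ρ) ⊆ {ρ} := by
      rintro x ⟨hx, hx'⟩
      simp only [mem_union, mem_Ioo, mem_Ioi, not_or, not_and, not_lt] at hx hx'
      exact le_antisymm hx'.2 (hx'.1 hx)
    refine (ae_eq_set).2 ⟨measure_mono_null hsub (by simp), ?_⟩
    have : (Ioo 0 ρ ∪ Ioi ρ) \ Ioi (0 : ℝ) = ∅ := by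
      rw [sdiff_eq_empty]
      rintro x (hx | hx)
      · exact hx.1
      · exact hρ.trans_lt hx
    rw [this, measure_empty]
  rw [hunion, lintegral_union measurableSet_Ioi
    (Set.disjoint_left.2 fun x hx hx' => (lt_asymm hx.2 hx').elim)]
  congr 1
  · refine setLIntegral_congr_fun measurableSet_Ioo fun v hv => ?_
    have hlt := (rpow_div_lt_iff hα hβ i j hr hv.1.le).2 hv.2
    simp only [hF, hw, if_pos hlt, lintegral_const, measure_univ, mul_one]
  · refine setLIntegral_congr_fun measurableSet_Ioi fun v hv => ?_
    have hlt := (lt_rpow_div_iff hα hβ i j hr (hρ.trans (le_of_lt hv))).2 hv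
    simp only [hF, hw, if_neg hlt.not_gt, if_pos hlt]

lemma sum_exclusionRadius (hα : ∀ j, 0 < α j) (hβ : ∀ j, 0 < β j) (i : LinkState) {r : ℝ}
    (hr : 0 ≤ r) : ∑ j, (∫ v in (0 : ℝ)..exclusionRadius α β i j r, v * linkProb j v) =
      (∫ v in (0 : ℝ)..r, v * linkProb i v) +
        ∫ v in (0 : ℝ)..exclusionRadius α β i i.other r, v * linkProb i.other v := by
  rw [sum_linkState]
  cases i
  · rw [exclusionRadius_self hα hβ _ hr]; rfl
  · rw [exclusionRadius_self hα hβ _ hr, add_comm]; rfl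

lemma assocPDF_nonneg (hlam : 0 < lam) (i : LinkState) {r : ℝ} (hr : 0 ≤ r) :
    0 ≤ assocPDF lam α β i r := by
  have := linkProb_nonneg i hr
  unfold assocPDF
  positivity

/-- The factors are the radial intensity of stations in state `i` and the probability that no
station has a smaller key. -/
lemma ofReal_assocPDF (hlam : 0 < lam) (hα : ∀ j, 0 < α j) (hβ : ∀ j, 0 < β j) (i : LinkState)
    {r : ℝ} (hr : 0 ≤ r) : ENNReal.ofReal (assocPDF lam α β i r) =
      ENNReal.ofReal (2 * Real.pi * lam) * (ENNReal.ofReal (r * linkProb i r) *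
        negExp (ENNReal.ofReal (2 * Real.pi * lam *
          ∑ j, ∫ v in (0 : ℝ)..exclusionRadius α β i j r, v * linkProb j v))) := by
  have hp := linkProb_nonneg i hr
  have hsum : 0 ≤ ∑ j, ∫ v in (0 : ℝ)..exclusionRadius α β i j r, v * linkProb j v :=
    Finset.sum_nonneg fun j _ => intervalIntegral.integral_nonneg
      (exclusionRadius_nonneg hβ i j hr) fun v hv => mul_nonneg hv.1 (linkProb_nonneg j hv.1)
  rw [negExp_ofReal (by positivity), ← ENNReal.ofReal_mul (by positivity),
    ← ENNReal.ofReal_mul (by positivity), sum_exclusionRadius hα hβ i hr, assocPDF]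
  congr 1
  rw [show -2 * Real.pi * lam * ((∫ v in (0 : ℝ)..r, v * linkProb i v) +
        ∫ v in (0 : ℝ)..exclusionRadius α β i i.other r, v * linkProb i.other v) =
    -(2 * Real.pi * lam * ((∫ v in (0 : ℝ)..r, v * linkProb i v) +
        ∫ v in (0 : ℝ)..exclusionRadius α β i i.other r, v * linkProb i.other v)) by ring]
  ring

end Intensity

/-! ### The joint law of the association and the interference -/

section Pointwise

variable {Ω : Type*} {α β : LinkState → ℝ} {s : LinkState → ℝ}
  {X : ℕ → Ω → Plane} {S : ℕ → Ω → LinkState} {G : ℕ → Ω → ℝ}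

/-- True at the origin too by the conventions for `0⁻¹`, but reversing inequalities requires
positive keys. -/
lemma pathLoss_eq_inv_lossKey (n : ℕ) (ω : Ω) :
    pathLoss α β (S n ω) ‖X n ω‖ = (lossKey α β (markedPoint X S G n ω))⁻¹ := by
  rw [lossKey, markedPoint, pathLoss, inv_div, Real.rpow_neg (norm_nonneg _), div_eq_mul_inv]

lemma tsum_weightedPower (ω : Ω) :
    ∑' n, (if n = serving α β X S ω then 0 else weightedPower α β s (markedPoint X S G n ω)) =
      ∑ j, ENNReal.ofReal (s j) * interference α β X S G j ω := by
  simp_rw [interference, ← ENNReal.tsum_mul_left]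
  rw [← Summable.tsum_finsetSum fun _ _ => ENNReal.summable]
  refine tsum_congr fun n => ?_
  by_cases hn : n = serving α β X S ω
  · simp [← hn]
  · rw [if_neg hn, Finset.sum_eq_single (S n ω)]
    · simp [hn, weightedPower, markedPoint]
    · intro j _ hj
      simp [hj.symm]
    · simp

/-- With a single minimiser, the product over the remaining points is exactly the exponential of
minus the weighted interference. -/
lemma minProd_eq_indicator {H : Set (Plane × LinkState × ℝ)} {ω : Ω}
    (hω : ∀ m, (∀ l, lossKey α β (markedPoint X S G m ω) ≤
      lossKey α β (markedPoint X S G l ω)) ↔ m = serving α β X S ω) :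
    minProd H (fun z => negExp (weightedPower α β s z)) (lossKey α β)
        (fun n => markedPoint X S G n ω) =
      {ω | markedPoint X S G (serving α β X S ω) ω ∈ H}.indicator
        (fun ω => negExp (∑ j, ENNReal.ofReal (s j) * interference α β X S G j ω)) ω := by
  classical
  unfold minProd
  simp only [hω]
  by_cases hmem : markedPoint X S G (serving α β X S ω) ω ∈ H
  · rw [indicator_of_mem (show ω ∈ {ω | markedPoint X S G (serving α β X S ω) ω ∈ H} from hmem),
      ← tsum_weightedPower, ← infProd_negExp]
    congr 1
    ext n
    by_cases hn : n = serving α β X S ω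
    · simp [hn, hmem]
    · simp [hn]
  · rw [indicator_of_notMem (show ω ∉ {ω | markedPoint X S G (serving α β X S ω) ω ∈ H} from hmem)]
    exact infProd_eq_zero (n := serving α β X S ω) (by simp [hmem])

end Pointwise

section Joint

variable {Ω : Type*} [MeasurableSpace Ω] {P : Measure Ω} [IsProbabilityMeasure P]
  {lam μo : ℝ} {fG : ℝ → ℝ} {α β : LinkState → ℝ} {s : LinkState → ℝ}
  {X : ℕ → Ω → Plane} {S : ℕ → Ω → LinkState} {Go : Ω → ℝ} {G : ℕ → Ω → ℝ}

/-- Almost surely the serving base station is the only one of minimal path loss. -/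
lemma ae_forall_lossKey_le_iff
    (hX : IsPoissonPointProcess P (ENNReal.ofReal lam • (volume : Measure Plane)) X)
    (hS : IsStateThinning P X S) (hG : IsGainModel P X S μo fG Go G)
    (hα : ∀ j, 0 < α j) (hβ : ∀ j, 0 < β j) :
    ∀ᵐ ω ∂P, ∀ m, (∀ l, lossKey α β (markedPoint X S G m ω) ≤
      lossKey α β (markedPoint X S G l ω)) ↔ m = serving α β X S ω := by
  filter_upwards [ae_existsUnique_min hX hS hG hα hβ, ae_ne_zero hX] with ω ⟨k, hk, huniq⟩ hne
  -- Away from the origin inversion reverses the order, so maximal path loss attenuation means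
  -- minimal key.
  have hpos : ∀ n, 0 < lossKey α β (markedPoint X S G n ω) := fun n =>
    div_pos (Real.rpow_pos_of_pos (norm_pos_iff.2 (hne n)) _) (hβ _)
  have hset : {n : ℕ | ∀ m, pathLoss α β (S m ω) ‖X m ω‖ ≤ pathLoss α β (S n ω) ‖X n ω‖} = {k} := by
    ext n
    simp only [mem_ofPred_eq, mem_singleton_iff, pathLoss_eq_inv_lossKey (G := G),
      inv_le_inv₀ (hpos _) (hpos _)]
    exact ⟨fun h => huniq n h, fun h => h ▸ hk⟩
  have hserv : serving α β X S ω = k := by rw [serving, hset, csInf_singleton]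
  intro m
  rw [hserv]
  exact ⟨fun h => huniq m h, fun h => h ▸ hk⟩

/-- The joint law of the serving state and distance and of the interference. -/
theorem setLIntegral_negExp_interference (hlam : 0 < lam) (hfG : Measurable fG)
    (hX : IsPoissonPointProcess P (ENNReal.ofReal lam • (volume : Measure Plane)) X)
    (hS : IsStateThinning P X S) (hG : IsGainModel P X S μo fG Go G)
    (hα : ∀ j, 0 < α j) (hβ : ∀ j, 0 < β j) (hs : ∀ j, 0 ≤ s j) (i : LinkState)
    {B : Set ℝ} (hB : MeasurableSet B) :
    ∫⁻ ω in {ω | servingState α β X S ω = i} ∩ servingDist α β X S ⁻¹' B,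
        negExp (∑ j, ENNReal.ofReal (s j) * interference α β X S G j ω) ∂P =
      ∫⁻ r in B ∩ Ioi 0, ENNReal.ofReal (assocPDF lam α β i r) *
        negExp (∑ j, laplaceExponent lam α β fG i j r (s j)) := by
  have := Measure.isProbabilityMeasure_map (μ := P) (hG.measurable_misaligned 0).aemeasurable
  set ν := P.map (G 0) with hν
  set M := markedIntensity (ENNReal.ofReal lam • volume) ν with hM
  set v : Plane × LinkState × ℝ → ℝ≥0∞ := fun z => negExp (weightedPower α β s z) with hv
  have hvm : Measurable v := measurable_negExp.comp measurable_weightedPower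
  set H : Set (Plane × LinkState × ℝ) := {z | z.2.1 = i ∧ ‖z.1‖ ∈ B} with hH
  have hHm : MeasurableSet H :=
    (measurable_snd.fst (measurableSet_singleton i)).inter (measurable_fst.norm hB)
  have hE : MeasurableSet ({ω | servingState α β X S ω = i} ∩ servingDist α β X S ⁻¹' B) :=
    (measurable_servingState hX.measurable hS.measurable (measurableSet_singleton i)).inter
      (measurable_servingDist hX.measurable hS.measurable hB)
  have h1 : ∫⁻ ω in {ω | servingState α β X S ω = i} ∩ servingDist α β X S ⁻¹' B,
        negExp (∑ j, ENNReal.ofReal (s j) * interference α β X S G j ω) ∂P =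
      ∫⁻ ω, minProd H v (lossKey α β) (fun n => markedPoint X S G n ω) ∂P := by
    rw [← lintegral_indicator hE]
    refine lintegral_congr_ae ?_
    filter_upwards [ae_forall_lossKey_le_iff hX hS hG hα hβ] with ω hω
    exact (minProd_eq_indicator (H := H) (s := s) hω).symm
  set Q : ℝ → ℝ≥0∞ := fun w => negExp (shellIntensity M v (lossKey α β) w) with hQ
  have hMs : SFinite M := by
    have : SigmaFinite (ENNReal.ofReal lam • (volume : Measure Plane)) :=
      inferInstanceAs (SigmaFinite (lam.toNNReal • (volume : Measure Plane)))
    rw [hM, markedIntensity]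
    infer_instance
  have hQm : Measurable Q := by
    refine measurable_negExp.comp (Measurable.lintegral_prod_right'
      (f := fun q : ℝ × (Plane × LinkState × ℝ) => if lossKey α β q.2 < q.1 then 1 else
        if q.1 < lossKey α β q.2 then 1 - v q.2 else 0) ?_)
    have hk : Measurable fun q : ℝ × (Plane × LinkState × ℝ) => lossKey α β q.2 :=
      measurable_lossKey.comp measurable_snd
    exact Measurable.ite (measurableSet_lt hk measurable_fst) measurable_const
      (Measurable.ite (measurableSet_lt measurable_fst hk)
        (measurable_const.sub (hvm.comp measurable_snd)) measurable_const)
  -- On `H` the key is `r^α_i / β_i`, so the integrand depends on the location only through its norm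
  -- and polar coordinates apply.
  set F : ℝ × LinkState × ℝ → ℝ≥0∞ := fun q =>
    ({i} : Set LinkState).indicator 1 q.2.1 * B.indicator (fun r => Q (r ^ α i / β i)) q.1 with hF
  have hQi : Measurable (B.indicator fun r => Q (r ^ α i / β i)) :=
    (hQm.comp (by fun_prop)).indicator hB
  have hFm : Measurable F :=
    ((measurable_of_countable (({i} : Set LinkState).indicator (1 : LinkState → ℝ≥0∞))).comp
      measurable_snd.fst).mul (hQi.comp measurable_fst)
  have h2 : ∫⁻ z in H, Q (lossKey α β z) ∂M = ∫⁻ z, F (‖z.1‖, z.2) ∂M := by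
    rw [← lintegral_indicator hHm]
    refine lintegral_congr fun z => ?_
    by_cases hi : z.2.1 = i
    · by_cases hz : ‖z.1‖ ∈ B
      · simp [hF, hH, hi, hz, lossKey]
      · simp [hF, hH, hi, hz]
    · simp [hF, hH, hi]
  rw [h1, lintegral_minProd_marked hX hS hG hα hβ hHm hvm fun z => negExp_le_one _]
  change ∫⁻ z in H, Q (lossKey α β z) ∂M = _
  rw [h2, lintegral_markedIntensity_norm hlam ν hFm, Finset.sum_eq_single i]
  · have hin : ∀ r, ∫⁻ g, F (r, i, g) ∂ν = B.indicator (fun r => Q (r ^ α i / β i)) r := by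
      intro r
      simp [hF]
    have hpm : Measurable fun r => ENNReal.ofReal (r * linkProb i r) :=
      (measurable_id.mul (continuous_linkProb i).measurable).ennreal_ofReal
    have hprod : Measurable fun r => ENNReal.ofReal (r * linkProb i r) *
        B.indicator (fun r => Q (r ^ α i / β i)) r := hpm.mul hQi
    simp_rw [hin]
    rw [← lintegral_const_mul _ hprod, ← Measure.restrict_restrict hB,
      ← lintegral_indicator hB]
    refine setLIntegral_congr_fun measurableSet_Ioi fun r hr => ?_
    have hr0 : (0 : ℝ) ≤ r := le_of_lt hr
    by_cases hrB : r ∈ B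
    · simp only [indicator_of_mem hrB, hQ]
      -- The exponent is a sum of a void part, absorbed into the association density, and the
      -- Laplace exponents.
      rw [shellIntensity_markedIntensity hlam hfG hα hβ hs (hG.misaligned_law 0) i hr0, negExp_add,
        ofReal_assocPDF hlam hα hβ i hr0]
      ring
    · simp [hrB]
  · intro j _ hj
    have hin : ∀ r, ∫⁻ g, F (r, j, g) ∂ν = 0 := by
      intro r
      simp [hF, hj]
    simp [hin]
  · simp

end Joint

/-! ### Regularity of the closed forms -/

section Regularity

variable {lam : ℝ} {α β : LinkState → ℝ} {fG : ℝ → ℝ}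

lemma measurable_exclusionRadius (i j : LinkState) : Measurable (exclusionRadius α β i j) := by
  unfold exclusionRadius
  fun_prop

lemma measurable_assocPDF (i : LinkState) : Measurable (assocPDF lam α β i) := by
  have hc : ∀ j, Continuous fun b => ∫ v in (0 : ℝ)..b, v * linkProb j v := fun j =>
    intervalIntegral.continuous_primitive (fun a b =>
      (continuous_id.mul (continuous_linkProb j)).intervalIntegrable a b) 0
  have h1 := (hc i).measurable
  have h2 := (hc i.other).measurable.comp (measurable_exclusionRadius (α := α) (β := β) i i.other)
  have h3 : Measurable (linkProb i) := (continuous_linkProb i).measurable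
  unfold assocPDF
  exact (((measurable_const.mul (measurable_const.mul h3)).mul measurable_id).mul
    (Real.measurable_exp.comp (measurable_const.mul (h1.add h2))))

/-- The lower limit of the inner integral varies with the distance; written as an indicator it
leaves a jointly measurable integrand. -/
lemma measurable_laplaceExponent (hfG : Measurable fG) (i j : LinkState) :
    Measurable fun q : ℝ × ℝ => laplaceExponent lam α β fG i j q.1 q.2 := by
  have hpl : Measurable (pathLoss α β j) := measurable_pathLoss.comp measurable_prodMk_left
  have hpr : Measurable (linkProb j) := (continuous_linkProb j).measurable
  have hρ := measurable_exclusionRadius (α := α) (β := β) i j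
  have h1 : Measurable fun q : ((ℝ × ℝ) × ℝ) × ℝ =>
      {q : ((ℝ × ℝ) × ℝ) × ℝ | exclusionRadius α β i j q.1.1.1 < q.2}.indicator (fun q =>
        ENNReal.ofReal ((1 - Real.exp (-(pathLoss α β j q.2 * q.1.1.2 * q.1.2))) * q.2 *
          linkProb j q.2)) q := by
    refine Measurable.indicator (by fun_prop) (measurableSet_lt ?_ measurable_snd)
    exact hρ.comp (by fun_prop)
  have h2 : Measurable fun q : (ℝ × ℝ) × ℝ =>
      (∫⁻ v in Ioi (exclusionRadius α β i j q.1.1),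
        ENNReal.ofReal ((1 - Real.exp (-(pathLoss α β j v * q.1.2 * q.2))) * v * linkProb j v)) *
      ENNReal.ofReal (fG q.2) := by
    refine Measurable.mul ?_ (by fun_prop)
    simp_rw [← lintegral_indicator measurableSet_Ioi]
    exact Measurable.lintegral_prod_right' h1
  exact (Measurable.lintegral_prod_right' h2).const_mul _

lemma measurable_laplaceExponent_left (hfG : Measurable fG) (i j : LinkState) (t : ℝ) :
    Measurable fun r => laplaceExponent lam α β fG i j r t := by
  have h := (measurable_laplaceExponent (lam := lam) (α := α) (β := β) hfG i j).comp
    (measurable_prodMk_right (y := t))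
  exact h

lemma laplaceExponent_zero (i j : LinkState) (r : ℝ) :
    laplaceExponent lam α β fG i j r 0 = 0 := by
  simp [laplaceExponent]

/-- Two monotone convergences. The exponent may be infinite, so only increasing arguments are
treated, which is why the later approximation comes from below. -/
lemma tendsto_laplaceExponent (hfG : Measurable fG) (hβ : ∀ j, 0 < β j) (i j : LinkState) {r : ℝ}
    (hr : 0 ≤ r) {s : ℕ → ℝ} {t : ℝ} (hs : Monotone s) (hst : Tendsto s atTop (𝓝 t)) :
    Tendsto (fun n => laplaceExponent lam α β fG i j r (s n)) atTop
      (𝓝 (laplaceExponent lam α β fG i j r t)) := by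
  have hρ := exclusionRadius_nonneg (α := α) hβ i j hr
  have hpl : Measurable (pathLoss α β j) := measurable_pathLoss.comp measurable_prodMk_left
  have hpr : Measurable (linkProb j) := (continuous_linkProb j).measurable
  have hinner : ∀ n, Measurable fun g : ℝ => ∫⁻ v in Ioi (exclusionRadius α β i j r),
      ENNReal.ofReal ((1 - Real.exp (-(pathLoss α β j v * s n * g))) * v * linkProb j v) :=
    fun n => Measurable.lintegral_prod_right' (f := fun q : ℝ × ℝ =>
      ENNReal.ofReal ((1 - Real.exp (-(pathLoss α β j q.2 * s n * q.1))) * q.2 * linkProb j q.2))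
      (by fun_prop)
  have hmono : ∀ g ∈ Ioi (0 : ℝ), ∀ v ∈ Ioi (exclusionRadius α β i j r), Monotone fun n =>
      ENNReal.ofReal ((1 - Real.exp (-(pathLoss α β j v * s n * g))) * v * linkProb j v) := by
    intro g hg v hv m n hmn
    have hv0 : 0 ≤ v := hρ.trans (le_of_lt hv)
    have hg0 : (0 : ℝ) ≤ g := le_of_lt hg
    have hpl0 := pathLoss_nonneg (α := α) hβ j hv0
    have hp0 := linkProb_nonneg j hv0
    have hsmn := hs hmn
    dsimp only
    gcongr
  refine ENNReal.Tendsto.const_mul ?_ (Or.inr ENNReal.ofReal_ne_top)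
  refine lintegral_tendsto_of_tendsto_of_monotone (fun n => ?_)
    ((ae_restrict_iff' measurableSet_Ioi).2 (Eventually.of_forall fun g hg => ?_))
    ((ae_restrict_iff' measurableSet_Ioi).2 (Eventually.of_forall fun g hg => ?_))
  · exact ((hinner n).mul hfG.ennreal_ofReal).aemeasurable
  · intro m n hmn
    refine mul_le_mul_left (setLIntegral_mono' measurableSet_Ioi fun v hv => ?_) _
    exact hmono g hg v hv hmn
  · refine ENNReal.Tendsto.mul_const ?_ (Or.inr ENNReal.ofReal_ne_top)
    refine lintegral_tendsto_of_tendsto_of_monotone (fun n => ?_)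
      ((ae_restrict_iff' measurableSet_Ioi).2 (Eventually.of_forall fun v hv => hmono g hg v hv))
      (Eventually.of_forall fun v => ?_)
    · exact Measurable.aemeasurable (by fun_prop)
    · have hc : Continuous fun x : ℝ =>
          ENNReal.ofReal ((1 - Real.exp (-(pathLoss α β j v * x * g))) * v * linkProb j v) :=
        ENNReal.continuous_ofReal.comp (by fun_prop)
      exact (hc.tendsto t).comp hst

end Regularity

/-! ### Laplace arguments that depend on the serving distance -/

/-- The dyadic approximation from below. -/
noncomputable def dyadicFloor (n : ℕ) (x : ℝ) : ℝ := dyadicIndex n x / 2 ^ n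

lemma monotone_dyadicFloor (x : ℝ) : Monotone fun n => dyadicFloor n x := by
  refine monotone_nat_of_le_succ fun n => ?_
  rw [dyadicFloor, dyadicFloor, dyadicIndex_succ n x, pow_succ,
    div_le_div_iff₀ (by positivity) (by positivity)]
  have : ((dyadicIndex (n + 1) x / 2 : ℕ) : ℝ) ≤ dyadicIndex (n + 1) x / 2 := Nat.cast_div_le
  have h2 : (0 : ℝ) < 2 ^ n := by positivity
  nlinarith

lemma tendsto_dyadicFloor {x : ℝ} (hx : 0 ≤ x) :
    Tendsto (fun n => dyadicFloor n x) atTop (𝓝 x) := by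
  have h1 : Tendsto (fun n : ℕ => x - (1 / 2 : ℝ) ^ n) atTop (𝓝 x) := by
    simpa using (tendsto_pow_atTop_nhds_zero_of_lt_one (r := (1 / 2 : ℝ)) (by norm_num)
      (by norm_num)).const_sub x
  refine tendsto_of_tendsto_of_tendsto_of_le_of_le h1 tendsto_const_nhds (fun n => ?_) fun n => ?_
  · have h := Nat.lt_floor_add_one (2 ^ n * x)
    have h2 : (0 : ℝ) < 2 ^ n := by positivity
    rw [dyadicFloor, dyadicIndex, le_div_iff₀ h2, sub_mul, one_div, inv_pow,
      inv_mul_cancel₀ h2.ne']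
    linarith
  · have h := Nat.floor_le (a := 2 ^ n * x) (by positivity)
    rw [dyadicFloor, dyadicIndex, div_le_iff₀ (by positivity), mul_comm x]
    exact h

lemma lintegral_eq_sum_servingState {Ω : Type*} [MeasurableSpace Ω] {P : Measure Ω}
    {τ : Ω → LinkState} (hτ : Measurable τ) (f : Ω → ℝ≥0∞) :
    ∫⁻ ω, f ω ∂P = ∑ i, ∫⁻ ω in {ω | τ ω = i}, f ω ∂P := by
  have hm : ∀ i, MeasurableSet {ω | τ ω = i} := fun i => hτ (measurableSet_singleton i)
  rw [sum_linkState, ← lintegral_add_compl f (hm .L)]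
  congr 2
  congr 1
  ext ω
  cases h : τ ω <;> simp [h]

/-- Two weighted measures that agree on preimages agree on all functions. -/
lemma lintegral_comp_mul_of_forall_setLIntegral {Ω : Type*} [MeasurableSpace Ω] {μ : Measure Ω}
    {ρ : Measure ℝ} {d : Ω → ℝ} (hd : Measurable d) {f : Ω → ℝ≥0∞} (hf : Measurable f)
    {R : ℝ → ℝ≥0∞} (hR : Measurable R)
    (hfR : ∀ B, MeasurableSet B → ∫⁻ ω in d ⁻¹' B, f ω ∂μ = ∫⁻ r in B, R r ∂ρ)
    {h : ℝ → ℝ≥0∞} (hh : Measurable h) :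
    ∫⁻ ω, h (d ω) * f ω ∂μ = ∫⁻ r, R r * h r ∂ρ := by
  have hmap : (μ.withDensity f).map d = ρ.withDensity R := by
    ext B hB
    rw [Measure.map_apply hd hB, withDensity_apply _ (hd hB), withDensity_apply _ hB]
    exact hfR B hB
  have h1 := lintegral_map (μ := μ.withDensity f) hh hd
  rw [hmap, lintegral_withDensity_eq_lintegral_mul _ hR hh,
    lintegral_withDensity_eq_lintegral_mul _ hf
      (show Measurable fun ω => h (d ω) from hh.comp hd)] at h1
  simp only [Pi.mul_apply] at h1
  rw [h1]
  exact lintegral_congr fun ω => mul_comm _ _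

/-- A formula for the Laplace transform at constants extends to arguments that depend on the
conditioning variable. -/
lemma lintegral_comp_mul_negExp_of_forall_const {Ω : Type*} [MeasurableSpace Ω] {μ : Measure Ω}
    [IsFiniteMeasure μ] {ρ : Measure ℝ} {d : Ω → ℝ} (hd : Measurable d) {I : Ω → ℝ≥0∞}
    (hI : Measurable I) {A : ℝ → ℝ≥0∞} (hA : Measurable A) (hA1 : ∫⁻ r, A r ∂ρ ≠ ∞)
    (hAtop : ∀ r, A r ≠ ∞) {L : ℝ → ℝ → ℝ≥0∞} (hL : Measurable fun q : ℝ × ℝ => L q.1 q.2)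
    (hLlim : ∀ᵐ r ∂ρ, ∀ (s : ℕ → ℝ) (t : ℝ), Monotone s → Tendsto s atTop (𝓝 t) →
      Tendsto (fun n => L r (s n)) atTop (𝓝 (L r t)))
    (hconst : ∀ s : ℝ, 0 ≤ s → ∀ h : ℝ → ℝ≥0∞, Measurable h →
      ∫⁻ ω, h (d ω) * negExp (ENNReal.ofReal s * I ω) ∂μ =
        ∫⁻ r, A r * negExp (L r s) * h r ∂ρ)
    {σ : ℝ → ℝ} (hσ : Measurable σ) (hσd : ∀ ω, 0 ≤ σ (d ω)) (hσρ : ∀ᵐ r ∂ρ, 0 ≤ σ r)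
    {h : ℝ → ℝ≥0∞} (hh : Measurable h) (hh1 : ∀ r, h r ≤ 1) :
    ∫⁻ ω, h (d ω) * negExp (ENNReal.ofReal (σ (d ω)) * I ω) ∂μ =
      ∫⁻ r, A r * negExp (L r (σ r)) * h r ∂ρ := by
  classical
  have hfm : ∀ n, Measurable (dyadicFloor n) := fun n =>
    ((measurable_of_countable (fun k : ℕ => (k : ℝ))).comp (measurable_dyadicIndex n)).div_const _
  have hLm : ∀ τ : ℝ → ℝ, Measurable τ → Measurable fun ω => h (d ω) *
      negExp (ENNReal.ofReal (τ (d ω)) * I ω) :=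
    fun τ hτ => (hh.comp hd).mul (measurable_negExp.comp ((hτ.comp hd).ennreal_ofReal.mul hI))
  have hRm : ∀ τ : ℝ → ℝ, Measurable τ → Measurable fun r => A r * negExp (L r (τ r)) * h r :=
    fun τ hτ => (hA.mul (measurable_negExp.comp (hL.comp (measurable_id.prodMk hτ)))).mul hh
  have hhtop : ∀ r, h r ≠ ∞ := fun r => ((hh1 r).trans_lt (by simp)).ne
  -- The approximated argument takes countably many values; on each piece it is constant and
  -- `hconst` applies.
  have hstep : ∀ n, ∫⁻ ω, h (d ω) * negExp (ENNReal.ofReal (dyadicFloor n (σ (d ω))) * I ω) ∂μ =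
      ∫⁻ r, A r * negExp (L r (dyadicFloor n (σ r))) * h r ∂ρ := by
    intro n
    set D : ℕ → Set ℝ := fun k => {r | dyadicIndex n (σ r) = k} with hD
    have hDm : ∀ k, MeasurableSet (D k) := fun k =>
      ((measurable_dyadicIndex n).comp hσ) (measurableSet_singleton k)
    have hdec : ∀ r, h r = ∑' k, (D k).indicator h r := by
      intro r
      rw [tsum_eq_single (dyadicIndex n (σ r))]
      · exact (indicator_of_mem (show r ∈ D (dyadicIndex n (σ r)) from rfl) h).symm
      · intro k hk
        exact indicator_of_notMem
          (fun hr : r ∈ D k => hk (show dyadicIndex n (σ r) = k from hr).symm) h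
    have hLd : ∀ ω, h (d ω) * negExp (ENNReal.ofReal (dyadicFloor n (σ (d ω))) * I ω) =
        ∑' k : ℕ, (D k).indicator h (d ω) * negExp (ENNReal.ofReal ((k : ℝ) / 2 ^ n) * I ω) := by
      intro ω
      rw [hdec (d ω), ← ENNReal.tsum_mul_right]
      refine tsum_congr fun k => ?_
      by_cases hr : d ω ∈ D k
      · have hr' : dyadicIndex n (σ (d ω)) = k := hr
        rw [dyadicFloor, hr']
      · rw [indicator_of_notMem hr, zero_mul, zero_mul]
    have hRd : ∀ r, A r * negExp (L r (dyadicFloor n (σ r))) * h r =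
        ∑' k : ℕ, A r * negExp (L r ((k : ℝ) / 2 ^ n)) * (D k).indicator h r := by
      intro r
      rw [hdec r, ← ENNReal.tsum_mul_left]
      refine tsum_congr fun k => ?_
      by_cases hr : r ∈ D k
      · have hr' : dyadicIndex n (σ r) = k := hr
        rw [dyadicFloor, hr']
      · rw [indicator_of_notMem hr, mul_zero, mul_zero]
    simp_rw [hLd, hRd]
    rw [lintegral_tsum, lintegral_tsum]
    · exact tsum_congr fun k => hconst ((k : ℝ) / 2 ^ n) (by positivity) _ (hh.indicator (hDm k))
    · intro k
      exact ((hA.mul (measurable_negExp.comp (hL.comp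
        (measurable_id.prodMk measurable_const)))).mul (hh.indicator (hDm k))).aemeasurable
    · intro k
      exact (((hh.indicator (hDm k)).comp hd).mul
        (measurable_negExp.comp (measurable_const.mul hI))).aemeasurable
  have hl : Tendsto (fun n => ∫⁻ ω, h (d ω) *
      negExp (ENNReal.ofReal (dyadicFloor n (σ (d ω))) * I ω) ∂μ) atTop
      (𝓝 (∫⁻ ω, h (d ω) * negExp (ENNReal.ofReal (σ (d ω)) * I ω) ∂μ)) := by
    refine tendsto_lintegral_of_dominated_convergence (fun _ => 1)
      (fun n => hLm (fun r => dyadicFloor n (σ r)) ((hfm n).comp hσ))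
      (fun n => Eventually.of_forall fun ω => mul_le_one' (hh1 _) (negExp_le_one _))
      (by simp) (Eventually.of_forall fun ω => ?_)
    refine ENNReal.Tendsto.const_mul ?_ (Or.inr (hhtop _))
    refine (continuous_negExp.tendsto _).comp ?_
    -- Multiplication is discontinuous at `(0, ∞)`. A zero argument is treated apart: all its
    -- approximations are 0.
    rcases eq_or_lt_of_le (hσd ω) with h0 | h0
    · simp [← h0, dyadicFloor, dyadicIndex]
    · exact ENNReal.Tendsto.mul_const (ENNReal.tendsto_ofReal (tendsto_dyadicFloor (hσd ω)))
        (Or.inl (ENNReal.ofReal_pos.2 h0).ne')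
  have hr : Tendsto (fun n => ∫⁻ r, A r * negExp (L r (dyadicFloor n (σ r))) * h r ∂ρ) atTop
      (𝓝 (∫⁻ r, A r * negExp (L r (σ r)) * h r ∂ρ)) := by
    refine tendsto_lintegral_of_dominated_convergence A
      (fun n => hRm (fun r => dyadicFloor n (σ r)) ((hfm n).comp hσ))
      (fun n => Eventually.of_forall fun r => ?_) hA1 ?_
    · dsimp only
      rw [mul_assoc]
      exact mul_le_of_le_one_right' (mul_le_one' (negExp_le_one _) (hh1 r))
    · filter_upwards [hLlim, hσρ] with r hr hσr
      refine ENNReal.Tendsto.mul_const ?_ (Or.inr (hhtop r))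
      refine ENNReal.Tendsto.const_mul ?_ (Or.inr (hAtop r))
      exact (continuous_negExp.tendsto _).comp
        (hr _ _ (monotone_dyadicFloor _) (tendsto_dyadicFloor hσr))
  simp_rw [hstep] at hl
  exact tendsto_nhds_unique hl hr

section Formula

variable {Ω : Type*} [MeasurableSpace Ω] {P : Measure Ω} [IsProbabilityMeasure P]
  {lam μo : ℝ} {fG : ℝ → ℝ} {α β : LinkState → ℝ} {s : LinkState → ℝ}
  {X : ℕ → Ω → Plane} {S : ℕ → Ω → LinkState} {Go : Ω → ℝ} {G : ℕ → Ω → ℝ}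

/-- The joint law of the serving state and distance and of the interference, tested on a function
of the distance. -/
lemma setLIntegral_comp_servingDist_mul (hlam : 0 < lam) (hfG : Measurable fG)
    (hX : IsPoissonPointProcess P (ENNReal.ofReal lam • (volume : Measure Plane)) X)
    (hS : IsStateThinning P X S) (hG : IsGainModel P X S μo fG Go G)
    (hα : ∀ j, 0 < α j) (hβ : ∀ j, 0 < β j) (hs : ∀ j, 0 ≤ s j) (i : LinkState)
    {h : ℝ → ℝ≥0∞} (hh : Measurable h) :
    ∫⁻ ω in {ω | servingState α β X S ω = i}, h (servingDist α β X S ω) *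
        negExp (∑ j, ENNReal.ofReal (s j) * interference α β X S G j ω) ∂P =
      ∫⁻ r in Ioi 0, ENNReal.ofReal (assocPDF lam α β i r) *
        negExp (∑ j, laplaceExponent lam α β fG i j r (s j)) * h r := by
  have hd := measurable_servingDist (α := α) (β := β) hX.measurable hS.measurable
  have hI : Measurable fun ω => negExp (∑ j, ENNReal.ofReal (s j) * interference α β X S G j ω) :=
    measurable_negExp.comp (Finset.measurable_sum _ fun j _ => measurable_const.mul
      (measurable_interference hX.measurable hS.measurable hG.measurable_misaligned j))
  have hR : Measurable fun r => ENNReal.ofReal (assocPDF lam α β i r) *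
      negExp (∑ j, laplaceExponent lam α β fG i j r (s j)) :=
    (measurable_assocPDF i).ennreal_ofReal.mul (measurable_negExp.comp
      (Finset.measurable_sum _ fun j _ => measurable_laplaceExponent_left hfG i j (s j)))
  refine lintegral_comp_mul_of_forall_setLIntegral hd hI hR (fun B hB => ?_) hh
  rw [Measure.restrict_restrict (hd hB), Measure.restrict_restrict hB, inter_comm]
  exact setLIntegral_negExp_interference hlam hfG hX hS hG hα hβ hs i hB

/-- The law of the association distance jointly with the state. -/
theorem map_servingDist (hlam : 0 < lam) (hfG : Measurable fG)
    (hX : IsPoissonPointProcess P (ENNReal.ofReal lam • (volume : Measure Plane)) X)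
    (hS : IsStateThinning P X S) (hG : IsGainModel P X S μo fG Go G)
    (hα : ∀ j, 0 < α j) (hβ : ∀ j, 0 < β j) (i : LinkState) :
    (P.restrict {ω | servingState α β X S ω = i}).map (servingDist α β X S) =
      (volume.restrict (Ioi (0 : ℝ))).withDensity
        fun r => ENNReal.ofReal (assocPDF lam α β i r) := by
  have hd := measurable_servingDist (α := α) (β := β) hX.measurable hS.measurable
  ext B hB
  -- At `s = 0` the interference disappears, even if infinite, since `0 * ∞ = 0`.
  have h := setLIntegral_negExp_interference (s := fun _ => 0) hlam hfG hX hS hG hα hβ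
    (fun _ => le_rfl) i hB
  simp only [ENNReal.ofReal_zero, zero_mul, Finset.sum_const_zero, negExp_zero, lintegral_one,
    laplaceExponent_zero, mul_one] at h
  rw [Measure.map_apply hd hB, withDensity_apply _ hB, Measure.restrict_restrict hB, ← h,
    Measure.restrict_apply_univ, Measure.restrict_apply (hd hB), inter_comm]

/-- The density is that of a part of a probability measure, so no integral has to be estimated. -/
lemma lintegral_assocPDF_ne_top (hlam : 0 < lam) (hfG : Measurable fG)
    (hX : IsPoissonPointProcess P (ENNReal.ofReal lam • (volume : Measure Plane)) X)
    (hS : IsStateThinning P X S) (hG : IsGainModel P X S μo fG Go G)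
    (hα : ∀ j, 0 < α j) (hβ : ∀ j, 0 < β j) (i : LinkState) :
    ∫⁻ r in Ioi 0, ENNReal.ofReal (assocPDF lam α β i r) ≠ ∞ := by
  rw [← setLIntegral_univ, ← withDensity_apply _ MeasurableSet.univ,
    ← map_servingDist hlam hfG hX hS hG hα hβ i]
  exact measure_ne_top _ _

/-- The joint law of the serving state and distance and of the interference, where the argument of
the Laplace transform may depend on the distance. -/
theorem setLIntegral_comp_servingDist_mul_negExp (hlam : 0 < lam) (hfG : Measurable fG)
    (hX : IsPoissonPointProcess P (ENNReal.ofReal lam • (volume : Measure Plane)) X)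
    (hS : IsStateThinning P X S) (hG : IsGainModel P X S μo fG Go G)
    (hα : ∀ j, 0 < α j) (hβ : ∀ j, 0 < β j) (i : LinkState)
    {σ : ℝ → ℝ} (hσ : Measurable σ) (hσ0 : ∀ r, 0 ≤ r → 0 ≤ σ r)
    {h : ℝ → ℝ≥0∞} (hh : Measurable h) (hh1 : ∀ r, h r ≤ 1) :
    ∫⁻ ω in {ω | servingState α β X S ω = i}, h (servingDist α β X S ω) *
        negExp (∑ j, ENNReal.ofReal (σ (servingDist α β X S ω)) * interference α β X S G j ω) ∂P =
      ∫⁻ r in Ioi 0, ENNReal.ofReal (assocPDF lam α β i r) *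
        negExp (∑ j, laplaceExponent lam α β fG i j r (σ r)) * h r := by
  have hd := measurable_servingDist (α := α) (β := β) hX.measurable hS.measurable
  have hI : Measurable fun ω => ∑ j, interference α β X S G j ω :=
    Finset.measurable_sum _ fun j _ =>
      measurable_interference hX.measurable hS.measurable hG.measurable_misaligned j
  simp only [← Finset.mul_sum]
  refine lintegral_comp_mul_negExp_of_forall_const hd hI (measurable_assocPDF i).ennreal_ofReal
    (lintegral_assocPDF_ne_top hlam hfG hX hS hG hα hβ i) (fun _ => ENNReal.ofReal_ne_top)
    (L := fun r t => ∑ j, laplaceExponent lam α β fG i j r t)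
    (Finset.measurable_sum _ fun j _ => measurable_laplaceExponent hfG i j) ?_ ?_ hσ
    (fun ω => hσ0 _ (norm_nonneg _)) ?_ hh hh1
  · refine (ae_restrict_iff' measurableSet_Ioi).2 (Eventually.of_forall fun r hr t u ht htu => ?_)
    exact tendsto_finsetSum _ fun j _ =>
      tendsto_laplaceExponent hfG hβ i j (le_of_lt hr) ht htu
  · intro t ht k hk
    have := setLIntegral_comp_servingDist_mul (s := fun _ => t) hlam hfG hX hS hG hα hβ
      (fun _ => ht) i hk
    simpa only [← Finset.mul_sum] using this
  · exact (ae_restrict_iff' measurableSet_Ioi).2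
      (Eventually.of_forall fun r hr => hσ0 r (le_of_lt hr))

end Formula

/-! ### The conditional Laplace transform and the coverage probability -/

section Conditional

variable {Ω : Type*} [MeasurableSpace Ω] {P : Measure Ω} [IsProbabilityMeasure P]
  {lam μo : ℝ} {fG : ℝ → ℝ} {α β : LinkState → ℝ}
  {X : ℕ → Ω → Plane} {S : ℕ → Ω → LinkState} {Go : Ω → ℝ} {G : ℕ → Ω → ℝ}

/-- The Laplace transform of the interference and its closed form have the same integral on each
event that concerns the serving state and distance. -/
lemma setLIntegral_interferenceLaplace (hlam : 0 < lam) (hfG : Measurable fG)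
    (hX : IsPoissonPointProcess P (ENNReal.ofReal lam • (volume : Measure Plane)) X)
    (hS : IsStateThinning P X S) (hG : IsGainModel P X S μo fG Go G)
    (hα : ∀ j, 0 < α j) (hβ : ∀ j, 0 < β j) (j : LinkState) {s : ℝ} (hs : 0 ≤ s)
    {D : Set (LinkState × ℝ)} (hD : MeasurableSet D) :
    ∫⁻ ω in (fun ω => (servingState α β X S ω, servingDist α β X S ω)) ⁻¹' D,
        negExp (laplaceExponent lam α β fG (servingState α β X S ω) j
          (servingDist α β X S ω) s) ∂P =
      ∫⁻ ω in (fun ω => (servingState α β X S ω, servingDist α β X S ω)) ⁻¹' D,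
        negExp (ENNReal.ofReal s * interference α β X S G j ω) ∂P := by
  classical
  have hd := measurable_servingDist (α := α) (β := β) hX.measurable hS.measurable
  have hτ := measurable_servingState (α := α) (β := β) hX.measurable hS.measurable
  have hA : MeasurableSet ((fun ω => (servingState α β X S ω, servingDist α β X S ω)) ⁻¹' D) :=
    (hτ.prodMk hd) hD
  rw [lintegral_eq_sum_servingState hτ, lintegral_eq_sum_servingState hτ]
  refine Finset.sum_congr rfl fun i _ => ?_
  have hτi : MeasurableSet {ω | servingState α β X S ω = i} := hτ (measurableSet_singleton i)
  set B : Set ℝ := Prod.mk i ⁻¹' D with hB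
  have hBm : MeasurableSet B := measurable_prodMk_left hD
  have hset : {ω | servingState α β X S ω = i} ∩
      (fun ω => (servingState α β X S ω, servingDist α β X S ω)) ⁻¹' D =
      {ω | servingState α β X S ω = i} ∩ servingDist α β X S ⁻¹' B := by
    ext ω
    simp only [mem_inter_iff, mem_ofPred_eq, mem_preimage, hB]
    refine and_congr_right fun h => ?_
    rw [h]
  have hset' : servingDist α β X S ⁻¹' B ∩ {ω | servingState α β X S ω = i} =
      {ω | servingState α β X S ω = i} ∩ servingDist α β X S ⁻¹' B := inter_comm _ _
  rw [Measure.restrict_restrict hτi, hset]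
  -- Weights supported at `j` isolate one interference from the joint formula.
  have h1 := setLIntegral_negExp_interference (s := fun k => if k = j then s else 0) hlam hfG hX hS
    hG hα hβ (fun k => by split_ifs <;> simp [hs]) i hBm
  have h2 : ∀ ω, ∑ k, ENNReal.ofReal (if k = j then s else 0) * interference α β X S G k ω =
      ENNReal.ofReal s * interference α β X S G j ω := by
    intro ω
    rw [Finset.sum_eq_single j]
    · simp
    · intro k _ hk
      simp [hk]
    · simp
  have h3 : ∀ r, ∑ k, laplaceExponent lam α β fG i k r (if k = j then s else 0) =
      laplaceExponent lam α β fG i j r s := by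
    intro r
    rw [Finset.sum_eq_single j]
    · simp
    · intro k _ hk
      simp [hk, laplaceExponent_zero]
    · simp
  simp only [h2, h3] at h1
  rw [h1]
  have hL : Measurable fun r => negExp (laplaceExponent lam α β fG i j r s) :=
    measurable_negExp.comp (measurable_laplaceExponent_left hfG i j s)
  have h4 : ∫⁻ ω in {ω | servingState α β X S ω = i} ∩ servingDist α β X S ⁻¹' B,
        negExp (laplaceExponent lam α β fG (servingState α β X S ω) j
          (servingDist α β X S ω) s) ∂P =
      ∫⁻ ω in {ω | servingState α β X S ω = i} ∩ servingDist α β X S ⁻¹' B,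
        negExp (laplaceExponent lam α β fG i j (servingDist α β X S ω) s) ∂P := by
    refine setLIntegral_congr_fun (hτi.inter (hd hBm)) fun ω hω => ?_
    have : servingState α β X S ω = i := hω.1
    rw [this]
  rw [h4, ← hset', ← Measure.restrict_restrict (hd hBm), ← setLIntegral_map hBm hL hd,
    map_servingDist hlam hfG hX hS hG hα hβ i, setLIntegral_withDensity_eq_setLIntegral_mul _
      (measurable_assocPDF i).ennreal_ofReal hL hBm, Measure.restrict_restrict hBm]
  rfl

/-- The closed form is a bounded measurable function of the serving state and distance, and has the
right integral over each event they generate. -/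
theorem condExp_interference (hlam : 0 < lam) (hfG : Measurable fG)
    (hX : IsPoissonPointProcess P (ENNReal.ofReal lam • (volume : Measure Plane)) X)
    (hS : IsStateThinning P X S) (hG : IsGainModel P X S μo fG Go G)
    (hα : ∀ j, 0 < α j) (hβ : ∀ j, 0 < β j) (j : LinkState) {s : ℝ} (hs : 0 ≤ s) :
    P[fun ω => expNeg (ENNReal.ofReal s * interference α β X S G j ω) |
          MeasurableSpace.comap
            (fun ω => (servingState α β X S ω, servingDist α β X S ω)) inferInstance]
      =ᵐ[P] fun ω => interferenceLaplace lam α β fG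
          (servingState α β X S ω) j (servingDist α β X S ω) s := by
  set T : Ω → LinkState × ℝ := fun ω => (servingState α β X S ω, servingDist α β X S ω) with hT
  have hTm : Measurable T :=
    (measurable_servingState (α := α) (β := β) hX.measurable hS.measurable).prodMk
      (measurable_servingDist (α := α) (β := β) hX.measurable hS.measurable)
  have hfm : Measurable fun ω => expNeg (ENNReal.ofReal s * interference α β X S G j ω) :=
    measurable_expNeg.comp (measurable_const.mul
      (measurable_interference hX.measurable hS.measurable hG.measurable_misaligned j))
  set g : LinkState × ℝ → ℝ := fun q => interferenceLaplace lam α β fG q.1 j q.2 s with hg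
  have hgm : Measurable g := measurable_linkState_fst fun i =>
    measurable_expNeg.comp (measurable_laplaceExponent_left hfG i j s)
  have hint : ∀ {f : Ω → ℝ≥0∞}, Measurable (fun ω => expNeg (f ω)) →
      Integrable (fun ω => expNeg (f ω)) P := fun hf =>
    Integrable.of_bound hf.aestronglyMeasurable 1 (Eventually.of_forall fun ω => by
      rw [Real.norm_of_nonneg (expNeg_nonneg _)]
      exact expNeg_le_one _)
  have hgint : Integrable (fun ω => g (T ω)) P :=
    hint (f := fun ω => laplaceExponent lam α β fG (T ω).1 j (T ω).2 s) (hgm.comp hTm)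
  refine (ae_eq_condExp_of_forall_setIntegral_eq hTm.comap_le (hint hfm)
    (fun A _ _ => hgint.integrableOn) ?_ ?_).symm
  · rintro A ⟨D, hD, rfl⟩ -
    have hmain := setLIntegral_interferenceLaplace hlam hfG hX hS hG hα hβ j hs hD
    rw [integral_eq_lintegral_of_nonneg_ae
        (Eventually.of_forall fun ω => interferenceLaplace_nonneg ..)
        (hgm.comp hTm).aestronglyMeasurable,
      integral_eq_lintegral_of_nonneg_ae (Eventually.of_forall fun ω => expNeg_nonneg _)
        hfm.aestronglyMeasurable]
    simp only [ofReal_expNeg, ofReal_interferenceLaplace]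
    exact congrArg ENNReal.toReal hmain
  · exact (hgm.comp (comap_measurable T)).aestronglyMeasurable

end Conditional

/-! ### Coverage: integrating out the aligned gain -/

/-- The tail of the exponential distribution. -/
lemma expMeasure_le_ofReal {μo : ℝ} (hμo : 0 < μo) {q : ℝ≥0∞} (hq : q ≠ 0) :
    expMeasure μo {x | q ≤ ENNReal.ofReal x} = negExp (ENNReal.ofReal μo * q) := by
  rcases eq_or_ne q ∞ with rfl | hqt
  · rw [ENNReal.mul_top (ENNReal.ofReal_pos.2 hμo).ne', negExp_top]
    simp
  have hprob : IsProbabilityMeasure (expMeasure μo) := isProbabilityMeasure_expMeasure hμo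
  set t := q.toReal with ht
  have htpos : 0 < t := ENNReal.toReal_pos hq hqt
  -- Positivity of `t` matters: `ENNReal.ofReal` truncates, so at `t = 0` negative `x` would belong
  -- to the set as well.
  have hset : {x | q ≤ ENNReal.ofReal x} = Ici t := by
    ext x
    rw [mem_ofPred_eq, mem_Ici, ← ENNReal.ofReal_toReal hqt, ← ht, ENNReal.ofReal_le_ofReal_iff',
      or_iff_left htpos.not_ge]
  have hatom : expMeasure μo {t} = 0 :=
    withDensity_absolutelyContinuous _ _ (by simp)
  have hIoi : expMeasure μo (Ici t) = expMeasure μo (Iic t)ᶜ := by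
    rw [compl_Iic]
    exact (measure_congr (Ioi_ae_eq_Ici' hatom)).symm
  have hcdf := cdf_expMeasure_eq hμo t
  rw [if_pos htpos.le, cdf_eq_real, measureReal_def] at hcdf
  have h2 : expMeasure μo (Iic t) = ENNReal.ofReal (1 - Real.exp (-(μo * t))) := by
    rw [← hcdf, ENNReal.ofReal_toReal (measure_ne_top _ _)]
  have h3 : Real.exp (-(μo * t)) ≤ 1 := Real.exp_le_one_iff.2 (by nlinarith)
  rw [hset, hIoi, prob_compl_eq_one_sub measurableSet_Iic, h2, ← ENNReal.ofReal_one,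
    ← ENNReal.ofReal_sub _ (by linarith), sub_sub_cancel, ← ENNReal.ofReal_toReal hqt,
    ← ENNReal.ofReal_mul hμo.le, negExp_ofReal (by positivity)]

/-- Independence of the aligned gain from locations, states and misaligned gains. -/
lemma IsGainModel.lintegral_aligned {Ω : Type*} [MeasurableSpace Ω] {P : Measure Ω}
    [IsProbabilityMeasure P] {μo : ℝ} {fG : ℝ → ℝ} {X : ℕ → Ω → Plane} {S : ℕ → Ω → LinkState}
    {Go : Ω → ℝ} {G : ℕ → Ω → ℝ} (hX : ∀ n, Measurable (X n)) (hS : ∀ n, Measurable (S n))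
    (hG : IsGainModel P X S μo fG Go G)
    {Φ : (((ℕ → Plane) × (ℕ → LinkState)) × (ℕ → ℝ)) × ℝ → ℝ≥0∞} (hΦ : Measurable Φ) :
    ∫⁻ ω, Φ ((((fun n => X n ω), fun n => S n ω), fun n => G n ω), Go ω) ∂P =
      ∫⁻ ω, ∫⁻ x, Φ ((((fun n => X n ω), fun n => S n ω), fun n => G n ω), x)
        ∂expMeasure μo ∂P := by
  have hXS : Measurable fun ω => ((fun n => X n ω), (fun n => S n ω)) :=
    (measurable_pi_lambda _ hX).prodMk (measurable_pi_lambda _ hS)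
  have hGm : Measurable fun ω n => G n ω := measurable_pi_lambda _ hG.measurable_misaligned
  have hind : IndepFun (fun ω => ((fun n => X n ω), (fun n => S n ω))) (fun ω n => G n ω) P :=
    hG.gains_indep.comp measurable_id measurable_snd
  have hprob : SFinite (expMeasure μo) := by
    rw [← hG.aligned_law]
    infer_instance
  set Ψ : ((ℕ → Plane) × (ℕ → LinkState)) × (ℕ → ℝ) → ℝ≥0∞ :=
    fun y => ∫⁻ x, Φ (y, x) ∂expMeasure μo with hΨ
  have hΨm : Measurable Ψ := hΦ.lintegral_prod_right'
  -- `gains_indep` detaches both gains from locations and states, and `aligned_indep` then separates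
  -- the two gains; together they make the aligned gain independent of everything else.
  have h1 := lintegral_comp_prodMk_of_indepFun hXS (hG.measurable_aligned.prodMk hGm)
    hG.gains_indep (Φ := fun q => Φ ((q.1, q.2.2), q.2.1)) (hΦ.comp (by fun_prop))
  have h2 := lintegral_comp_prodMk_of_indepFun hXS hGm hind hΨm
  refine h1.trans (Eq.trans ?_ h2.symm)
  refine lintegral_congr fun ω => ?_
  have h3 := lintegral_comp_prodMk_of_indepFun hGm hG.measurable_aligned hG.aligned_indep.symm
    (Φ := fun q => Φ ((((fun n => X n ω), fun n => S n ω), q.1), q.2)) (hΦ.comp (by fun_prop))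
  refine h3.trans (lintegral_congr fun ω' => ?_)
  rw [hΨ, ← hG.aligned_law]
  refine (lintegral_map (f := fun x => Φ ((((fun n => X n ω), fun n => S n ω),
    fun n => G n ω'), x)) ?_ hG.measurable_aligned).symm
  exact hΦ.comp measurable_prodMk_left

/-- The total interference plus noise, relative to the attenuation of the serving link. -/
noncomputable def noiseRatio {Ω : Type*} (α β : LinkState → ℝ) (σ2 : ℝ) (X : ℕ → Ω → Plane)
    (S : ℕ → Ω → LinkState) (G : ℕ → Ω → ℝ) (ω : Ω) : ℝ≥0∞ :=
  (interference α β X S G .L ω + interference α β X S G .N ω + ENNReal.ofReal σ2) *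
    ENNReal.ofReal (pathLoss α β (servingState α β X S ω) (servingDist α β X S ω))⁻¹

lemma pathLoss_pos {α β : LinkState → ℝ} (hβ : ∀ j, 0 < β j) (j : LinkState) {r : ℝ} (hr : 0 < r) :
    0 < pathLoss α β j r :=
  mul_pos (hβ j) (Real.rpow_pos_of_pos hr _)

/-- Positive noise and attenuation justify the division in `[0, ∞]`. For positive `T` and infinite
interference both sides fail. -/
lemma le_sinr_iff {Ω : Type*} {σ2 : ℝ} {α β : LinkState → ℝ} {X : ℕ → Ω → Plane}
    {S : ℕ → Ω → LinkState} {Go : Ω → ℝ} {G : ℕ → Ω → ℝ} (hβ : ∀ j, 0 < β j) (hσ2 : 0 < σ2)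
    (T : ℝ) {ω : Ω} (hr : 0 < servingDist α β X S ω) :
    ENNReal.ofReal T ≤ sinr α β σ2 X S Go G ω ↔
      ENNReal.ofReal T * noiseRatio α β σ2 X S G ω ≤ ENNReal.ofReal (Go ω) := by
  have hl := pathLoss_pos (α := α) hβ (servingState α β X S ω) hr
  have hl' : ENNReal.ofReal (pathLoss α β (servingState α β X S ω) (servingDist α β X S ω)) ≠ 0 :=
    (ENNReal.ofReal_pos.2 hl).ne'
  rw [sinr, ENNReal.le_div_iff_mul_le (Or.inl (by simp [hσ2])) (Or.inr ENNReal.ofReal_ne_top),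
    noiseRatio, ENNReal.ofReal_inv_of_pos hl, ENNReal.ofReal_mul' hl.le, ← mul_assoc,
    ← div_eq_mul_inv, ENNReal.div_le_iff_le_mul (Or.inl hl') (Or.inl ENNReal.ofReal_ne_top)]

section Coverage

variable {Ω : Type*} [MeasurableSpace Ω] {P : Measure Ω} [IsProbabilityMeasure P]
  {lam μo σ2 : ℝ} {fG : ℝ → ℝ} {α β : LinkState → ℝ}
  {X : ℕ → Ω → Plane} {S : ℕ → Ω → LinkState} {Go : Ω → ℝ} {G : ℕ → Ω → ℝ}

lemma measurable_noiseRatio (hX : ∀ n, Measurable (X n)) (hS : ∀ n, Measurable (S n))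
    (hG : ∀ n, Measurable (G n)) : Measurable (noiseRatio α β σ2 X S G) :=
  (((measurable_interference hX hS hG .L).add (measurable_interference hX hS hG .N)).add
    measurable_const).mul (measurable_pathLoss.comp ((measurable_servingState hX hS).prodMk
      (measurable_servingDist hX hS))).inv.ennreal_ofReal

lemma ae_servingDist_pos
    (hX : IsPoissonPointProcess P (ENNReal.ofReal lam • (volume : Measure Plane)) X) :
    ∀ᵐ ω ∂P, 0 < servingDist α β X S ω := by
  filter_upwards [ae_ne_zero hX] with ω hω
  exact norm_pos_iff.2 (hω _)

/-- A realisation of the locations, the states and the misaligned gains. -/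
abbrev Realisation : Type := ((ℕ → Plane) × (ℕ → LinkState)) × (ℕ → ℝ)

/-- The coverage probability as an exponential moment of the interference. -/
lemma measure_le_sinr (hσ2 : 0 < σ2) (hμo : 0 < μo)
    (hX : IsPoissonPointProcess P (ENNReal.ofReal lam • (volume : Measure Plane)) X)
    (hS : IsStateThinning P X S) (hG : IsGainModel P X S μo fG Go G)
    (hβ : ∀ j, 0 < β j) {T : ℝ} (hT : 0 < T) :
    P {ω | ENNReal.ofReal T ≤ sinr α β σ2 X S Go G ω} =
      ∫⁻ ω, negExp (ENNReal.ofReal μo * (ENNReal.ofReal T * noiseRatio α β σ2 X S G ω)) ∂P := by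
  -- The noise ratio on the canonical space of coordinate sequences exhibits it as a measurable
  -- function of everything but the aligned gain.
  set R : Realisation → ℝ≥0∞ := noiseRatio α β σ2 (fun n (y : Realisation) => y.1.1 n)
    (fun n (y : Realisation) => y.1.2 n) (fun n (y : Realisation) => y.2 n) with hR
  have hRm : Measurable R := measurable_noiseRatio (fun n => by fun_prop) (fun n => by fun_prop)
    (fun n => by fun_prop)
  have hRω : ∀ ω, R (((fun n => X n ω), fun n => S n ω), fun n => G n ω) =
    noiseRatio α β σ2 X S G ω := fun ω => rfl
  have hA : MeasurableSet {q : Realisation × ℝ | ENNReal.ofReal T * R q.1 ≤ ENNReal.ofReal q.2} :=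
    measurableSet_le (measurable_const.mul (hRm.comp measurable_fst)) (by fun_prop)
  have h1 := hG.lintegral_aligned hX.measurable hS.measurable
    (Φ := {q : Realisation × ℝ | ENNReal.ofReal T * R q.1 ≤ ENNReal.ofReal q.2}.indicator 1)
    (measurable_one.indicator hA)
  have hY : Measurable fun ω => ((((fun n => X n ω), fun n => S n ω), fun n => G n ω), Go ω) :=
    (((measurable_pi_lambda _ hX.measurable).prodMk (measurable_pi_lambda _ hS.measurable)).prodMk
      (measurable_pi_lambda _ hG.measurable_misaligned)).prodMk hG.measurable_aligned
  have h2 : P {ω | ENNReal.ofReal T ≤ sinr α β σ2 X S Go G ω} =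
      ∫⁻ ω, {q : Realisation × ℝ | ENNReal.ofReal T * R q.1 ≤ ENNReal.ofReal q.2}.indicator 1
        ((((fun n => X n ω), fun n => S n ω), fun n => G n ω), Go ω) ∂P := by
    have h3 := lintegral_indicator_one (μ := P) (hY hA)
    refine Eq.trans ?_ h3.symm
    refine measure_congr ?_
    filter_upwards [ae_servingDist_pos (α := α) (β := β) (S := S) hX] with ω hω
    exact propext (le_sinr_iff hβ hσ2 T hω)
  rw [h2, h1]
  refine lintegral_congr_ae ?_
  filter_upwards [ae_servingDist_pos (α := α) (β := β) (S := S) hX] with ω hω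
  have hne : ENNReal.ofReal T * noiseRatio α β σ2 X S G ω ≠ 0 := by
    have hl := pathLoss_pos (α := α) hβ (servingState α β X S ω) hω
    have h4 : ENNReal.ofReal σ2 ≠ 0 := (ENNReal.ofReal_pos.2 hσ2).ne'
    refine mul_ne_zero (ENNReal.ofReal_pos.2 hT).ne' (mul_ne_zero (by simp [hσ2]) ?_)
    exact (ENNReal.ofReal_pos.2 (inv_pos.2 hl)).ne'
  rw [← expMeasure_le_ofReal hμo hne, ← hRω]
  have hm : MeasurableSet {x : ℝ | ENNReal.ofReal T *
      R (((fun n => X n ω), fun n => S n ω), fun n => G n ω) ≤ ENNReal.ofReal x} :=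
    measurableSet_le measurable_const (by fun_prop)
  exact lintegral_indicator_one hm

lemma measurable_interferenceLaplace (hfG : Measurable fG) (i j : LinkState) {σ : ℝ → ℝ}
    (hσ : Measurable σ) : Measurable fun r => interferenceLaplace lam α β fG i j r (σ r) := by
  have h := (measurable_laplaceExponent (lam := lam) (α := α) (β := β) hfG i j).comp
    (measurable_id.prodMk hσ)
  exact measurable_expNeg.comp h

lemma measurable_coverageIntegrand (hfG : Measurable fG) (T : ℝ) (i : LinkState) :
    Measurable (coverageIntegrand lam α β σ2 μo fG T i) := by
  have hσ : Measurable fun r => μo * T / pathLoss α β i r :=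
    measurable_const.div (measurable_pathLoss.comp measurable_prodMk_left)
  refine (((measurable_assocPDF i).mul ?_).mul (measurable_interferenceLaplace hfG i .L hσ)).mul
    (measurable_interferenceLaplace hfG i .N hσ)
  fun_prop

lemma ofReal_coverageIntegrand (hlam : 0 < lam) (hβ : ∀ j, 0 < β j) (hσ2 : 0 < σ2) (hμo : 0 < μo)
    {T : ℝ} (hT : 0 < T) (i : LinkState) {r : ℝ} (hr : 0 < r) :
    ENNReal.ofReal (coverageIntegrand lam α β σ2 μo fG T i r) =
      ENNReal.ofReal (assocPDF lam α β i r) *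
        negExp (∑ j, laplaceExponent lam α β fG i j r (μo * T / pathLoss α β i r)) *
        negExp (ENNReal.ofReal (μo * T / pathLoss α β i r * σ2)) := by
  have hl := pathLoss_pos (α := α) hβ i hr
  have ha := assocPDF_nonneg (α := α) (β := β) hlam i hr.le
  have he : -μo * T * r ^ α i * σ2 / β i = -(μo * T / pathLoss α β i r * σ2) := by
    have hrp : (0 : ℝ) < r ^ α i := Real.rpow_pos_of_pos hr _
    have := hβ i
    rw [pathLoss, Real.rpow_neg hr.le]
    field_simp
  rw [coverageIntegrand, he, sum_linkState, negExp_add, negExp_ofReal (by positivity),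
    ← ofReal_interferenceLaplace, ← ofReal_interferenceLaplace,
    ENNReal.ofReal_mul (mul_nonneg (mul_nonneg ha (Real.exp_pos _).le)
      (interferenceLaplace_nonneg ..)),
    ENNReal.ofReal_mul (mul_nonneg ha (Real.exp_pos _).le), ENNReal.ofReal_mul ha]
  ring

theorem measure_le_sinr_eq_sum (hlam : 0 < lam) (hfG : Measurable fG) (hσ2 : 0 < σ2) (hμo : 0 < μo)
    (hX : IsPoissonPointProcess P (ENNReal.ofReal lam • (volume : Measure Plane)) X)
    (hS : IsStateThinning P X S) (hG : IsGainModel P X S μo fG Go G)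
    (hα : ∀ j, 0 < α j) (hβ : ∀ j, 0 < β j) {T : ℝ} (hT : 0 < T) :
    P {ω | ENNReal.ofReal T ≤ sinr α β σ2 X S Go G ω} =
      ∑ i, ∫⁻ r in Ioi 0, ENNReal.ofReal (coverageIntegrand lam α β σ2 μo fG T i r) := by
  have hτ := measurable_servingState (α := α) (β := β) hX.measurable hS.measurable
  rw [measure_le_sinr hσ2 hμo hX hS hG hβ hT, lintegral_eq_sum_servingState hτ]
  refine Finset.sum_congr rfl fun i _ => ?_
  have hpl : Measurable (pathLoss α β i) := measurable_pathLoss.comp measurable_prodMk_left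
  have hσ0 : ∀ r, 0 ≤ r → 0 ≤ μo * T / pathLoss α β i r := fun r hr =>
    div_nonneg (by positivity) (pathLoss_nonneg hβ i hr)
  -- The Laplace argument `μo T / ℓ^i(r)` is common to both interferences; the noise factor depends
  -- only on the distance and serves as test function.
  have h1 := setLIntegral_comp_servingDist_mul_negExp hlam hfG hX hS hG hα hβ i
    (σ := fun r => μo * T / pathLoss α β i r) (measurable_const.div hpl) hσ0
    (h := fun r => negExp (ENNReal.ofReal (μo * T / pathLoss α β i r * σ2)))
    (measurable_negExp.comp (by fun_prop)) (fun _ => negExp_le_one _)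
  rw [setLIntegral_congr_fun measurableSet_Ioi fun r hr =>
    ofReal_coverageIntegrand (fG := fG) hlam hβ hσ2 hμo hT i hr, ← h1]
  refine setLIntegral_congr_fun (hτ (measurableSet_singleton i)) fun ω hω => ?_
  have hi : servingState α β X S ω = i := hω
  have hd : 0 ≤ servingDist α β X S ω := norm_nonneg _
  have hl0 := pathLoss_nonneg (α := α) hβ i hd
  rw [noiseRatio, hi, ← negExp_add, sum_linkState, ← mul_add,
    ENNReal.ofReal_mul (hσ0 _ hd), ← mul_add, div_eq_mul_inv, ENNReal.ofReal_mul (by positivity),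
    ENNReal.ofReal_mul hμo.le]
  congr 1
  ring

theorem integrableOn_coverageIntegrand_and_coverage_eq (hlam : 0 < lam) (hfG : Measurable fG)
    (hσ2 : 0 < σ2) (hμo : 0 < μo)
    (hX : IsPoissonPointProcess P (ENNReal.ofReal lam • (volume : Measure Plane)) X)
    (hS : IsStateThinning P X S) (hG : IsGainModel P X S μo fG Go G)
    (hα : ∀ j, 0 < α j) (hβ : ∀ j, 0 < β j) {T : ℝ} (hT : 0 < T) :
    (∀ i, IntegrableOn (coverageIntegrand lam α β σ2 μo fG T i) (Ioi (0 : ℝ)) volume) ∧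
      coverage P α β σ2 X S Go G T =
        ∑ i, ∫ r in Ioi (0 : ℝ), coverageIntegrand lam α β σ2 μo fG T i r := by
  have hsum := measure_le_sinr_eq_sum hlam hfG hσ2 hμo hX hS hG hα hβ hT
  have hm := fun i => (measurable_coverageIntegrand (lam := lam) (α := α) (β := β) (σ2 := σ2)
    (μo := μo) hfG T i).aestronglyMeasurable (μ := volume.restrict (Ioi (0 : ℝ)))
  have hnn : ∀ i, 0 ≤ᵐ[volume.restrict (Ioi (0 : ℝ))]
      coverageIntegrand lam α β σ2 μo fG T i := fun i =>
    (ae_restrict_iff' measurableSet_Ioi).2 (Eventually.of_forall fun r hr =>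
      mul_nonneg (mul_nonneg (mul_nonneg (assocPDF_nonneg hlam i (le_of_lt hr))
        (Real.exp_pos _).le) (interferenceLaplace_nonneg ..)) (interferenceLaplace_nonneg ..))
  -- Integrability comes for free: the integrals are nonnegative and sum to a probability.
  have hfin : ∀ i, ∫⁻ r in Ioi 0, ENNReal.ofReal (coverageIntegrand lam α β σ2 μo fG T i r) ≠ ∞ := by
    intro i
    refine ((Finset.single_le_sum (f := fun i => ∫⁻ r in Ioi 0,
      ENNReal.ofReal (coverageIntegrand lam α β σ2 μo fG T i r)) (fun _ _ => zero_le)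
      (Finset.mem_univ i)).trans_lt ?_).ne
    rw [← hsum]
    exact measure_lt_top _ _
  refine ⟨fun i => (lintegral_ofReal_ne_top_iff_integrable (hm i) (hnn i)).1 (hfin i), ?_⟩
  rw [coverage, measureReal_def, hsum, ENNReal.toReal_sum fun i _ => hfin i]
  exact Finset.sum_congr rfl fun i _ => (integral_eq_lintegral_of_nonneg_ae (hnn i) (hm i)).symm

end Coverage

end MmWave

theorem proposition1 {Ω : Type*} [mΩ : MeasurableSpace Ω] (P : Measure Ω) [IsProbabilityMeasure P]
    (lam : ℝ) (hlam : 0 < lam)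
    (α β : MmWave.LinkState → ℝ) (hα : ∀ j, 0 < α j) (hβ : ∀ j, 0 < β j)
    (σ2 : ℝ) (hσ2 : 0 < σ2) (μo : ℝ) (hμo : 0 < μo)
    (fG : ℝ → ℝ) (hfG : Measurable fG) (hfG_nonneg : ∀ g, 0 ≤ fG g)
    (X : ℕ → Ω → MmWave.Plane) (S : ℕ → Ω → MmWave.LinkState) (Go : Ω → ℝ) (G : ℕ → Ω → ℝ)
    (hX : MmWave.IsPoissonPointProcess P (ENNReal.ofReal lam • (volume : Measure MmWave.Plane)) X)
    (hS : MmWave.IsStateThinning P X S)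
    (hG : MmWave.IsGainModel P X S μo fG Go G) :
    -- `f_{r^i}` is the density of the association distance on the event of association in state `i`
    (∀ i : MmWave.LinkState,
      (P.restrict {ω | MmWave.servingState α β X S ω = i}).map (MmWave.servingDist α β X S) =
        (volume.restrict (Set.Ioi (0 : ℝ))).withDensity
          (fun r => ENNReal.ofReal (MmWave.assocPDF lam α β i r))) ∧
    -- the Laplace transform of the interference, given the serving state and distance
    (∀ (j : MmWave.LinkState) (s : ℝ), 0 ≤ s →
      P[fun ω => MmWave.expNeg (ENNReal.ofReal s * MmWave.interference α β X S G j ω) |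
          MeasurableSpace.comap
            (fun ω => (MmWave.servingState α β X S ω, MmWave.servingDist α β X S ω)) inferInstance]
        =ᵐ[P] fun ω => MmWave.interferenceLaplace lam α β fG
          (MmWave.servingState α β X S ω) j (MmWave.servingDist α β X S ω) s) ∧
    -- the coverage probability
    (∀ T : ℝ, 0 < T →
      (∀ i : MmWave.LinkState, IntegrableOn
        (MmWave.coverageIntegrand lam α β σ2 μo fG T i) (Set.Ioi (0 : ℝ)) volume) ∧
      MmWave.coverage P α β σ2 X S Go G T =
        ∑ i : MmWave.LinkState, ∫ r in Set.Ioi (0 : ℝ),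
          MmWave.coverageIntegrand lam α β σ2 μo fG T i r) := by
  refine ⟨fun i => MmWave.map_servingDist hlam hfG hX hS hG hα hβ i,
    fun j s hs => MmWave.condExp_interference hlam hfG hX hS hG hα hβ j hs,
    fun T hT => MmWave.integrableOn_coverageIntegrand_and_coverage_eq hlam hfG hσ2 hμo hX hS hG
      hα hβ hT⟩
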